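/- **Setting.** Let $\Omega\subset\mathbb R^N$ be a bounded open set with Lipschitz boundary, $T>0$, $Q=\Omega\times(0,T)$. Let $\boldsymbol\Phi=\boldsymbol\Phi(x,t,u)$ (with values in $\mathbb R^N$) and $f=f(x,t,u)$ be such that, for every $R>0$, $\boldsymbol\Phi\in \boldsymbol W^{2,\infty}(Q\times(-R,R))$ and $f\in W^{1,\infty}(Q\times(-R,R))$ (continuous representatives), and such that for some constants $c_1,c_2>0$, for a.e. $(x,t)\in Q$ and all $u\in\mathbb R$, $$|(\nabla\cdot\boldsymbol\Phi)(x,t,u)+f(x,t,u)|\le c_1|u|+c_2,$$ where $\nabla\cdot$ is the divergence in $x$ at fixed $(t,u)$. Let $G=G(x,u):\Omega\times\mathbb R\to\mathbb R$ belong to $C(\mathbb R;L^\infty(\Omega))$ (with $u\mapsto G(x,u)$ continuous for a.e. $x$), with $G(x,u)\ge\lambda>0$ for a.e. $x\in\Omega$ and all $u\in\mathbb R$. Fix an extension of $G$ to $\mathbb R^N\times\mathbb R$ with the same properties on $\mathbb R^N$ (for instance by $\lambda$ outside $\Omega$), still denoted by $G$. Let $u_0\in H^1_0(\Omega)$ be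 continuous on $\overline\Omega$, zero on $\partial\Omega$, with $|\nabla u_0(x)|\le G(x,u_0(x))$ for a.e. $x\in\Omega$. Let $C_0$ be a constant. For $0<\varepsilon<1$ and $0<\delta<1$, let $k_\varepsilon:\mathbb R\to\mathbb R$ be smooth and nondecreasing with $k_\varepsilon(s)=1$ for $s\le0$ and $k_\varepsilon(s)=e^{s/\varepsilon}$ for $s\ge\varepsilon$; let $G_\varepsilon=G*\rho_\varepsilon$, where $\rho_\varepsilon\ge0$ is a smooth function of $(x,u)$ with integral $1$, supported in the set $|x|\le\varepsilon$, $|u|\le\varepsilon$; and let $u_0^{\varepsilon\delta}\in\mathscr D(\Omega)$ satisfy $|u_0^{\varepsilon\delta}|\le\max_{\overline\Omega}|u_0|+1$ in $\Omega$, $|\nabla u_0^{\varepsilon\delta}|\le|\nabla u_0|$ a.e. in $\Omega$, $|\nabla u_0^{\varepsilon\delta}(x)|\le G_\varepsilon(x,u_0^{\varepsilon\delta}(x))$ in $\Omega$ and $\|\Delta u_0^{\varepsilon\delta}\|_{L^1(\Omega)}\le C_0/\delta$. Let $w=u^{\varepsilon\delta}$ be a classical solution (continuous on $\overline Q$, with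 $\partial_tw$, $\nabla w$ and $D^2w$ existing and continuous in $Q$) of $$\partial_tw-\nabla\cdot\big[\delta k_\varepsilon(|\nabla w|^2-G_\varepsilon^2(w))\nabla w+\boldsymbol\Phi(w)\big]=f(w)\ \text{ in }Q,\qquad w(0)=u_0^{\varepsilon\delta}\ \text{ in }\Omega,\qquad w=0\ \text{ on }\partial\Omega\times(0,T),$$ where $\boldsymbol\Phi(w)=\boldsymbol\Phi(x,t,w(x,t))$, $f(w)=f(x,t,w(x,t))$, $G_\varepsilon(w)=G_\varepsilon(x,w(x,t))$. **Claim.** There exist positive constants $C_1,C_2,K,C$ and $D_q$ $(2\le q<\infty)$, independent of $\varepsilon$, $\delta$, $k_\varepsilon$, $\rho_\varepsilon$, $u_0^{\varepsilon\delta}$ and $u^{\varepsilon\delta}$, such that for all such $\varepsilon,\delta$ and all solutions $u^{\varepsilon\delta}$ as above: 1. for all $(x,t)\in Q$, with $b_1=c_1+\tfrac12$ and $b_2=\tfrac12c_2^2$, $$|u^{\varepsilon\delta}(x,t)|\le M=\inf_{l>b_1}e^{lT}\max\Big\{\max_{\overline\Omega}|u_0|+1,\Big(\frac{b_2}{l-b_1}\Big)^{1/2}\Big\};$$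 in particular $M$ is independent of $\varepsilon$ and $\delta$; 2. $\|\partial_tu^{\varepsilon\delta}\|_{L^\infty(0,T;L^1(\Omega))}\le e^{C_2T}\big(C_1+K\|\nabla u^{\varepsilon\delta}\|_{L^1(Q)}\big)$; 3. $\|k_\varepsilon(|\nabla u^{\varepsilon\delta}|^2-G_\varepsilon^2(u^{\varepsilon\delta}))\|_{L^\infty(0,T;L^1(\Omega))}\le C/\delta^2$; 4. for all $2\le q<\infty$, $\|\nabla u^{\varepsilon\delta}\|_{L^\infty(0,T;L^q(\Omega))}\le D_q/\delta^2$. -/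

import Mathlib

open MeasureTheory Set Filter Topology
open scoped ContDiff ENNReal

noncomputable section

namespace GradConstraint

/-- The space `ℝ^N` with its Euclidean norm. -/
abbrev Space (N : ℕ) : Type := EuclideanSpace ℝ (Fin N)

/-- The space-time cylinder `Q = Ω × (0,T)`. -/
def cylinder {N : ℕ} (Ω : Set (Space N)) (T : ℝ) : Set (Space N × ℝ) := Ω ×ˢ Ioo 0 T

/-- The boundary of `Ω` is locally the graph of a Lipschitz function over a hyperplane `e^⊥`,
with `Ω` lying on one side of it. -/
def HasLipschitzBoundary {N : ℕ} (Ω : Set (Space N)) : Prop :=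
  ∀ p ∈ frontier Ω, ∃ (e : Space N) (r : ℝ) (L : NNReal) (γ : Space N → ℝ),
    ‖e‖ = 1 ∧ 0 < r ∧ LipschitzWith L γ ∧ (∀ (x : Space N) (s : ℝ), γ (x + s • e) = γ x) ∧
    ∀ x ∈ Metric.ball p r, x ∈ Ω ↔ γ x < inner ℝ e x

/-- The divergence `∑ᵢ ∂ᵢ Fᵢ` of a vector field. -/
def divergence {N : ℕ} (F : Space N → Space N) (x : Space N) : ℝ :=
  ∑ i, (fderiv ℝ F x (EuclideanSpace.single i 1)) i

/-- The spatial gradient `∇w(x,t)`. -/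
def spaceGrad {N : ℕ} (w : Space N → ℝ → ℝ) (x : Space N) (t : ℝ) : Space N :=
  gradient (fun y => w y t) x

/-- The time derivative `∂ₜw(x,t)`. -/
def timeDeriv {N : ℕ} (w : Space N → ℝ → ℝ) (x : Space N) (t : ℝ) : ℝ :=
  deriv (w x) t

/-- The test functions `𝒟(U)`. -/
structure IsTestFunction {V : Type*} [NormedAddCommGroup V] [NormedSpace ℝ V]
    (U : Set V) (φ : V → ℝ) : Prop where
  smooth : ContDiff ℝ ∞ φ
  compact : HasCompactSupport φ
  support : tsupport φ ⊆ U

/-- `h` is the weak derivative of `g` in the direction `v` on `U`. -/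
def HasWeakDeriv {V : Type*} [NormedAddCommGroup V] [NormedSpace ℝ V] [MeasureSpace V]
    (U : Set V) (v : V) (g h : V → ℝ) : Prop :=
  ∀ φ : V → ℝ, IsTestFunction U φ →
    ∫ z in U, g z * fderiv ℝ φ z v = - ∫ z in U, h z * φ z

/-- The Sobolev space `W^{m,∞}(U)`. -/
def MemWInfty {V : Type*} [NormedAddCommGroup V] [NormedSpace ℝ V] [MeasureSpace V]
    (U : Set V) : ℕ → (V → ℝ) → Prop
  | 0, g => MemLp g ⊤ (volume.restrict U)
  | m + 1, g => MemLp g ⊤ (volume.restrict U) ∧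
      ∀ v : V, ∃ h : V → ℝ, MemWInfty U m h ∧ HasWeakDeriv U v g h

/-- `u ∈ H¹₀(Ω)` with weak gradient `g`: a limit of test functions in the `H¹` norm. -/
structure HasH10Gradient {N : ℕ} (Ω : Set (Space N)) (u : Space N → ℝ)
    (g : Space N → Space N) : Prop where
  memLp : MemLp u 2 (volume.restrict Ω)
  grad_memLp : MemLp g 2 (volume.restrict Ω)
  approx : ∃ φ : ℕ → Space N → ℝ, (∀ n, IsTestFunction Ω (φ n)) ∧
    Tendsto (fun n => eLpNorm (fun x => φ n x - u x) 2 (volume.restrict Ω)) atTop (𝓝 0) ∧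
    Tendsto (fun n => eLpNorm (fun x => gradient (φ n) x - g x) 2 (volume.restrict Ω))
      atTop (𝓝 0)

/-- The flux `Φ` and the source `f`, both in their continuous representatives:
for every `R > 0`, `Φ ∈ W^{2,∞}(Q × (-R,R))` and `f ∈ W^{1,∞}(Q × (-R,R))`;
`|∇·Φ + f| ≤ c₁|u| + c₂`, where `∇·` is the divergence in `x` at frozen `t`, `u`. -/
structure IsAdmissibleFluxSource {N : ℕ} (Ω : Set (Space N)) (T : ℝ)
    (Φ : Space N → ℝ → ℝ → Space N) (f : Space N → ℝ → ℝ → ℝ) (c₁ c₂ : ℝ) : Prop where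
  flux_cont : ContinuousOn (fun z : Space N × ℝ × ℝ => Φ z.1 z.2.1 z.2.2)
    (Ω ×ˢ Ioo 0 T ×ˢ univ)
  source_cont : ContinuousOn (fun z : Space N × ℝ × ℝ => f z.1 z.2.1 z.2.2)
    (Ω ×ˢ Ioo 0 T ×ˢ univ)
  flux_sobolev : ∀ R : ℝ, 0 < R → ∀ i : Fin N,
    MemWInfty (Ω ×ˢ Ioo 0 T ×ˢ Ioo (-R) R) 2
      (fun z : Space N × ℝ × ℝ => Φ z.1 z.2.1 z.2.2 i)
  source_sobolev : ∀ R : ℝ, 0 < R →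
    MemWInfty (Ω ×ˢ Ioo 0 T ×ˢ Ioo (-R) R) 1
      (fun z : Space N × ℝ × ℝ => f z.1 z.2.1 z.2.2)
  c₁_pos : 0 < c₁
  c₂_pos : 0 < c₂
  growth : ∀ᵐ z ∂(volume.restrict (cylinder Ω T)), ∀ u : ℝ,
    |divergence (fun y => Φ y z.2 u) z.1 + f z.1 z.2 u| ≤ c₁ * |u| + c₂

/-- `G ∈ C(ℝ; L^∞(A))` and `G ≥ lam > 0`, with `G(x,·)` continuous for a.e. `x`
(the representative for which `x ↦ G(x,u(x))` is meaningful). -/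
structure IsThreshold {N : ℕ} (A : Set (Space N)) (lam : ℝ) (G : Space N → ℝ → ℝ) :
    Prop where
  memLp : ∀ u : ℝ, MemLp (fun x => G x u) ⊤ (volume.restrict A)
  cont : ∀ u₀ : ℝ, Tendsto
    (fun u => eLpNorm (fun x => G x u - G x u₀) ⊤ (volume.restrict A)) (𝓝 u₀) (𝓝 0)
  cont_rep : ∀ᵐ x ∂(volume.restrict A), Continuous (G x)
  lam_pos : 0 < lam
  lower : ∀ᵐ x ∂(volume.restrict A), ∀ u : ℝ, lam ≤ G x u

/-- `u₀ ∈ K_{G(u₀)} ∩ C₀(Ω̄)`, with weak gradient `du₀`. -/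
structure IsAdmissibleInitial {N : ℕ} (Ω : Set (Space N)) (G : Space N → ℝ → ℝ)
    (u₀ : Space N → ℝ) (du₀ : Space N → Space N) : Prop where
  cont : ContinuousOn u₀ (closure Ω)
  boundary : ∀ x ∈ frontier Ω, u₀ x = 0
  sobolev : HasH10Gradient Ω u₀ du₀
  constraint : ∀ᵐ x ∂(volume.restrict Ω), ‖du₀ x‖ ≤ G x (u₀ x)

/-- `max_{Ω̄} |u₀|`. -/
def supNorm {N : ℕ} (Ω : Set (Space N)) (u₀ : Space N → ℝ) : ℝ :=
  sSup ((fun x => |u₀ x|) '' closure Ω)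

/-- The penalty function `k_ε`. -/
structure IsPenalty (ε : ℝ) (k : ℝ → ℝ) : Prop where
  smooth : ContDiff ℝ ∞ k
  mono : Monotone k
  eq_one : ∀ s ≤ 0, k s = 1
  eq_exp : ∀ s, ε ≤ s → k s = Real.exp (s / ε)

/-- A mollifier `ρ_ε` in the variables `(x,u)`. -/
structure IsMollifier {N : ℕ} (ε : ℝ) (ρ : Space N × ℝ → ℝ) : Prop where
  smooth : ContDiff ℝ ∞ ρ
  nonneg : ∀ z, 0 ≤ ρ z
  support : Function.support ρ ⊆ Metric.closedBall 0 ε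
  integral_eq_one : ∫ z, ρ z = 1

/-- The mollified threshold `G_ε = G * ρ_ε`, a convolution on `ℝ^N × ℝ`. -/
def mollified {N : ℕ} (G : Space N → ℝ → ℝ) (ρ : Space N × ℝ → ℝ)
    (x : Space N) (u : ℝ) : ℝ :=
  convolution (fun z : Space N × ℝ => G z.1 z.2) ρ (ContinuousLinearMap.mul ℝ ℝ) volume (x, u)

/-- The regularized initial datum `u₀^{εδ} = v₀`. -/
structure IsRegularizedInitial {N : ℕ} (Ω : Set (Space N)) (Gε : Space N → ℝ → ℝ)
    (u₀ : Space N → ℝ) (du₀ : Space N → Space N) (C₀ δ : ℝ) (v₀ : Space N → ℝ) : Prop where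
  test : IsTestFunction Ω v₀
  sup_le : ∀ x ∈ Ω, |v₀ x| ≤ supNorm Ω u₀ + 1
  grad_le : ∀ᵐ x ∂(volume.restrict Ω), ‖gradient v₀ x‖ ≤ ‖du₀ x‖
  grad_le_threshold : ∀ x ∈ Ω, ‖gradient v₀ x‖ ≤ Gε x (v₀ x)
  laplacian_le : ∫ x in Ω, |divergence (gradient v₀) x| ≤ C₀ / δ

/-- The penalty `k_ε(|∇w|² - G_ε²(w))` at `(x,t)`. -/
def penalty {N : ℕ} (k : ℝ → ℝ) (Gε : Space N → ℝ → ℝ) (w : Space N → ℝ → ℝ)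
    (x : Space N) (t : ℝ) : ℝ :=
  k (‖spaceGrad w x t‖ ^ 2 - (Gε x (w x t)) ^ 2)

/-- `w` is a classical solution of
`∂ₜw - ∇·[δ k_ε(|∇w|² - G_ε²(w)) ∇w + Φ(w)] = f(w)` in `Q`, `w(0) = v₀` in `Ω`,
`w = 0` on `∂Ω × (0,T)`: it is continuous on `Q̄`, and `∂ₜw`, `∇w`, `D²w` exist and are
continuous in `Q`. -/
structure IsClassicalSolution {N : ℕ} (Ω : Set (Space N)) (T δ : ℝ) (k : ℝ → ℝ)
    (Gε : Space N → ℝ → ℝ) (Φ : Space N → ℝ → ℝ → Space N) (f : Space N → ℝ → ℝ → ℝ)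
    (v₀ : Space N → ℝ) (w : Space N → ℝ → ℝ) : Prop where
  cont : ContinuousOn (fun z : Space N × ℝ => w z.1 z.2) (closure Ω ×ˢ Icc 0 T)
  diff_time : ∀ x ∈ Ω, ∀ t ∈ Ioo 0 T, DifferentiableAt ℝ (w x) t
  diff_space : ∀ t ∈ Ioo 0 T, ContDiffOn ℝ 2 (fun x => w x t) Ω
  cont_time : ContinuousOn (fun z : Space N × ℝ => timeDeriv w z.1 z.2) (cylinder Ω T)
  cont_grad : ContinuousOn (fun z : Space N × ℝ => spaceGrad w z.1 z.2) (cylinder Ω T)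
  cont_hess : ContinuousOn
    (fun z : Space N × ℝ => fderiv ℝ (fun y => spaceGrad w y z.2) z.1) (cylinder Ω T)
  equation : ∀ x ∈ Ω, ∀ t ∈ Ioo 0 T,
    timeDeriv w x t
      - divergence (fun y => (δ * penalty k Gε w y t) • spaceGrad w y t + Φ y t (w y t)) x
      = f x t (w x t)
  initial : ∀ x ∈ Ω, w x 0 = v₀ x
  boundary : ∀ x ∈ frontier Ω, ∀ t ∈ Ioo 0 T, w x t = 0

/-- The norm of `L^∞(0,T; L^q(Ω))`. -/
def normLinftyLq {N : ℕ} {F : Type*} [NormedAddCommGroup F] (Ω : Set (Space N)) (T : ℝ)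
    (q : ℝ≥0∞) (g : Space N → ℝ → F) : ℝ≥0∞ :=
  essSup (fun t => eLpNorm (fun x => g x t) q (volume.restrict Ω)) (volume.restrict (Ioo 0 T))

/-- `inf_{l > b₁} e^{lT} max {m, (b₂ / (l - b₁))^{1/2}}` with `m = max|u₀| + 1`,
`b₁ = c₁ + 1/2`, `b₂ = c₂²/2`. -/
def boundM {N : ℕ} (Ω : Set (Space N)) (T : ℝ) (u₀ : Space N → ℝ) (c₁ c₂ : ℝ) : ℝ :=
  ⨅ l : Ioi (c₁ + 1 / 2), Real.exp ((l : ℝ) * T) *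
    max (supNorm Ω u₀ + 1) (Real.sqrt ((c₂ ^ 2 / 2) / ((l : ℝ) - (c₁ + 1 / 2))))

end GradConstraint

end

open GradConstraint

/-!
All estimates come from testing the equation `∂ₜw = ∇·A + f(w)`,
`A = δ k(|∇w|² - G_ε²(w)) ∇w + Φ(w)`, with functions of `w` that are cut off near `0`. Since `w`
is continuous on `Q̄` and vanishes on `∂Ω`, such test functions have compact support in `Ω`, and
neither the regularity of `∂Ω` nor that of `w` up to `∂Ω` matters
(`IsConservationLaw.integral_truncation_mul_timeDeriv`). The level of the cut-off is then sent
to `0`.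

* The sup bound is the maximum principle for `e^{-lt} w`. At an interior spatial extremum of `w`
  the gradient vanishes and the equation becomes `∂ₜw = δ k Δw + (∇·Φ)(w) + f(w)`, so that only
  the growth condition on `∇·Φ + f` enters (`IsClassicalSolution.abs_le_boundM`).
* The map `p ↦ k(|p|² - s) p` is monotone for fixed `s`. For the difference `z` of two solutions
  the threshold depends on the solution, which costs a term `O(|z|) k`, and `Φ` costs a term
  `O(|z|) |∇z|`. Tested with an approximation `β` of the sign of `z`, these errors carry the
  factor `|z| β'(z)`, which is bounded and tends to `0` pointwise; so they disappear in the limit,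
  although their constants depend on `ε`. This gives an `L¹` comparison with constants that depend
  only on the data (`integral_abs_sub_le`).
* Comparing `w` with the stationary function `u₀^{εδ}`, for which `k = 1`, gives
  `‖w(τ) - u₀^{εδ}‖₁ ≤ C τ` from the bound of the Laplacian
  (`IsBoundedSolution.integral_abs_sub_initial_le`). Comparing `w(· + τ)` with `w` propagates this
  to all times, the explicit dependence of the data on `t` costing `C τ (1 + |∇w|)`. Fatou's lemma
  for the difference quotients then bounds `∂ₜw` in `L¹(Ω)` at every time
  (`IsBoundedSolution.lintegral_timeDeriv_le`).
* Testing with `w` bounds the energy `δ k |∇w|²` in `L¹(Q)` by `C/δ`, hence `‖∇w‖_{L¹(Q)}` by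
  `C/δ` as well. At a fixed time the same test leaves `M ‖∂ₜw‖₁`, which is now at most `C/δ`.
  Where `k ≠ 1` one has `|∇w| ≥ λ`, so `k` is at most `C/δ²` in `L¹(Ω)`
  (`IsBoundedSolution.lintegral_penalty_slice_le`).
* As `k(s) ≥ e^{s - 1}` for `s ≥ 0`, whatever `ε < 1` is, the penalty dominates every power of
  `|∇w|` (`exists_rpow_norm_le_penalty`), and the `L^q` bounds follow.

The hypotheses on `Φ` and `f` are stated with weak derivatives. Mollification shows that a
continuous function of class `W^{2,∞}` is `C¹`, with the bounds of its first derivatives and of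
their difference quotients that are needed (`MemWInfty.contDiffOn`,
`MemWInfty.exists_abs_fderiv_sub_le`), and that a continuous function of class `W^{1,∞}` is
Lipschitz along segments (`abs_sub_le_of_hasWeakDeriv`).
-/

namespace GradConstraint

/-! ### Mollification on an open set -/

section Segments

variable {V : Type*} [NormedAddCommGroup V] [NormedSpace ℝ V]

/-- Bumps at the origin with radii tending to `0`. -/
noncomputable def shrinkingBump (V : Type*) [NormedAddCommGroup V] [NormedSpace ℝ V] (n : ℕ) :
    ContDiffBump (0 : V) where
  rIn := 1 / ((n : ℝ) + 1) / 2
  rOut := 1 / ((n : ℝ) + 1)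
  rIn_pos := by positivity
  rIn_lt_rOut := half_lt_self (by positivity)

theorem tendsto_shrinkingBump_rOut :
    Tendsto (fun n => (shrinkingBump V n).rOut) atTop (𝓝 0) :=
  tendsto_one_div_add_atTop_nhds_zero_nat

theorem abs_sub_le_of_fderiv_le {F : V → ℝ} (hF : Differentiable ℝ F) {z v : V} {s C : ℝ}
    (hs : 0 ≤ s) (hC : ∀ σ ∈ Icc 0 s, |fderiv ℝ F (z + σ • v) v| ≤ C) :
    |F (z + s • v) - F z| ≤ C * s := by
  have hd : ∀ σ ∈ Icc 0 s, HasDerivWithinAt (fun σ : ℝ => F (z + σ • v))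
      (fderiv ℝ F (z + σ • v) v) (Icc 0 s) σ := by
    intro σ _
    have h1 : HasDerivAt (fun σ : ℝ => z + σ • v) v σ := by
      simpa using ((hasDerivAt_id σ).smul_const v).const_add z
    exact ((hF _).hasFDerivAt.comp_hasDerivAt σ h1).hasDerivWithinAt
  have := (convex_Icc 0 s).norm_image_sub_le_of_norm_hasDerivWithin_le hd hC
    (left_mem_Icc.2 hs) (right_mem_Icc.2 hs)
  simpa [abs_of_nonneg hs] using this

theorem isCompact_segment_image (z v : V) (s : ℝ) :
    IsCompact ((fun σ : ℝ => z + σ • v) '' Icc 0 s) :=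
  isCompact_Icc.image (by fun_prop)

theorem MemWInfty.memLp [MeasureSpace V] {U : Set V} {m : ℕ} {g : V → ℝ} (h : MemWInfty U m g) :
    MemLp g ⊤ (volume.restrict U) := by
  cases m with
  | zero => exact h
  | succ m => exact h.1

end Segments

section Mollification

variable {V : Type*} [NormedAddCommGroup V] [NormedSpace ℝ V] [FiniteDimensional ℝ V]
  [MeasureSpace V] [BorelSpace V] [(volume : Measure V).IsAddHaarMeasure]

/-- The mollification `ρ * (g 1_U)` of a function on `U` by a normalized bump `ρ`. -/
noncomputable def smoothing (U : Set V) (ρ : ContDiffBump (0 : V)) (g : V → ℝ) : V → ℝ :=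
  convolution (ρ.normed volume) (U.indicator g) (ContinuousLinearMap.lsmul ℝ ℝ) volume

theorem smoothing_apply {U : Set V} (hU : IsOpen U) (ρ : ContDiffBump (0 : V)) (g : V → ℝ)
    (z : V) : smoothing U ρ g z = ∫ y in U, g y * ρ.normed volume (z - y) := by
  rw [smoothing, convolution_eq_swap, ← integral_indicator hU.measurableSet]
  congr 1
  ext y
  by_cases hy : y ∈ U <;> simp [hy, mul_comm]

theorem locallyIntegrable_indicator {U : Set V} (hU : IsOpen U) {g : V → ℝ}
    (hg : MemLp g ⊤ (volume.restrict U)) : LocallyIntegrable (U.indicator g) volume :=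
  ((memLp_indicator_iff_restrict hU.measurableSet).2 hg).locallyIntegrable le_top

theorem exists_ae_abs_le_of_memLp_top {α : Type*} [MeasurableSpace α] {μ : Measure α} {g : α → ℝ}
    (hg : MemLp g ⊤ μ) : ∃ C : ℝ, 0 ≤ C ∧ ∀ᵐ z ∂μ, |g z| ≤ C := by
  refine ⟨(eLpNorm g ⊤ μ).toReal, ENNReal.toReal_nonneg, ?_⟩
  have h := ae_le_eLpNormEssSup (f := g) (μ := μ)
  filter_upwards [h] with z hz
  rw [← eLpNorm_exponent_top] at hz
  have := ENNReal.toReal_mono hg.2.ne hz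
  simpa using this

theorem tsupport_reflect_subset {U : Set V} (ρ : ContDiffBump (0 : V)) {z : V}
    (hz : Metric.closedBall z ρ.rOut ⊆ U) :
    tsupport (fun y => ρ.normed volume (z - y)) ⊆ U := by
  refine (closure_minimal ?_ Metric.isClosed_closedBall).trans hz
  intro y hy
  have : z - y ∈ Function.support (ρ.normed (volume : Measure V)) := hy
  rw [ρ.support_normed_eq] at this
  rw [Metric.mem_closedBall, dist_comm, dist_eq_norm]
  simpa using (mem_ball_zero_iff.1 this).le

theorem isTestFunction_reflect {U : Set V} (ρ : ContDiffBump (0 : V)) {z : V}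
    (hz : Metric.closedBall z ρ.rOut ⊆ U) :
    IsTestFunction U (fun y => ρ.normed volume (z - y)) where
  smooth := ρ.contDiff_normed.comp (contDiff_const.sub contDiff_id)
  compact := by
    refine HasCompactSupport.of_support_subset_isCompact (isCompact_closedBall z ρ.rOut) ?_
    exact (subset_tsupport _).trans (tsupport_reflect_subset ρ le_rfl)
  support := tsupport_reflect_subset ρ hz

theorem contDiff_smoothing {U : Set V} (hU : IsOpen U) (ρ : ContDiffBump (0 : V))
    {g : V → ℝ} (hg : MemLp g ⊤ (volume.restrict U)) :
    ContDiff ℝ ∞ (smoothing U ρ g) :=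
  ρ.hasCompactSupport_normed.contDiff_convolution_left _ ρ.contDiff_normed
    (locallyIntegrable_indicator hU hg)

/-- Mollification commutes with weak derivatives at the points that are far enough from the
boundary. -/
theorem fderiv_smoothing {U : Set V} (hU : IsOpen U) (ρ : ContDiffBump (0 : V)) {v : V}
    {g h : V → ℝ} (hg : MemLp g ⊤ (volume.restrict U)) (hgh : HasWeakDeriv U v g h) {z : V}
    (hz : Metric.closedBall z ρ.rOut ⊆ U) :
    fderiv ℝ (smoothing U ρ g) z v = smoothing U ρ h z := by
  have hloc := locallyIntegrable_indicator hU hg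
  have h1 := (ρ.hasCompactSupport_normed (μ := volume)).hasFDerivAt_convolution_left
    (ContinuousLinearMap.lsmul ℝ ℝ) ρ.contDiff_normed hloc z
  have h2 : fderiv ℝ (smoothing U ρ g) z = _ := h1.fderiv
  have hT := hgh _ (isTestFunction_reflect ρ hz)
  have hd : ∀ y, fderiv ℝ (fun y => ρ.normed volume (z - y)) y v
      = - fderiv ℝ (ρ.normed volume) (z - y) v := by
    intro y
    have hρ : DifferentiableAt ℝ (ρ.normed (volume : Measure V)) (z - y) :=
      (ρ.contDiff_normed (n := 1)).differentiable (by simp) _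
    have := hρ.hasFDerivAt.comp y ((hasFDerivAt_const z y).sub (hasFDerivAt_id y))
    have h3 : fderiv ℝ (fun y => ρ.normed volume (z - y)) y = _ := this.fderiv
    rw [h3]; simp
  rw [h2, convolution_eq_swap, ContinuousLinearMap.integral_apply, smoothing_apply hU]
  · simp only [hd] at hT
    have h4 : ∀ y, g y * -(fderiv ℝ (ρ.normed volume) (z - y)) v
      = -(g y * (fderiv ℝ (ρ.normed volume) (z - y)) v) := fun y => by ring
    simp only [h4, integral_neg, neg_inj] at hT
    rw [← hT, ← integral_indicator hU.measurableSet]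
    congr 1
    ext y
    by_cases hy : y ∈ U <;> simp [hy, mul_comm, ContinuousLinearMap.precompL_apply]
  · have hc : HasCompactSupport (fderiv ℝ (ρ.normed (volume : Measure V))) :=
      ρ.hasCompactSupport_normed.fderiv ℝ
    have hcont : Continuous (fderiv ℝ (ρ.normed (volume : Measure V))) :=
      (ρ.contDiff_normed (n := 1)).continuous_fderiv (by simp)
    have h5 : ConvolutionExistsAt (fderiv ℝ (ρ.normed (volume : Measure V))) (U.indicator g) z
        ((ContinuousLinearMap.lsmul ℝ ℝ : ℝ →L[ℝ] ℝ →L[ℝ] ℝ).precompL V) volume :=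
      hc.convolutionExists_left _ hcont hloc z
    exact h5.integrable_swap

theorem abs_smoothing_le {U : Set V} (hU : IsOpen U) (ρ : ContDiffBump (0 : V)) {h : V → ℝ}
    {C : ℝ} (hC : ∀ᵐ z ∂(volume.restrict U), |h z| ≤ C) (hC0 : 0 ≤ C) (z : V) :
    |smoothing U ρ h z| ≤ C := by
  have hi : Integrable (fun y => C * ρ.normed volume (z - y)) volume :=
    ((ρ.integrable_normed (μ := volume)).comp_sub_left z).const_mul C
  have h1 : ∫ y, C * ρ.normed volume (z - y) = C := by
    rw [integral_const_mul, integral_sub_left_eq_self (fun y => ρ.normed volume y) volume z,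
      ρ.integral_normed, mul_one]
  rw [smoothing_apply hU, ← Real.norm_eq_abs]
  calc ‖∫ y in U, h y * ρ.normed volume (z - y)‖
      ≤ ∫ y in U, C * ρ.normed volume (z - y) := by
        refine norm_integral_le_of_norm_le hi.integrableOn ?_
        filter_upwards [hC] with y hy
        rw [norm_mul, Real.norm_eq_abs, Real.norm_of_nonneg (ρ.nonneg_normed _)]
        exact mul_le_mul_of_nonneg_right hy (ρ.nonneg_normed _)
    _ ≤ ∫ y, C * ρ.normed volume (z - y) :=
        setIntegral_le_integral hi
          (Eventually.of_forall fun y => mul_nonneg hC0 (ρ.nonneg_normed _))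
    _ = C := h1

theorem abs_smoothing_sub_le {U : Set V} (hU : IsOpen U) (ρ : ContDiffBump (0 : V)) {g : V → ℝ}
    (hg : MemLp g ⊤ (volume.restrict U)) {z : V} {η : ℝ}
    (hz : ∀ y ∈ Metric.ball z ρ.rOut, y ∈ U ∧ |g y - g z| ≤ η) :
    |smoothing U ρ g z - g z| ≤ η := by
  have hzU := (hz z (Metric.mem_ball_self ρ.rOut_pos)).1
  have h := ρ.dist_normed_convolution_le (μ := volume) (g := U.indicator g) (x₀ := z) (ε := η)
    (locallyIntegrable_indicator hU hg).aestronglyMeasurable ?_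
  · rw [Real.dist_eq, indicator_of_mem hzU] at h
    exact h
  · intro y hy
    rw [indicator_of_mem hzU, indicator_of_mem (hz y hy).1, Real.dist_eq]
    exact (hz y hy).2

/-- On a compact subset of `U`, mollifications converge uniformly to a continuous function, and
the points of the compact set are eventually far from the boundary. -/
theorem eventually_abs_smoothing_sub_le {U K : Set V} (hU : IsOpen U) (hK : IsCompact K)
    (hKU : K ⊆ U) {g : V → ℝ} (hg : MemLp g ⊤ (volume.restrict U)) (hgc : ContinuousOn g U)
    {η : ℝ} (hη : 0 < η) :
    ∀ᶠ n in atTop, ∀ z ∈ K, Metric.closedBall z (shrinkingBump V n).rOut ⊆ U ∧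
      |smoothing U (shrinkingBump V n) g z - g z| ≤ η := by
  obtain ⟨r, hr, hrU⟩ := hK.exists_cthickening_subset_open hU hKU
  have hc : IsCompact (Metric.cthickening r K) := hK.cthickening
  have huc := hc.uniformContinuousOn_of_continuous (hgc.mono hrU)
  obtain ⟨d, hd, hdist⟩ := Metric.uniformContinuousOn_iff.1 huc η hη
  have h0 := (tendsto_order.1 (tendsto_shrinkingBump_rOut (V := V))).2 (min r d) (lt_min hr hd)
  filter_upwards [h0] with n hn z hz
  have hb : Metric.closedBall z (shrinkingBump V n).rOut ⊆ Metric.cthickening r K :=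
    (Metric.closedBall_subset_closedBall (hn.le.trans (min_le_left _ _))).trans
      (Metric.closedBall_subset_cthickening hz r)
  refine ⟨hb.trans hrU, abs_smoothing_sub_le hU _ hg fun y hy => ?_⟩
  have hy' := Metric.ball_subset_closedBall hy
  refine ⟨hrU (hb hy'), ?_⟩
  rw [← Real.dist_eq]
  exact (hdist y (hb hy') z (hb (Metric.mem_closedBall_self (shrinkingBump V n).rOut_pos.le))
    ((Metric.mem_ball.1 hy).trans_le (hn.le.trans (min_le_right _ _)))).le

/-- A continuous function with a bounded weak derivative in the direction `v` is Lipschitz along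
the segments of direction `v`. -/
theorem abs_sub_le_of_hasWeakDeriv {U : Set V} (hU : IsOpen U) {g h : V → ℝ}
    (hg : MemLp g ⊤ (volume.restrict U)) (hgc : ContinuousOn g U) {v : V}
    (hgh : HasWeakDeriv U v g h) {C : ℝ} (hC0 : 0 ≤ C)
    (hC : ∀ᵐ z ∂(volume.restrict U), |h z| ≤ C) {z : V} {s : ℝ} (hs : 0 ≤ s)
    (hseg : ∀ σ ∈ Icc 0 s, z + σ • v ∈ U) :
    |g (z + s • v) - g z| ≤ C * s := by
  refine le_of_forall_pos_le_add fun η hη => ?_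
  have hK := isCompact_segment_image z v s
  have hKU : (fun σ : ℝ => z + σ • v) '' Icc 0 s ⊆ U := by
    rintro _ ⟨σ, hσ, rfl⟩; exact hseg σ hσ
  obtain ⟨n, hn⟩ := (eventually_abs_smoothing_sub_le hU hK hKU hg hgc
    (half_pos hη)).exists
  have h1 := (hn _ (mem_image_of_mem _ (right_mem_Icc.2 hs))).2
  have h0 := (hn _ (mem_image_of_mem _ (left_mem_Icc.2 hs))).2
  simp only [zero_smul, add_zero] at h0
  have h2 := abs_sub_le_of_fderiv_le (z := z) (v := v) (C := C)
    ((contDiff_smoothing hU (shrinkingBump V n) hg).differentiable (by simp)) hs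
    (fun σ hσ => by
      rw [fderiv_smoothing hU _ hg hgh (hn _ (mem_image_of_mem _ hσ)).1]
      exact abs_smoothing_le hU _ hC hC0 _)
  rw [abs_le] at *
  constructor <;> linarith [h0.1, h0.2, h1.1, h1.2, h2.1, h2.2]

end Mollification

/-! ### Regularity of functions of class `W^{2,∞}` -/

section SobolevRegularity

variable {V : Type*} [NormedAddCommGroup V] [NormedSpace ℝ V] [FiniteDimensional ℝ V]
  [MeasureSpace V] [BorelSpace V] [(volume : Measure V).IsAddHaarMeasure]

/-- The directional derivatives of the mollifications of a function of class `W^{2,∞}` are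
Lipschitz along segments, with a constant that does not depend on the mollification. -/
theorem abs_fderiv_smoothing_sub_le {U : Set V} (hU : IsOpen U) {g h k : V → ℝ}
    (hg : MemLp g ⊤ (volume.restrict U)) (hh : MemLp h ⊤ (volume.restrict U)) {v a : V}
    (hgh : HasWeakDeriv U v g h) (hhk : HasWeakDeriv U a h k) {C : ℝ} (hC0 : 0 ≤ C)
    (hC : ∀ᵐ z ∂(volume.restrict U), |k z| ≤ C) (ρ : ContDiffBump (0 : V)) {z : V} {s : ℝ}
    (hs : 0 ≤ s) (hseg : ∀ σ ∈ Icc 0 s, Metric.closedBall (z + σ • a) ρ.rOut ⊆ U) :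
    |fderiv ℝ (smoothing U ρ g) (z + s • a) v - fderiv ℝ (smoothing U ρ g) z v| ≤ C * s := by
  have h0 := hseg 0 (left_mem_Icc.2 hs)
  rw [zero_smul, add_zero] at h0
  rw [fderiv_smoothing hU ρ hg hgh (hseg s (right_mem_Icc.2 hs)),
    fderiv_smoothing hU ρ hg hgh h0]
  refine abs_sub_le_of_fderiv_le ((contDiff_smoothing hU ρ hh).differentiable (by simp)) hs
    fun σ hσ => ?_
  rw [fderiv_smoothing hU ρ hh hhk (hseg σ hσ)]
  exact abs_smoothing_le hU ρ hC hC0 _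

/-- Interpolation: the directional derivatives of the mollifications form a uniform Cauchy
sequence, because the mollifications do and their derivatives are equi-Lipschitz. -/
theorem eventually_abs_fderiv_smoothing_sub_le {U : Set V} (hU : IsOpen U) {g : V → ℝ}
    (hg : MemWInfty U 2 g) (hgc : ContinuousOn g U) {z₀ : V} {r : ℝ} (hr : 0 < r)
    (hball : Metric.closedBall z₀ (2 * r) ⊆ U) (v : V) {η : ℝ} (hη : 0 < η) :
    ∀ᶠ n in atTop, ∀ m ≥ n, ∀ z ∈ Metric.ball z₀ r,
      |fderiv ℝ (smoothing U (shrinkingBump V m) g) z v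
        - fderiv ℝ (smoothing U (shrinkingBump V n) g) z v| ≤ η := by
  obtain ⟨h, hh, hgh⟩ := hg.2 v
  obtain ⟨k, hk, hhk⟩ := hh.2 v
  obtain ⟨C, hC0, hC⟩ := exists_ae_abs_le_of_memLp_top hk.memLp
  -- the step `s` of the difference quotient
  obtain ⟨s, hs, hsr, hsC⟩ : ∃ s : ℝ, 0 < s ∧ s * ‖v‖ ≤ r ∧ 2 * C * s ≤ η / 2 := by
    refine ⟨min (r / (‖v‖ + 1)) (η / 2 / (2 * C + 1)), by positivity, ?_, ?_⟩
    · calc _ ≤ r / (‖v‖ + 1) * (‖v‖ + 1) := by gcongr; exacts [min_le_left _ _, by linarith]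
        _ = r := by field_simp
    · calc _ ≤ (2 * C + 1) * (η / 2 / (2 * C + 1)) := by
            gcongr; exacts [by linarith, min_le_right _ _]
        _ = η / 2 := by field_simp
  have hev := eventually_abs_smoothing_sub_le hU (isCompact_closedBall z₀ (2 * r)) hball
    hg.memLp hgc (η := η * s / 8) (by positivity)
  obtain ⟨n₀, hn₀⟩ := eventually_atTop.1 hev
  filter_upwards [eventually_ge_atTop n₀] with n hn m hm z hz
  have hmem : ∀ σ ∈ Icc 0 s, z + σ • v ∈ Metric.closedBall z₀ (2 * r) := by
    intro σ hσ
    rw [Metric.mem_closedBall, dist_eq_norm]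
    calc ‖z + σ • v - z₀‖ ≤ ‖z - z₀‖ + ‖σ • v‖ := by
          rw [show z + σ • v - z₀ = (z - z₀) + σ • v by abel]; exact norm_add_le _ _
      _ ≤ r + s * ‖v‖ := by
          rw [norm_smul, Real.norm_of_nonneg hσ.1]
          gcongr
          · exact (mem_ball_iff_norm.1 hz).le
          · exact hσ.2
      _ ≤ 2 * r := by linarith
  set F := fun i => smoothing U (shrinkingBump V i) g with hF
  have hFd : ∀ i, Differentiable ℝ (F i) := fun i =>
    (contDiff_smoothing hU _ hg.memLp).differentiable (by simp)
  have hder : ∀ i, ∀ σ, HasDerivAt (fun σ : ℝ => F i (z + σ • v))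
      (fderiv ℝ (F i) (z + σ • v) v) σ := by
    intro i σ
    have h1 : HasDerivAt (fun σ : ℝ => z + σ • v) v σ := by
      simpa using ((hasDerivAt_id σ).smul_const v).const_add z
    exact ((hFd i) _).hasFDerivAt.comp_hasDerivAt σ h1
  have hder2 : ∀ σ, HasDerivAt (fun σ : ℝ => F m (z + σ • v) - F n (z + σ • v))
      (fderiv ℝ (F m) (z + σ • v) v - fderiv ℝ (F n) (z + σ • v) v) σ := fun σ =>
    (hder m σ).sub (hder n σ)
  obtain ⟨ξ, hξ, hslope⟩ := exists_hasDerivAt_eq_slope _ _ hs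
    (fun σ _ => (hder2 σ).continuousAt.continuousWithinAt) fun σ _ => hder2 σ
  have hlip : ∀ i, n₀ ≤ i →
      |fderiv ℝ (F i) (z + ξ • v) v - fderiv ℝ (F i) z v| ≤ C * s := fun i hi =>
    (abs_fderiv_smoothing_sub_le hU hg.memLp hh.memLp hgh hhk hC0 hC _ hξ.1.le
      fun σ hσ => (hn₀ i hi _ (hmem σ ⟨hσ.1, hσ.2.trans hξ.2.le⟩)).1).trans
      (mul_le_mul_of_nonneg_left hξ.2.le hC0)
  have hl1 := hlip m (hn.trans hm)
  have hl2 := hlip n hn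
  have e1 := (hn₀ m (hn.trans hm) _ (hmem s (right_mem_Icc.2 hs.le))).2
  have e2 := (hn₀ n hn _ (hmem s (right_mem_Icc.2 hs.le))).2
  have e3 := (hn₀ m (hn.trans hm) _ (hmem 0 (left_mem_Icc.2 hs.le))).2
  have e4 := (hn₀ n hn _ (hmem 0 (left_mem_Icc.2 hs.le))).2
  have hsl : |fderiv ℝ (F m) (z + ξ • v) v - fderiv ℝ (F n) (z + ξ • v) v| ≤ η / 2 := by
    rw [hslope, sub_zero, abs_div, abs_of_pos hs, div_le_iff₀ hs]
    rw [abs_le] at *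
    constructor <;> linarith [e1.1, e1.2, e2.1, e2.2, e3.1, e3.2, e4.1, e4.2]
  rw [abs_le] at *
  constructor <;> linarith [hl1.1, hl1.2, hl2.1, hl2.2, hsl.1, hsl.2]

/-- Locally, the derivatives of the mollifications converge uniformly, and their limit is the
derivative of `g`. -/
theorem exists_tendstoUniformlyOn_fderiv_smoothing {U : Set V} (hU : IsOpen U) {g : V → ℝ}
    (hg : MemWInfty U 2 g) (hgc : ContinuousOn g U) {z₀ : V} (hz₀ : z₀ ∈ U) :
    ∃ r > 0, Metric.ball z₀ r ⊆ U ∧ ∃ g' : V → V →L[ℝ] ℝ,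
      TendstoUniformlyOn (fun n => fderiv ℝ (smoothing U (shrinkingBump V n) g)) g' atTop
        (Metric.ball z₀ r) ∧ ContinuousOn g' (Metric.ball z₀ r) ∧
      ∀ z ∈ Metric.ball z₀ r, HasFDerivAt g (g' z) z := by
  obtain ⟨R, hR, hRU⟩ := Metric.nhds_basis_closedBall.mem_iff.1 (hU.mem_nhds hz₀)
  have hball : Metric.closedBall z₀ (2 * (R / 2)) ⊆ U := by
    rwa [mul_div_cancel₀ _ (two_ne_zero)]
  have hsub : Metric.ball z₀ (R / 2) ⊆ Metric.closedBall z₀ (2 * (R / 2)) :=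
    Metric.ball_subset_closedBall.trans (Metric.closedBall_subset_closedBall (by linarith))
  refine ⟨R / 2, half_pos hR, hsub.trans hball, ?_⟩
  obtain ⟨C, hC, hop⟩ := (Module.finBasis ℝ V).exists_opNorm_le (F := ℝ)
  have hcauchy : UniformCauchySeqOn (fun n => fderiv ℝ (smoothing U (shrinkingBump V n) g))
      atTop (Metric.ball z₀ (R / 2)) := by
    rw [Metric.uniformCauchySeqOn_iff]
    intro η hη
    have hall : ∀ᶠ n in atTop, ∀ i, ∀ m ≥ n, ∀ z ∈ Metric.ball z₀ (R / 2),
        |fderiv ℝ (smoothing U (shrinkingBump V m) g) z (Module.finBasis ℝ V i)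
          - fderiv ℝ (smoothing U (shrinkingBump V n) g) z (Module.finBasis ℝ V i)|
          ≤ η / (4 * C) :=
      eventually_all.2 fun i => eventually_abs_fderiv_smoothing_sub_le hU hg hgc (half_pos hR)
        hball _ (by positivity)
    obtain ⟨N, hN⟩ := hall.exists
    have key : ∀ m ≥ N, ∀ z ∈ Metric.ball z₀ (R / 2),
        ‖fderiv ℝ (smoothing U (shrinkingBump V m) g) z
          - fderiv ℝ (smoothing U (shrinkingBump V N) g) z‖ ≤ η / 4 := by
      intro m hm z hz
      calc _ ≤ C * (η / (4 * C)) := hop (by positivity) fun i => hN i m hm z hz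
        _ = η / 4 := by field_simp
    refine ⟨N, fun m hm n hn z hz => ?_⟩
    have h1 := key m hm z hz
    have h2 := key n hn z hz
    rw [← dist_eq_norm] at h1 h2
    calc _ ≤ _ := dist_triangle_right _ _ (fderiv ℝ (smoothing U (shrinkingBump V N) g) z)
      _ < η := by linarith
  have hlim : ∀ z, ∃ L : V →L[ℝ] ℝ, z ∈ Metric.ball z₀ (R / 2) →
      Tendsto (fun n => fderiv ℝ (smoothing U (shrinkingBump V n) g) z) atTop (𝓝 L) := by
    intro z
    by_cases hz : z ∈ Metric.ball z₀ (R / 2)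
    · obtain ⟨L, hL⟩ := cauchySeq_tendsto_of_complete (hcauchy.cauchySeq hz)
      exact ⟨L, fun _ => hL⟩
    · exact ⟨0, fun h => absurd h hz⟩
  choose g' hg' using hlim
  have hunif := hcauchy.tendstoUniformlyOn_of_tendsto hg'
  refine ⟨g', hunif, hunif.continuousOn (Eventually.of_forall fun n =>
    ((contDiff_smoothing hU _ hg.memLp).continuous_fderiv (by simp)).continuousOn).frequently,
    fun z hz => ?_⟩
  refine hasFDerivAt_of_tendstoUniformlyOn Metric.isOpen_ball hunif (fun n x _ =>
    ((contDiff_smoothing hU _ hg.memLp).differentiable (by simp) x).hasFDerivAt)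
    (fun x hx => ?_) hz
  rw [Metric.tendsto_atTop]
  intro η hη
  obtain ⟨N, hN⟩ := eventually_atTop.1 (eventually_abs_smoothing_sub_le hU
    (isCompact_closedBall z₀ (2 * (R / 2))) hball hg.memLp hgc (half_pos hη))
  refine ⟨N, fun n hn => ?_⟩
  rw [Real.dist_eq]
  linarith [(hN n hn x (hsub hx)).2]

/-- A continuous function of class `W^{2,∞}` on an open set is of class `C¹`. -/
theorem MemWInfty.contDiffOn {U : Set V} (hU : IsOpen U) {g : V → ℝ} (hg : MemWInfty U 2 g)
    (hgc : ContinuousOn g U) : ContDiffOn ℝ 1 g U := by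
  intro z hz
  obtain ⟨r, hr, hrU, g', -, hcont, hder⟩ := exists_tendstoUniformlyOn_fderiv_smoothing hU hg hgc hz
  refine ContDiffAt.contDiffWithinAt ?_
  have : ContDiffOn ℝ 1 g (Metric.ball z r) := by
    rw [show (1 : WithTop ℕ∞) = 0 + 1 from (zero_add 1).symm,
      contDiffOn_succ_iff_fderiv_of_isOpen Metric.isOpen_ball]
    exact ⟨fun x hx => (hder x hx).differentiableAt.differentiableWithinAt, by simp,
      contDiffOn_zero.2 (hcont.congr fun x hx => (hder x hx).fderiv)⟩
  exact this.contDiffAt (Metric.ball_mem_nhds z hr)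

theorem tendsto_fderiv_smoothing {U : Set V} (hU : IsOpen U) {g : V → ℝ}
    (hg : MemWInfty U 2 g) (hgc : ContinuousOn g U) {z : V} (hz : z ∈ U) :
    Tendsto (fun n => fderiv ℝ (smoothing U (shrinkingBump V n) g) z) atTop
      (𝓝 (fderiv ℝ g z)) := by
  obtain ⟨r, hr, hrU, g', hunif, -, hder⟩ := exists_tendstoUniformlyOn_fderiv_smoothing hU hg hgc hz
  rw [(hder z (Metric.mem_ball_self hr)).fderiv]
  exact hunif.tendsto_at (Metric.mem_ball_self hr)

theorem MemWInfty.exists_abs_fderiv_le {U : Set V} (hU : IsOpen U) {g : V → ℝ}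
    (hg : MemWInfty U 2 g) (hgc : ContinuousOn g U) (v : V) :
    ∃ C : ℝ, 0 ≤ C ∧ ∀ z ∈ U, |fderiv ℝ g z v| ≤ C := by
  obtain ⟨h, hh, hgh⟩ := hg.2 v
  obtain ⟨C, hC0, hC⟩ := exists_ae_abs_le_of_memLp_top hh.memLp
  refine ⟨C, hC0, fun z hz => ?_⟩
  have hlim := ((ContinuousLinearMap.apply ℝ ℝ v).continuous.tendsto _).comp
    (tendsto_fderiv_smoothing hU hg hgc hz)
  refine le_of_tendsto hlim.abs ?_
  filter_upwards [eventually_abs_smoothing_sub_le hU (isCompact_singleton (x := z))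
    (singleton_subset_iff.2 hz) hg.memLp hgc one_pos] with n hn
  simp only [Function.comp, ContinuousLinearMap.apply_apply]
  rw [fderiv_smoothing hU _ hg.memLp hgh (hn z rfl).1]
  exact abs_smoothing_le hU _ hC hC0 z

/-- The first derivatives of a continuous function of class `W^{2,∞}` are Lipschitz along segments
contained in the open set; no convexity is needed. -/
theorem MemWInfty.exists_abs_fderiv_sub_le {U : Set V} (hU : IsOpen U) {g : V → ℝ}
    (hg : MemWInfty U 2 g) (hgc : ContinuousOn g U) (v a : V) :
    ∃ C : ℝ, 0 ≤ C ∧ ∀ (z : V) (s : ℝ), 0 ≤ s → (∀ σ ∈ Icc 0 s, z + σ • a ∈ U) →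
      |fderiv ℝ g (z + s • a) v - fderiv ℝ g z v| ≤ C * s := by
  obtain ⟨h, hh, hgh⟩ := hg.2 v
  obtain ⟨k, hk, hhk⟩ := hh.2 a
  obtain ⟨C, hC0, hC⟩ := exists_ae_abs_le_of_memLp_top hk.memLp
  refine ⟨C, hC0, fun z s hs hseg => ?_⟩
  have hz : z ∈ U := by simpa using hseg 0 (left_mem_Icc.2 hs)
  have hlim : ∀ y ∈ U, Tendsto (fun n => fderiv ℝ (smoothing U (shrinkingBump V n) g) y v) atTop
      (𝓝 (fderiv ℝ g y v)) := fun y hy =>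
    ((ContinuousLinearMap.apply ℝ ℝ v).continuous.tendsto _).comp
      (tendsto_fderiv_smoothing hU hg hgc hy)
  refine le_of_tendsto ((hlim _ (hseg s (right_mem_Icc.2 hs))).sub (hlim z hz)).abs ?_
  have hKU : (fun σ : ℝ => z + σ • a) '' Icc 0 s ⊆ U := by
    rintro _ ⟨σ, hσ, rfl⟩; exact hseg σ hσ
  filter_upwards [eventually_abs_smoothing_sub_le hU (isCompact_segment_image z a s) hKU
    hg.memLp hgc one_pos] with n hn
  exact abs_fderiv_smoothing_sub_le hU hg.memLp hh.memLp hgh hhk hC0 hC _ hs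
    fun σ hσ => (hn _ (mem_image_of_mem _ hσ)).1

/-- An essentially bounded continuous function on an open set is bounded. -/
theorem exists_abs_le_of_memLp_top {U : Set V} (hU : IsOpen U) {g : V → ℝ}
    (hg : MemLp g ⊤ (volume.restrict U)) (hgc : ContinuousOn g U) :
    ∃ C : ℝ, 0 ≤ C ∧ ∀ z ∈ U, |g z| ≤ C := by
  obtain ⟨C, hC0, hC⟩ := exists_ae_abs_le_of_memLp_top hg
  refine ⟨C, hC0, fun z hz => ?_⟩
  refine le_of_forall_pos_le_add fun η hη => ?_
  obtain ⟨n, hn⟩ := (eventually_abs_smoothing_sub_le hU (isCompact_singleton (x := z))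
    (singleton_subset_iff.2 hz) hg hgc hη).exists
  have h1 := (hn z rfl).2
  have h2 := abs_smoothing_le hU (shrinkingBump V n) hC hC0 z
  rw [abs_le] at *
  constructor <;> linarith [h1.1, h1.2, h2.1, h2.2]

end SobolevRegularity

/-! ### The mollified threshold -/

section Threshold

variable {N : ℕ}

instance isAddHaarMeasure_volume_prod {V W : Type*} [NormedAddCommGroup V] [NormedSpace ℝ V]
    [FiniteDimensional ℝ V] [MeasureSpace V] [BorelSpace V] [(volume : Measure V).IsAddHaarMeasure]
    [NormedAddCommGroup W] [NormedSpace ℝ W] [FiniteDimensional ℝ W]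
    [MeasureSpace W] [BorelSpace W] [(volume : Measure W).IsAddHaarMeasure] :
    (volume : Measure (V × W)).IsAddHaarMeasure := by
  rw [Measure.volume_eq_prod]
  infer_instance

/-- A Carathéodory function is jointly measurable: it is the limit of the functions obtained by
rounding `u` to a multiple of `1 / (n + 1)`. -/
theorem IsThreshold.aestronglyMeasurable {lam : ℝ} {G : Space N → ℝ → ℝ}
    (hG : IsThreshold univ lam G) :
    AEStronglyMeasurable (fun z : Space N × ℝ => G z.1 z.2) volume := by
  have hm : ∀ u, AEStronglyMeasurable (fun x => G x u) volume := fun u => by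
    simpa using (hG.memLp u).1
  have hc : ∀ᵐ x ∂(volume : Measure (Space N)), Continuous (G x) := by
    simpa using hG.cont_rep
  choose g hg hGg using hm
  have hr : ∀ (n : ℕ) (u : ℝ), |(⌊((n : ℝ) + 1) * u⌋ : ℝ) / ((n : ℝ) + 1) - u| ≤ 1 / ((n : ℝ) + 1) := by
    intro n u
    have hn : (0 : ℝ) < (n : ℝ) + 1 := by positivity
    have h1 := Int.floor_le (((n : ℝ) + 1) * u)
    have h2 := Int.lt_floor_add_one (((n : ℝ) + 1) * u)
    rw [show (⌊((n : ℝ) + 1) * u⌋ : ℝ) / ((n : ℝ) + 1) - u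
      = ((⌊((n : ℝ) + 1) * u⌋ : ℝ) - ((n : ℝ) + 1) * u) / ((n : ℝ) + 1) by field_simp,
      abs_div, abs_of_pos hn]
    gcongr
    rw [abs_le]; constructor <;> linarith
  have hlim : ∀ u : ℝ, Tendsto (fun n : ℕ => (⌊((n : ℝ) + 1) * u⌋ : ℝ) / ((n : ℝ) + 1)) atTop
      (𝓝 u) := by
    intro u
    rw [tendsto_iff_dist_tendsto_zero]
    exact squeeze_zero (fun _ => dist_nonneg) (fun n => hr n u) tendsto_one_div_add_atTop_nhds_zero_nat
  refine aestronglyMeasurable_of_tendsto_ae (u := atTop)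
    (f := fun (n : ℕ) (z : Space N × ℝ) => g ((⌊((n : ℝ) + 1) * z.2⌋ : ℝ) / ((n : ℝ) + 1)) z.1)
    (fun n => ?_) ?_
  · have h1 : Measurable (fun p : Space N × ℤ => g ((p.2 : ℝ) / ((n : ℝ) + 1)) p.1) :=
      measurable_from_prod_countable_left fun j => (hg ((j : ℝ) / ((n : ℝ) + 1))).measurable
    have h2 : Measurable (fun z : Space N × ℝ => (z.1, ⌊((n : ℝ) + 1) * z.2⌋)) := by fun_prop
    exact (h1.comp h2).aestronglyMeasurable
  · have hall : ∀ᵐ x ∂(volume : Measure (Space N)), ∀ (n : ℕ) (j : ℤ),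
        G x ((j : ℝ) / ((n : ℝ) + 1)) = g ((j : ℝ) / ((n : ℝ) + 1)) x :=
      ae_all_iff.2 fun n => ae_all_iff.2 fun j => hGg _
    have hprod : ∀ᵐ z ∂(volume : Measure (Space N × ℝ)), Continuous (G z.1) ∧ ∀ (n : ℕ) (j : ℤ),
        G z.1 ((j : ℝ) / ((n : ℝ) + 1)) = g ((j : ℝ) / ((n : ℝ) + 1)) z.1 :=
      Measure.quasiMeasurePreserving_fst.ae (hc.and hall)
    filter_upwards [hprod] with z hz
    simp only [← hz.2]
    exact (hz.1.tendsto z.2).comp (hlim z.2)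

/-- A compactness argument in `u` gives a bound at each rational `u`; the continuity of `G(x,·)`
makes the exceptional null set independent of `u`. -/
theorem IsThreshold.exists_ae_abs_le {lam : ℝ} {G : Space N → ℝ → ℝ}
    (hG : IsThreshold univ lam G) (R : ℝ) :
    ∃ Λ : ℝ, 0 < Λ ∧ ∀ᵐ x ∂(volume : Measure (Space N)), ∀ u ∈ Ioo (-R) R, |G x u| ≤ Λ := by
  obtain ⟨Λ, hΛ⟩ : ∃ Λ : NNReal, ∀ u ∈ Icc (-R) R, eLpNorm (fun x => G x u) ⊤ volume ≤ Λ := by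
    refine isCompact_Icc.induction_on (p := fun s => ∃ Λ : NNReal, ∀ u ∈ s,
      eLpNorm (fun x => G x u) ⊤ volume ≤ Λ) ⟨0, by simp⟩ ?_ ?_ ?_
    · rintro s t hst ⟨Λ, h⟩
      exact ⟨Λ, fun u hu => h u (hst hu)⟩
    · rintro s t ⟨Λ, h⟩ ⟨Λ', h'⟩
      refine ⟨max Λ Λ', fun u hu => ?_⟩
      rcases hu with hu | hu
      · exact (h u hu).trans (by exact_mod_cast le_max_left _ _)
      · exact (h' u hu).trans (by exact_mod_cast le_max_right _ _)
    · intro u₀ _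
      have h1 := (hG.memLp u₀)
      simp only [Measure.restrict_univ] at h1
      have h2 := hG.cont u₀
      simp only [Measure.restrict_univ] at h2
      have h3 := h2.eventually (ge_mem_nhds (zero_lt_one (α := ℝ≥0∞)))
      refine ⟨_, mem_nhdsWithin_of_mem_nhds h3, (eLpNorm (fun x => G x u₀) ⊤ volume).toNNReal + 1,
        fun u hu => ?_⟩
      have h4 := hG.memLp u
      simp only [Measure.restrict_univ] at h4
      have h5 := eLpNorm_add_le (h1.1) (h4.1.sub h1.1) (p := ⊤) le_top
      have h6 : (fun x => G x u₀) + ((fun x => G x u) - fun x => G x u₀) = fun x => G x u := by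
        ext x; simp
      rw [h6] at h5
      refine h5.trans ?_
      push_cast
      rw [ENNReal.coe_toNNReal h1.2.ne]
      exact add_le_add le_rfl hu
  refine ⟨Λ + 1, by positivity, ?_⟩
  have hc : ∀ᵐ x ∂(volume : Measure (Space N)), Continuous (G x) := by
    simpa using hG.cont_rep
  have hq : ∀ᵐ x ∂(volume : Measure (Space N)), ∀ q : ℚ, (q : ℝ) ∈ Icc (-R) R →
      |G x q| ≤ Λ := by
    refine ae_all_iff.2 fun q => ?_
    by_cases hq : (q : ℝ) ∈ Icc (-R) R
    · have h := ae_le_eLpNormEssSup (f := fun x => G x q) (μ := (volume : Measure (Space N)))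
      filter_upwards [h] with x hx _
      rw [← eLpNorm_exponent_top] at hx
      have := hx.trans (hΛ q hq)
      rw [enorm_le_coe] at this
      simpa using NNReal.coe_le_coe.2 this
    · exact Eventually.of_forall fun x h => absurd h hq
  filter_upwards [hc, hq] with x hx hxq u hu
  -- a point where the bound fails would have a rational neighbour where it fails
  by_contra hlt
  push Not at hlt
  have hopen : IsOpen ({u | (Λ : ℝ) + 1 < |G x u|} ∩ Ioo (-R) R) :=
    (isOpen_lt continuous_const hx.abs).inter isOpen_Ioo
  obtain ⟨q, hq⟩ := Rat.isDenseEmbedding_coe_real.dense.exists_mem_open hopen ⟨u, hlt, hu⟩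
  have := hxq q (Ioo_subset_Icc_self hq.2)
  have h2 : (Λ : ℝ) + 1 < |G x q| := hq.1
  linarith

theorem ae_fst_abs_le {G : Space N → ℝ → ℝ} {R Λ : ℝ}
    (h : ∀ᵐ x ∂(volume : Measure (Space N)), ∀ u ∈ Ioo (-R) R, |G x u| ≤ Λ) :
    ∀ᵐ z ∂(volume : Measure (Space N × ℝ)), ∀ u ∈ Ioo (-R) R, |G z.1 u| ≤ Λ :=
  Measure.quasiMeasurePreserving_fst.ae h

theorem IsThreshold.locallyIntegrable {lam : ℝ} {G : Space N → ℝ → ℝ}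
    (hG : IsThreshold univ lam G) :
    LocallyIntegrable (fun z : Space N × ℝ => G z.1 z.2) volume := by
  intro z₀
  obtain ⟨Λ, hΛ, h⟩ := hG.exists_ae_abs_le (|z₀.2| + 1)
  refine ⟨Metric.ball z₀ 1, Metric.ball_mem_nhds _ one_pos, ?_⟩
  refine Integrable.mono' (g := fun _ => Λ) (integrableOn_const measure_ball_lt_top.ne)
    hG.aestronglyMeasurable.restrict ?_
  filter_upwards [ae_restrict_of_ae (ae_fst_abs_le h),
    ae_restrict_mem measurableSet_ball] with z hz hzb
  refine hz z.2 ?_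
  have h1 : dist z.2 z₀.2 < 1 := (le_max_right _ _).trans_lt (Metric.mem_ball.1 hzb)
  rw [Real.dist_eq, abs_lt] at h1
  exact ⟨by linarith [neg_abs_le z₀.2], by linarith [le_abs_self z₀.2]⟩

theorem IsMollifier.hasCompactSupport {ε : ℝ} {ρ : Space N × ℝ → ℝ} (hρ : IsMollifier ε ρ) :
    HasCompactSupport ρ :=
  HasCompactSupport.of_support_subset_isCompact (isCompact_closedBall 0 ε) hρ.support

theorem contDiff_mollified {lam ε : ℝ} {G : Space N → ℝ → ℝ} (hG : IsThreshold univ lam G)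
    {ρ : Space N × ℝ → ℝ} (hρ : IsMollifier ε ρ) :
    ContDiff ℝ ∞ (fun z : Space N × ℝ => mollified G ρ z.1 z.2) :=
  hρ.hasCompactSupport.contDiff_convolution_right _ hG.locallyIntegrable hρ.smooth

theorem IsMollifier.integral_comp_sub {ε : ℝ} {ρ : Space N × ℝ → ℝ} (hρ : IsMollifier ε ρ)
    (z : Space N × ℝ) (c : ℝ) :
    Integrable (fun y => c * ρ (z - y)) volume ∧ ∫ y, c * ρ (z - y) = c := by
  have h1 : Integrable ρ volume :=
    hρ.smooth.continuous.integrable_of_hasCompactSupport hρ.hasCompactSupport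
  refine ⟨(h1.comp_sub_left z).const_mul c, ?_⟩
  rw [integral_const_mul, integral_sub_left_eq_self (fun y => ρ y) volume z,
    hρ.integral_eq_one, mul_one]

theorem integrable_mollified {lam ε : ℝ} {G : Space N → ℝ → ℝ} (hG : IsThreshold univ lam G)
    {ρ : Space N × ℝ → ℝ} (hρ : IsMollifier ε ρ) (z : Space N × ℝ) :
    Integrable (fun y : Space N × ℝ => G y.1 y.2 * ρ (z - y)) volume := by
  have h : ConvolutionExistsAt (fun y : Space N × ℝ => G y.1 y.2) ρ z
      (ContinuousLinearMap.mul ℝ ℝ) volume :=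
    hρ.hasCompactSupport.convolutionExists_right _ hG.locallyIntegrable hρ.smooth.continuous z
  exact h

theorem le_mollified {lam ε : ℝ} {G : Space N → ℝ → ℝ} (hG : IsThreshold univ lam G)
    {ρ : Space N × ℝ → ℝ} (hρ : IsMollifier ε ρ) (x : Space N) (u : ℝ) :
    lam ≤ mollified G ρ x u := by
  have hl : ∀ᵐ x ∂(volume : Measure (Space N)), ∀ u, lam ≤ G x u := by simpa using hG.lower
  have hl2 : ∀ᵐ z ∂(volume : Measure (Space N × ℝ)), ∀ u, lam ≤ G z.1 u :=
    Measure.quasiMeasurePreserving_fst.ae hl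
  obtain ⟨h1, h2⟩ := hρ.integral_comp_sub (x, u) lam
  rw [← h2]
  refine integral_mono_ae h1 (integrable_mollified hG hρ (x, u)) ?_
  filter_upwards [hl2] with y hy
  exact mul_le_mul_of_nonneg_right (hy _) (hρ.nonneg _)

theorem mollified_le {lam ε : ℝ} {G : Space N → ℝ → ℝ} (hG : IsThreshold univ lam G)
    {ρ : Space N × ℝ → ℝ} (hρ : IsMollifier ε ρ) (hε : ε < 1) {R Λ : ℝ}
    (h : ∀ᵐ x ∂(volume : Measure (Space N)), ∀ u ∈ Ioo (-(R + 1)) (R + 1), |G x u| ≤ Λ)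
    (x : Space N) {u : ℝ} (hu : |u| ≤ R) : mollified G ρ x u ≤ Λ := by
  obtain ⟨h1, h2⟩ := hρ.integral_comp_sub (x, u) Λ
  rw [← h2]
  refine integral_mono_ae (integrable_mollified hG hρ (x, u)) h1 ?_
  filter_upwards [ae_fst_abs_le h] with y hy
  by_cases hρy : ρ ((x, u) - y) = 0
  · simp [hρy]
  · have h3 := hρ.support hρy
    rw [mem_closedBall_zero_iff] at h3
    have h4 : |u - y.2| ≤ ε := (le_max_right _ _).trans h3
    rw [abs_le] at h4 hu
    exact mul_le_mul_of_nonneg_right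
      ((le_abs_self _).trans (hy _ ⟨by linarith [h4.2, hu.1], by linarith [h4.1, hu.2]⟩))
      (hρ.nonneg _)

end Threshold

/-! ### Bounds on the flux and the source -/

section FluxSource

variable {N : ℕ}

/-- The chain rule for `y ↦ F(y, t, v(y))`. -/
theorem fderiv_comp_graph {F : Space N × ℝ × ℝ → ℝ} {v : Space N → ℝ} {x : Space N} {t : ℝ}
    (hF : DifferentiableAt ℝ F (x, t, v x)) (hv : DifferentiableAt ℝ v x) (e : Space N) :
    fderiv ℝ (fun y => F (y, t, v y)) x e
      = fderiv ℝ F (x, t, v x) (e, 0, 0) + fderiv ℝ v x e * fderiv ℝ F (x, t, v x) (0, 0, 1) := by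
  have h1 : HasFDerivAt (fun y : Space N => (y, t, v y))
      ((ContinuousLinearMap.id ℝ (Space N)).prod
        ((0 : Space N →L[ℝ] ℝ).prod (fderiv ℝ v x))) x :=
    (hasFDerivAt_id x).prodMk ((hasFDerivAt_const t x).prodMk hv.hasFDerivAt)
  have h2 : HasFDerivAt (fun y => F (y, t, v y)) _ x := hF.hasFDerivAt.comp x h1
  rw [h2.fderiv]
  simp only [ContinuousLinearMap.comp_apply, ContinuousLinearMap.prod_apply,
    ContinuousLinearMap.id_apply, zero_apply]
  rw [← smul_eq_mul, ← map_smul, ← map_add]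
  simp

theorem fderiv_apply_coord {E : Type*} [NormedAddCommGroup E] [NormedSpace ℝ E]
    {F : E → Space N} {x : E} (hF : DifferentiableAt ℝ F x)
    (e : E) (i : Fin N) : fderiv ℝ F x e i = fderiv ℝ (fun y => F y i) x e := by
  have := (EuclideanSpace.proj (𝕜 := ℝ) i).hasFDerivAt.comp x hF.hasFDerivAt
  have h2 : HasFDerivAt (fun y => F y i) _ x := this
  rw [h2.fderiv]
  rfl

theorem divergence_eq_sum {F : Space N → Space N} {x : Space N} (hF : DifferentiableAt ℝ F x) :
    divergence F x = ∑ i, fderiv ℝ (fun y => F y i) x (EuclideanSpace.single i 1) :=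
  Finset.sum_congr rfl fun i _ => fderiv_apply_coord hF _ i

theorem abs_fderiv_single_le (v : Space N → ℝ) (x : Space N) (i : Fin N) :
    |fderiv ℝ v x (EuclideanSpace.single i 1)| ≤ ‖gradient v x‖ := by
  have h := (fderiv ℝ v x).le_opNorm (EuclideanSpace.single i 1)
  rw [PiLp.norm_single, norm_one, mul_one, Real.norm_eq_abs] at h
  rwa [gradient, LinearIsometryEquiv.norm_map]

/-- The `i`-th component of the flux, as a function of `(x, t, u)`. -/
def fluxComp (Φ : Space N → ℝ → ℝ → Space N) (i : Fin N) (z : Space N × ℝ × ℝ) : ℝ :=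
  Φ z.1 z.2.1 z.2.2 i

variable {Ω : Set (Space N)} {T : ℝ} {Φ : Space N → ℝ → ℝ → Space N}
  {f : Space N → ℝ → ℝ → ℝ} {c₁ c₂ : ℝ}

theorem isOpen_slab (hΩ : IsOpen Ω) (R : ℝ) : IsOpen (Ω ×ˢ Ioo 0 T ×ˢ Ioo (-R) R) :=
  hΩ.prod (isOpen_Ioo.prod isOpen_Ioo)

theorem IsAdmissibleFluxSource.continuousOn_fluxComp (h : IsAdmissibleFluxSource Ω T Φ f c₁ c₂)
    (i : Fin N) (R : ℝ) : ContinuousOn (fluxComp Φ i) (Ω ×ˢ Ioo 0 T ×ˢ Ioo (-R) R) :=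
  ((EuclideanSpace.proj (𝕜 := ℝ) i).continuous.comp_continuousOn h.flux_cont).mono
    (prod_mono_right (prod_mono_right (subset_univ _)))

theorem IsAdmissibleFluxSource.contDiffAt_fluxComp (h : IsAdmissibleFluxSource Ω T Φ f c₁ c₂)
    (hΩ : IsOpen Ω) (i : Fin N) {x : Space N} (hx : x ∈ Ω) {t : ℝ} (ht : t ∈ Ioo 0 T) (u : ℝ) :
    ContDiffAt ℝ 1 (fluxComp Φ i) (x, t, u) := by
  have hR : 0 < |u| + 1 := by positivity
  have h1 := (h.flux_sobolev (|u| + 1) hR i).contDiffOn (isOpen_slab hΩ _)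
    (h.continuousOn_fluxComp i _)
  refine h1.contDiffAt ((isOpen_slab hΩ _).mem_nhds ⟨hx, ht, ?_, ?_⟩)
  · change -(|u| + 1) < u
    linarith [neg_abs_le u]
  · change u < |u| + 1
    linarith [le_abs_self u]

theorem IsAdmissibleFluxSource.contDiffAt_flux (h : IsAdmissibleFluxSource Ω T Φ f c₁ c₂)
    (hΩ : IsOpen Ω) {x : Space N} (hx : x ∈ Ω) {t : ℝ} (ht : t ∈ Ioo 0 T) (u : ℝ) :
    ContDiffAt ℝ 1 (fun z : Space N × ℝ × ℝ => Φ z.1 z.2.1 z.2.2) (x, t, u) :=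
  contDiffAt_euclidean.2 fun i => h.contDiffAt_fluxComp hΩ i hx ht u

theorem IsAdmissibleFluxSource.differentiableAt_comp (h : IsAdmissibleFluxSource Ω T Φ f c₁ c₂)
    (hΩ : IsOpen Ω) {x : Space N} (hx : x ∈ Ω) {t : ℝ} (ht : t ∈ Ioo 0 T) {v : Space N → ℝ}
    (hv : DifferentiableAt ℝ v x) : DifferentiableAt ℝ (fun y => Φ y t (v y)) x :=
  DifferentiableAt.comp (g := fun z : Space N × ℝ × ℝ => Φ z.1 z.2.1 z.2.2) x
    (f := fun y => (y, t, v y)) ((h.contDiffAt_flux hΩ hx ht (v x)).differentiableAt (by simp))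
    (by fun_prop)

/-- The chain rule for the divergence of `Φ(y, t, v(y))`. -/
theorem IsAdmissibleFluxSource.divergence_comp (h : IsAdmissibleFluxSource Ω T Φ f c₁ c₂)
    (hΩ : IsOpen Ω) {x : Space N} (hx : x ∈ Ω) {t : ℝ} (ht : t ∈ Ioo 0 T) {v : Space N → ℝ}
    (hv : DifferentiableAt ℝ v x) :
    divergence (fun y => Φ y t (v y)) x
      = ∑ i, (fderiv ℝ (fluxComp Φ i) (x, t, v x) (EuclideanSpace.single i 1, 0, 0)
        + fderiv ℝ v x (EuclideanSpace.single i 1)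
          * fderiv ℝ (fluxComp Φ i) (x, t, v x) (0, 0, 1)) := by
  rw [divergence_eq_sum (h.differentiableAt_comp hΩ hx ht hv)]
  exact Finset.sum_congr rfl fun i _ => fderiv_comp_graph (F := fluxComp Φ i)
    ((h.contDiffAt_fluxComp hΩ i hx ht (v x)).differentiableAt (by simp)) hv _

/-- By continuity, the growth condition holds at every point of `Q`. -/
theorem IsAdmissibleFluxSource.growth_everywhere (h : IsAdmissibleFluxSource Ω T Φ f c₁ c₂)
    (hΩ : IsOpen Ω) {x : Space N} (hx : x ∈ Ω) {t : ℝ} (ht : t ∈ Ioo 0 T) (u : ℝ) :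
    |divergence (fun y => Φ y t u) x + f x t u| ≤ c₁ * |u| + c₂ := by
  have hQ : IsOpen (cylinder Ω T) := hΩ.prod isOpen_Ioo
  have hcont : ContinuousOn (fun z : Space N × ℝ =>
      |divergence (fun y => Φ y z.2 u) z.1 + f z.1 z.2 u|) (cylinder Ω T) := by
    refine ContinuousOn.abs (ContinuousOn.add ?_ ?_)
    · have h1 : ContinuousOn (fun z : Space N × ℝ =>
          ∑ i, fderiv ℝ (fluxComp Φ i) (z.1, z.2, u) (EuclideanSpace.single i 1, 0, 0))
          (cylinder Ω T) := by
        refine continuousOn_finsetSum _ fun i _ => ?_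
        intro z hz
        have h2 : ContinuousAt (fderiv ℝ (fluxComp Φ i)) (z.1, z.2, u) :=
          ((h.contDiffAt_fluxComp hΩ i hz.1 hz.2 u).fderiv_right (m := 0) (by simp)).continuousAt
        have h3 : ContinuousAt (fun z : Space N × ℝ => (z.1, z.2, u)) z := by fun_prop
        exact ((ContinuousAt.comp (f := fun z : Space N × ℝ => (z.1, z.2, u)) h2 h3).clm_apply
          continuousAt_const).continuousWithinAt
      refine h1.congr fun z hz => ?_
      simp [h.divergence_comp hΩ hz.1 hz.2 (differentiableAt_const u)]
    · exact h.source_cont.comp (f := fun z : Space N × ℝ => (z.1, z.2, u)) (by fun_prop)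
        fun z hz => ⟨hz.1, hz.2, mem_univ _⟩
  by_contra hlt
  push Not at hlt
  have hopen : IsOpen (cylinder Ω T ∩ (fun z : Space N × ℝ =>
      |divergence (fun y => Φ y z.2 u) z.1 + f z.1 z.2 u|) ⁻¹' Ioi (c₁ * |u| + c₂)) :=
    hcont.isOpen_inter_preimage hQ isOpen_Ioi
  have hpos := hopen.measure_pos volume ⟨(x, t), ⟨hx, ht⟩, hlt⟩
  refine hpos.ne' ?_
  have hae := (ae_restrict_iff' hQ.measurableSet).1 h.growth
  refine measure_mono_null (fun z hz => ?_) hae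
  exact fun hz2 => absurd (hz2 hz.1 u) (not_le.2 hz.2)

/-- Finitely many bounds, each monotone in its constant, hold with a common constant. -/
theorem exists_uniform_bound {ι : Type*} [Fintype ι] {P : ι → ℝ → Prop}
    (hP : ∀ i, ∃ C, 0 ≤ C ∧ P i C) (hmono : ∀ i C C', C ≤ C' → P i C → P i C') :
    ∃ C, 0 ≤ C ∧ ∀ i, P i C := by
  choose C hC0 hC using hP
  exact ⟨∑ i, C i, Finset.sum_nonneg fun i _ => hC0 i, fun i =>
    hmono i _ _ (Finset.single_le_sum (f := C) (fun j _ => hC0 j) (Finset.mem_univ i)) (hC i)⟩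

theorem IsAdmissibleFluxSource.exists_source_bound (h : IsAdmissibleFluxSource Ω T Φ f c₁ c₂)
    (hΩ : IsOpen Ω) {R : ℝ} (hR : 0 < R) :
    ∃ L, 0 ≤ L ∧ (∀ x ∈ Ω, ∀ t ∈ Ioo 0 T, ∀ u ∈ Ioo (-R) R, |f x t u| ≤ L) ∧
      ∀ x ∈ Ω, ∀ t ∈ Ioo 0 T, ∀ t' ∈ Ioo 0 T, ∀ u ∈ Ioo (-R) R, ∀ u' ∈ Ioo (-R) R,
        t ≤ t' → |f x t' u' - f x t u| ≤ L * ((t' - t) + |u' - u|) := by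
  have hU := isOpen_slab (T := T) hΩ R
  have hS := h.source_sobolev R hR
  have hc : ContinuousOn (fun z : Space N × ℝ × ℝ => f z.1 z.2.1 z.2.2)
      (Ω ×ˢ Ioo 0 T ×ˢ Ioo (-R) R) :=
    h.source_cont.mono (prod_mono_right (prod_mono_right (subset_univ _)))
  obtain ⟨A, hA0, hA⟩ := exists_abs_le_of_memLp_top hU hS.memLp hc
  obtain ⟨ht, hht, hwt⟩ := hS.2 (0, 1, 0)
  obtain ⟨hu, hhu, hwu⟩ := hS.2 (0, 0, 1)
  obtain ⟨B, hB0, hB⟩ := exists_ae_abs_le_of_memLp_top hht.memLp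
  obtain ⟨C, hC0, hC⟩ := exists_ae_abs_le_of_memLp_top hhu.memLp
  have hconvT : Convex ℝ (Ioo 0 T) := convex_Ioo 0 T
  have hconvR : Convex ℝ (Ioo (-R) R) := convex_Ioo (-R) R
  have hstep : ∀ x ∈ Ω, ∀ t ∈ Ioo 0 T, ∀ u ∈ Ioo (-R) R, ∀ u' ∈ Ioo (-R) R, u ≤ u' →
      |f x t u' - f x t u| ≤ C * (u' - u) := by
    intro x hx t ht u hu u' hu' hle
    have := abs_sub_le_of_hasWeakDeriv hU hS.memLp hc hwu hC0 hC (z := (x, t, u)) (s := u' - u)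
      (sub_nonneg.2 hle) fun σ hσ => by
        refine ⟨by simpa using hx, by simpa using ht, ?_⟩
        simp only [Prod.smul_mk, Prod.mk_add_mk, smul_eq_mul, mul_one, mem_Ioo]
        exact ⟨by linarith [hu.1, hσ.1], by linarith [hu'.2, hσ.2]⟩
    simpa using this
  refine ⟨A + B + C, by positivity, fun x hx t ht u hu =>
    (hA (x, t, u) ⟨hx, ht, hu⟩).trans (by linarith), ?_⟩
  intro x hx t ht t' ht' u hu u' hu' hle
  have h1 : |f x t' u' - f x t u'| ≤ B * (t' - t) := by
    have := abs_sub_le_of_hasWeakDeriv hU hS.memLp hc hwt hB0 hB (z := (x, t, u')) (s := t' - t)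
      (sub_nonneg.2 hle) fun σ hσ => by
        refine ⟨by simpa using hx, ?_, by simpa using hu'⟩
        simp only [Prod.smul_mk, Prod.mk_add_mk, smul_eq_mul, mul_one, mem_Ioo]
        exact ⟨by linarith [ht.1, hσ.1], by linarith [ht'.2, hσ.2]⟩
    simpa using this
  have h2 : |f x t u' - f x t u| ≤ C * |u' - u| := by
    rcases le_total u u' with hle | hle
    · rw [abs_of_nonneg (sub_nonneg.2 hle)]; exact hstep x hx t ht u hu u' hu' hle
    · rw [abs_sub_comm, abs_sub_comm u', abs_of_nonneg (sub_nonneg.2 hle)]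
      exact hstep x hx t ht u' hu' u hu hle
  calc |f x t' u' - f x t u| ≤ |f x t' u' - f x t u'| + |f x t u' - f x t u| := abs_sub_le _ _ _
    _ ≤ B * (t' - t) + C * |u' - u| := add_le_add h1 h2
    _ ≤ (A + B + C) * ((t' - t) + |u' - u|) := by
        have := sub_nonneg.2 hle
        nlinarith [mul_nonneg hA0 this, mul_nonneg hA0 (abs_nonneg (u' - u)), mul_nonneg hC0 this,
          mul_nonneg hB0 (abs_nonneg (u' - u))]

theorem norm_le_of_abs_apply_le {p : Space N} {C : ℝ} (hp : ∀ i, |p i| ≤ C) :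
    ‖p‖ ≤ N * C := by
  calc ‖p‖ = ‖∑ i, p i • EuclideanSpace.single i (1 : ℝ)‖ := by
        congr 1
        ext j
        simp [Finset.sum_apply, Pi.single_apply]
    _ ≤ ∑ i : Fin N, C := norm_sum_le_of_le _ fun i _ => by
        simpa [norm_smul, PiLp.norm_single] using hp i
    _ = N * C := by simp

/-- The bounds on the flux that the estimates use, on `{|u| < R}`. -/
theorem IsAdmissibleFluxSource.exists_flux_bound (h : IsAdmissibleFluxSource Ω T Φ f c₁ c₂)
    (hΩ : IsOpen Ω) {R : ℝ} (hR : 0 < R) :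
    ∃ L, 0 ≤ L ∧ (∀ x ∈ Ω, ∀ t ∈ Ioo 0 T, ∀ u ∈ Ioo (-R) R, ‖Φ x t u‖ ≤ L) ∧
      (∀ x ∈ Ω, ∀ t ∈ Ioo 0 T, ∀ u ∈ Ioo (-R) R, ∀ u' ∈ Ioo (-R) R,
        ‖Φ x t u' - Φ x t u‖ ≤ L * |u' - u|) ∧
      (∀ x ∈ Ω, ∀ t ∈ Ioo 0 T, ∀ v : Space N → ℝ, DifferentiableAt ℝ v x → v x ∈ Ioo (-R) R →
        |divergence (fun y => Φ y t (v y)) x| ≤ L * (1 + ‖gradient v x‖)) ∧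
      ∀ x ∈ Ω, ∀ t ∈ Ioo 0 T, ∀ t' ∈ Ioo 0 T, t ≤ t' → ∀ v : Space N → ℝ,
        DifferentiableAt ℝ v x → v x ∈ Ioo (-R) R →
        |divergence (fun y => Φ y t' (v y)) x - divergence (fun y => Φ y t (v y)) x|
          ≤ L * (t' - t) * (1 + ‖gradient v x‖) := by
  have hU := isOpen_slab (T := T) hΩ R
  have hS := h.flux_sobolev R hR
  have hc := fun i => h.continuousOn_fluxComp i R
  set U : Set (Space N × ℝ × ℝ) := Ω ×ˢ Ioo 0 T ×ˢ Ioo (-R) R with hUdef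
  obtain ⟨A, hA0, hA⟩ := exists_uniform_bound (ι := Fin N)
    (P := fun i C => ∀ z ∈ U, |fluxComp Φ i z| ≤ C)
    (fun i => exists_abs_le_of_memLp_top hU (hS i).memLp (hc i))
    (fun i C C' hCC hC z hz => (hC z hz).trans hCC)
  obtain ⟨B, hB0, hB⟩ := exists_uniform_bound (ι := Fin N)
    (P := fun i C => ∀ z ∈ U, |fderiv ℝ (fluxComp Φ i) z (EuclideanSpace.single i 1, 0, 0)| ≤ C)
    (fun i => (hS i).exists_abs_fderiv_le hU (hc i) _)
    (fun i C C' hCC hC z hz => (hC z hz).trans hCC)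
  obtain ⟨B', hB'0, hB'⟩ := exists_uniform_bound (ι := Fin N)
    (P := fun i C => ∀ z ∈ U, |fderiv ℝ (fluxComp Φ i) z (0, 0, 1)| ≤ C)
    (fun i => (hS i).exists_abs_fderiv_le hU (hc i) _)
    (fun i C C' hCC hC z hz => (hC z hz).trans hCC)
  obtain ⟨C, hC0, hC⟩ := exists_uniform_bound (ι := Fin N)
    (P := fun i C => ∀ (z : Space N × ℝ × ℝ) (s : ℝ), 0 ≤ s →
      (∀ σ ∈ Icc 0 s, z + σ • ((0, 1, 0) : Space N × ℝ × ℝ) ∈ U) →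
      |fderiv ℝ (fluxComp Φ i) (z + s • ((0, 1, 0) : Space N × ℝ × ℝ))
        (EuclideanSpace.single i 1, 0, 0)
        - fderiv ℝ (fluxComp Φ i) z (EuclideanSpace.single i 1, 0, 0)| ≤ C * s)
    (fun i => (hS i).exists_abs_fderiv_sub_le hU (hc i) _ _)
    (fun i C C' hCC hC z s hs hz => (hC z s hs hz).trans (mul_le_mul_of_nonneg_right hCC hs))
  obtain ⟨C', hC'0, hC'⟩ := exists_uniform_bound (ι := Fin N)
    (P := fun i C => ∀ (z : Space N × ℝ × ℝ) (s : ℝ), 0 ≤ s →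
      (∀ σ ∈ Icc 0 s, z + σ • ((0, 1, 0) : Space N × ℝ × ℝ) ∈ U) →
      |fderiv ℝ (fluxComp Φ i) (z + s • ((0, 1, 0) : Space N × ℝ × ℝ)) (0, 0, 1)
        - fderiv ℝ (fluxComp Φ i) z (0, 0, 1)| ≤ C * s)
    (fun i => (hS i).exists_abs_fderiv_sub_le hU (hc i) _ _)
    (fun i C C' hCC hC z s hs hz => (hC z s hs hz).trans (mul_le_mul_of_nonneg_right hCC hs))
  set M := A + B + B' + C + C' with hM
  have hM0 : 0 ≤ M := by positivity
  have hN : (0 : ℝ) ≤ N := Nat.cast_nonneg N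
  refine ⟨N * M, by positivity, ?_, ?_, ?_, ?_⟩
  · intro x hx t ht u hu
    refine norm_le_of_abs_apply_le fun i => ?_
    exact (hA i (x, t, u) ⟨hx, ht, hu⟩).trans (by linarith)
  · intro x hx t ht u hu u' hu'
    rw [mul_assoc]
    refine norm_le_of_abs_apply_le fun i => ?_
    have hd : ∀ s ∈ Ioo (-R) R, HasDerivWithinAt (fun s => fluxComp Φ i (x, t, s))
        (fderiv ℝ (fluxComp Φ i) (x, t, s) (0, 0, 1)) (Ioo (-R) R) s := by
      intro s hs
      have h1 : HasDerivAt (fun s : ℝ => (x, t, s)) ((0, 0, 1) : Space N × ℝ × ℝ) s :=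
        (hasDerivAt_const s x).prodMk ((hasDerivAt_const s t).prodMk (hasDerivAt_id s))
      exact (((h.contDiffAt_fluxComp hΩ i hx ht s).differentiableAt
        (by simp)).hasFDerivAt.comp_hasDerivAt s h1).hasDerivWithinAt
    have := (convex_Ioo (-R) R).norm_image_sub_le_of_norm_hasDerivWithin_le hd
      (fun s hs => hB' i (x, t, s) ⟨hx, ht, hs⟩) hu hu'
    refine (show |(Φ x t u' - Φ x t u) i| ≤ B' * |u' - u| from this).trans ?_
    gcongr
    linarith
  · intro x hx t ht v hv hvR
    rw [h.divergence_comp hΩ hx ht hv]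
    have hz : (x, t, v x) ∈ U := ⟨hx, ht, hvR⟩
    calc _ ≤ ∑ i : Fin N, M * (1 + ‖gradient v x‖) := by
          refine Finset.abs_sum_le_sum_abs _ _ |>.trans (Finset.sum_le_sum fun i _ => ?_)
          refine (abs_add_le _ _).trans ?_
          rw [abs_mul, mul_add, mul_one, mul_comm M]
          refine add_le_add ((hB i _ hz).trans (by linarith)) (mul_le_mul
            (abs_fderiv_single_le v x i) ((hB' i _ hz).trans (by linarith)) (abs_nonneg _)
            (norm_nonneg _))
      _ = _ := by simp [mul_assoc]
  · intro x hx t ht t' ht' hle v hv hvR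
    rw [h.divergence_comp hΩ hx ht hv, h.divergence_comp hΩ hx ht' hv, ← Finset.sum_sub_distrib]
    have hle' := sub_nonneg.2 hle
    have hseg : ∀ σ ∈ Icc 0 (t' - t),
        (x, t, v x) + σ • ((0, 1, 0) : Space N × ℝ × ℝ) ∈ U := by
      intro σ hσ
      refine ⟨by simpa using hx, ?_, by simpa using hvR⟩
      simp only [Prod.smul_mk, Prod.mk_add_mk, smul_eq_mul, mul_one, mem_Ioo]
      exact ⟨by linarith [ht.1, hσ.1], by linarith [ht'.2, hσ.2]⟩
    have hpt : (x, t, v x) + (t' - t) • ((0, 1, 0) : Space N × ℝ × ℝ) = (x, t', v x) := by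
      simp
    calc _ ≤ ∑ i : Fin N, M * (t' - t) * (1 + ‖gradient v x‖) := by
          refine Finset.abs_sum_le_sum_abs _ _ |>.trans (Finset.sum_le_sum fun i _ => ?_)
          have h1 := hC i _ _ hle' hseg
          have h2 := hC' i _ _ hle' hseg
          rw [hpt] at h1 h2
          rw [add_sub_add_comm, ← mul_sub]
          refine (abs_add_le _ _).trans ?_
          rw [abs_mul, mul_add, mul_one, mul_comm (M * (t' - t))]
          refine add_le_add (h1.trans ?_) (mul_le_mul
            (abs_fderiv_single_le v x i) (h2.trans ?_) (abs_nonneg _)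
            (norm_nonneg _)) <;> gcongr <;> linarith
      _ = _ := by simp [mul_assoc]

end FluxSource

/-! ### Integration by parts -/

section IntegrationByParts

theorem integrableOn_of_continuousOn_of_eq_zero {X : Type*} [TopologicalSpace X] [T2Space X]
    [MeasurableSpace X] [OpensMeasurableSpace X] {μ : Measure X}
    [IsFiniteMeasureOnCompacts μ] {s K : Set X} (hs : MeasurableSet s) (hK : IsCompact K)
    {F : X → ℝ} (hF : ContinuousOn F K) (h0 : ∀ x ∈ s, x ∉ K → F x = 0) :
    IntegrableOn F s μ :=
  (hF.integrableOn_compact hK).of_forall_sdiff_eq_zero hs fun x hx => h0 x hx.1 hx.2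

variable {N : ℕ} {Ω : Set (Space N)}

theorem clm_apply_eq_sum (L : Space N →L[ℝ] ℝ) (p : Space N) :
    L p = ∑ i, p i * L (EuclideanSpace.single i 1) := by
  have : p = ∑ i, p i • EuclideanSpace.single i (1 : ℝ) := by
    ext j
    simp [Finset.sum_apply, Pi.single_apply]
  conv_lhs => rw [this]
  simp [map_sum]

theorem inner_gradient_eq_fderiv (v : Space N → ℝ) (x p : Space N) :
    inner ℝ p (gradient v x) = fderiv ℝ v x p := by
  rw [real_inner_comm, gradient, InnerProductSpace.toDual_symm_apply]

theorem continuousOn_divergence (hΩ : IsOpen Ω) {A : Space N → Space N}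
    (hA : ContDiffOn ℝ 1 A Ω) : ContinuousOn (divergence A) Ω := by
  have h := hA.continuousOn_fderiv_of_isOpen hΩ (by simp)
  refine continuousOn_finsetSum _ fun i _ => ?_
  exact (EuclideanSpace.proj (𝕜 := ℝ) i).continuous.comp_continuousOn
    (h.clm_apply continuousOn_const)

theorem continuousOn_gradient (hΩ : IsOpen Ω) {v : Space N → ℝ}
    (hv : ContDiffOn ℝ 1 v Ω) : ContinuousOn (gradient v) Ω :=
  (InnerProductSpace.toDual ℝ (Space N)).symm.continuous.comp_continuousOn
    (hv.continuousOn_fderiv_of_isOpen hΩ (by simp))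

/-- Integration by parts on `Ω` against a function that vanishes off a compact subset of `Ω`. -/
theorem integral_mul_divergence (hΩ : IsOpen Ω) {K : Set (Space N)} (hK : IsCompact K)
    (hKΩ : K ⊆ Ω) {ζ : Space N → ℝ} (hζ : ContDiffOn ℝ 1 ζ Ω) (h0 : ∀ x ∈ Ω, x ∉ K → ζ x = 0)
    {A : Space N → Space N} (hA : ContDiffOn ℝ 1 A Ω) :
    ∫ x in Ω, ζ x * divergence A x = - ∫ x in Ω, fderiv ℝ ζ x (A x) := by
  set Z := Ω.indicator ζ with hZ
  have hZΩ : ∀ x ∈ Ω, Z =ᶠ[𝓝 x] ζ := fun x hx => by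
    filter_upwards [hΩ.mem_nhds hx] with y hy
    exact indicator_of_mem hy ζ
  have hZK : ∀ x ∉ K, Z x = 0 := fun x hx => by
    by_cases hxΩ : x ∈ Ω
    · rw [hZ, indicator_of_mem hxΩ, h0 x hxΩ hx]
    · exact indicator_of_notMem hxΩ ζ
  have hZK' : ∀ x ∉ K, Z =ᶠ[𝓝 x] fun _ => 0 := fun x hx => by
    filter_upwards [hK.isClosed.isOpen_compl.mem_nhds hx] with y hy
    exact hZK y hy
  have hZd : Differentiable ℝ Z := fun x => by
    by_cases hx : x ∈ Ω
    · exact ((hζ.differentiableOn (by simp)).differentiableAt (hΩ.mem_nhds hx)).congr_of_eventuallyEq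
        (hZΩ x hx)
    · exact (differentiableAt_const (0 : ℝ)).congr_of_eventuallyEq (hZK' x fun h => hx (hKΩ h))
  have hZf : ∀ x ∈ Ω, fderiv ℝ Z x = fderiv ℝ ζ x := fun x hx => (hZΩ x hx).fderiv_eq
  have hZf0 : ∀ x ∉ K, fderiv ℝ Z x = 0 := fun x hx => by
    rw [(hZK' x hx).fderiv_eq]; simp
  have hsupp : tsupport Z ⊆ K := by
    refine closure_minimal (fun x hx => ?_) hK.isClosed
    by_contra h
    exact hx (hZK x h)
  have hAc : ∀ i, ContDiffOn ℝ 1 (fun y => A y i) Ω := fun i =>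
    (EuclideanSpace.proj (𝕜 := ℝ) i).contDiff.comp_contDiffOn hA
  have hint : ∀ F : Space N → ℝ, ContinuousOn F Ω → (∀ x ∉ K, F x = 0) →
      Integrable F volume := fun F hF hF0 => by
    rw [← integrableOn_iff_integrable_of_support_subset (s := K) fun x hx => by
      by_contra h; exact hx (hF0 x h)]
    exact (hF.mono hKΩ).integrableOn_compact hK
  have hZcont : ContinuousOn Z Ω := hZd.continuous.continuousOn
  have hζf := hζ.continuousOn_fderiv_of_isOpen hΩ (by simp)
  have hI1 : ∀ i, Integrable (fun x => fderiv ℝ Z x (EuclideanSpace.single i 1) * A x i)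
      volume := fun i => hint _
    ((((hζf.clm_apply continuousOn_const).congr fun x hx => by rw [hZf x hx]).mul
      (hAc i).continuousOn)) fun x hx => by simp [hZf0 x hx]
  have hI2 : ∀ i, Integrable (fun x => Z x *
      fderiv ℝ (fun y => A y i) x (EuclideanSpace.single i 1)) volume := fun i => hint _
    (hZcont.mul (((hAc i).continuousOn_fderiv_of_isOpen hΩ (by simp)).clm_apply
      continuousOn_const)) fun x hx => by simp [hZK x hx]
  have hI3 : ∀ i, Integrable (fun x => Z x * A x i) volume := fun i => hint _
    (hZcont.mul (hAc i).continuousOn) fun x hx => by simp [hZK x hx]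
  have hmain : ∀ i, ∫ x, Z x * fderiv ℝ (fun y => A y i) x (EuclideanSpace.single i 1)
      = - ∫ x, fderiv ℝ Z x (EuclideanSpace.single i 1) * A x i := fun i =>
    integral_mul_fderiv_eq_neg_fderiv_mul_of_integrable (𝕜 := ℝ) (hI1 i) (hI2 i) (hI3 i)
      (fun x _ => hZd x) fun x hx =>
        ((hAc i).differentiableOn (by simp)).differentiableAt (hΩ.mem_nhds (hKΩ (hsupp hx)))
  have hl : ∫ x in Ω, ζ x * divergence A x
      = ∫ x, ∑ i, Z x * fderiv ℝ (fun y => A y i) x (EuclideanSpace.single i 1) := by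
    refine (setIntegral_congr_fun hΩ.measurableSet fun x hx => ?_).trans
      (setIntegral_eq_integral_of_forall_compl_eq_zero fun x hx => ?_)
    · simp only
      rw [divergence_eq_sum ((hA.differentiableOn (by simp)).differentiableAt (hΩ.mem_nhds hx)),
        Finset.mul_sum, hZ, indicator_of_mem hx]
    · simp [hZ, indicator_of_notMem hx]
  have hr : ∫ x in Ω, fderiv ℝ ζ x (A x)
      = ∫ x, ∑ i, fderiv ℝ Z x (EuclideanSpace.single i 1) * A x i := by
    refine (setIntegral_congr_fun hΩ.measurableSet fun x hx => ?_).trans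
      (setIntegral_eq_integral_of_forall_compl_eq_zero fun x hx => ?_)
    · simp only
      rw [clm_apply_eq_sum, hZf x hx]
      exact Finset.sum_congr rfl fun i _ => mul_comm _ _
    · rw [hZf0 x fun h => hx (hKΩ h)]
      simp
  rw [hl, hr, integral_finsetSum _ fun i _ => hI2 i, integral_finsetSum _ fun i _ => hI1 i,
    ← Finset.sum_neg_distrib]
  exact Finset.sum_congr rfl fun i _ => hmain i

/-- The gradient of a differentiable function vanishes almost everywhere on its zero set. -/
theorem ae_gradient_eq_zero_of_eq_zero (hΩ : IsOpen Ω) {v : Space N → ℝ}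
    (hv : DifferentiableOn ℝ v Ω) :
    ∀ᵐ x ∂(volume.restrict Ω), v x = 0 → gradient v x = 0 := by
  rcases subsingleton_or_nontrivial (Space N) with hs | hs
  · exact Eventually.of_forall fun x _ => Subsingleton.elim _ _
  obtain ⟨c, hc⟩ := exists_ne (0 : Space N)
  have hm : MeasurableSet (Ω ∩ v ⁻¹' {0}ᶜ) :=
    (hv.continuousOn.isOpen_inter_preimage hΩ isOpen_compl_singleton).measurableSet
  have hm' : MeasurableSet (Ω ∩ v ⁻¹' {0}) := by
    have : Ω ∩ v ⁻¹' {0} = Ω \ (Ω ∩ v ⁻¹' {0}ᶜ) := by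
      ext x; simp only [mem_inter_iff, mem_preimage, mem_singleton_iff, Set.mem_sdiff,
        mem_compl_iff]; tauto
    rw [this]
    exact hΩ.measurableSet.diff hm
  have happ : ApproximatesLinearOn (fun x => v x • c) (0 : Space N →L[ℝ] Space N)
      (Ω ∩ v ⁻¹' {0}) 0 := by
    intro x hx y hy
    have h1 : v x = 0 := hx.2
    have h2 : v y = 0 := hy.2
    simp [h1, h2]
  have h := happ.norm_fderiv_sub_le volume hm' (fun x => (fderiv ℝ v x).smulRight c)
    fun x hx => (((hv.differentiableAt (hΩ.mem_nhds hx.1)).hasFDerivAt).smul_const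
      c).hasFDerivWithinAt
  rw [ae_restrict_iff' hm'] at h
  rw [ae_restrict_iff' hΩ.measurableSet]
  filter_upwards [h] with x hx hxΩ hx0
  have h1 := hx ⟨hxΩ, hx0⟩
  rw [sub_zero, nonpos_iff_eq_zero, nnnorm_eq_zero] at h1
  have h2 : fderiv ℝ v x = 0 := by
    ext p
    have h3 := congrArg (fun L : Space N →L[ℝ] Space N => L p) h1
    simpa [hc] using h3
  rw [gradient, h2, map_zero]

end IntegrationByParts

/-! ### Smooth truncations -/

section Cutoffs

/-- An odd smooth nondecreasing function that is `0` on `[-1,1]` and `±1` off `[-2,2]`. -/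
noncomputable def smoothSign (s : ℝ) : ℝ :=
  Real.smoothTransition (s - 1) - Real.smoothTransition (-s - 1)

theorem contDiff_smoothSign : ContDiff ℝ ∞ smoothSign :=
  (Real.smoothTransition.contDiff.comp (contDiff_id.sub contDiff_const)).sub
    (Real.smoothTransition.contDiff.comp (contDiff_neg.sub contDiff_const))

theorem smoothSign_neg (s : ℝ) : smoothSign (-s) = -smoothSign s := by
  simp [smoothSign]

theorem monotone_smoothSign : Monotone smoothSign := by
  intro s t hst
  have h1 := Real.smoothTransition.monotone (show s - 1 ≤ t - 1 by linarith)
  have h2 := Real.smoothTransition.monotone (show -t - 1 ≤ -s - 1 by linarith)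
  simp only [smoothSign]
  linarith

theorem smoothSign_eq_zero {s : ℝ} (hs : |s| ≤ 1) : smoothSign s = 0 := by
  rw [abs_le] at hs
  rw [smoothSign, Real.smoothTransition.zero_of_nonpos (by linarith),
    Real.smoothTransition.zero_of_nonpos (by linarith), sub_zero]

theorem smoothSign_eq_one {s : ℝ} (hs : 2 ≤ s) : smoothSign s = 1 := by
  rw [smoothSign, Real.smoothTransition.one_of_one_le (by linarith),
    Real.smoothTransition.zero_of_nonpos (by linarith), sub_zero]

theorem smoothSign_eq_neg_one {s : ℝ} (hs : s ≤ -2) : smoothSign s = -1 := by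
  rw [← neg_neg s, smoothSign_neg, smoothSign_eq_one (by linarith)]

theorem abs_smoothSign_le (s : ℝ) : |smoothSign s| ≤ 1 := by
  have h1 := Real.smoothTransition.nonneg (s - 1)
  have h2 := Real.smoothTransition.le_one (s - 1)
  have h3 := Real.smoothTransition.nonneg (-s - 1)
  have h4 := Real.smoothTransition.le_one (-s - 1)
  rw [abs_le, smoothSign]
  constructor <;> linarith

theorem smoothSign_nonneg {s : ℝ} (hs : 0 ≤ s) : 0 ≤ smoothSign s := by
  have := monotone_smoothSign hs
  rwa [smoothSign_eq_zero (by simp)] at this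

theorem mul_smoothSign_nonneg (s : ℝ) : 0 ≤ s * smoothSign s := by
  rcases le_total 0 s with hs | hs
  · exact mul_nonneg hs (smoothSign_nonneg hs)
  · have := smoothSign_nonneg (neg_nonneg.2 hs)
    rw [smoothSign_neg] at this
    nlinarith

theorem deriv_smoothSign_eq_zero {s : ℝ} (hs : |s| < 1 ∨ 2 < |s|) : deriv smoothSign s = 0 := by
  have key : ∀ c : ℝ, smoothSign =ᶠ[𝓝 s] (fun _ => c) → deriv smoothSign s = 0 := fun c h => by
    rw [h.deriv_eq, deriv_const]
  rcases hs with hs | hs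
  · refine key 0 ?_
    filter_upwards [(isOpen_lt continuous_abs continuous_const).mem_nhds hs] with r hr
    exact smoothSign_eq_zero (le_of_lt hr)
  · rcases lt_abs.1 hs with h | h
    · refine key 1 ?_
      filter_upwards [Ioi_mem_nhds h] with r hr using smoothSign_eq_one (le_of_lt hr)
    · refine key (-1) ?_
      filter_upwards [Iio_mem_nhds (show s < -2 by linarith)] with r hr using
        smoothSign_eq_neg_one (le_of_lt hr)

theorem deriv_smoothSign_nonneg (s : ℝ) : 0 ≤ deriv smoothSign s :=
  monotone_smoothSign.deriv_nonneg

theorem exists_deriv_smoothSign_le : ∃ D : ℝ, 0 ≤ D ∧ ∀ s, |s| * deriv smoothSign s ≤ D := by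
  obtain ⟨C, hC⟩ := (isCompact_Icc (a := (-2 : ℝ)) (b := 2)).exists_bound_of_continuousOn
    (f := fun s => |s| * deriv smoothSign s)
    (continuous_abs.mul (contDiff_smoothSign.continuous_deriv (by simp))).continuousOn
  refine ⟨max C 0, le_max_right _ _, fun s => ?_⟩
  by_cases hs : |s| ≤ 2
  · exact ((le_abs_self _).trans (hC s (abs_le.1 hs))).trans (le_max_left _ _)
  · rw [deriv_smoothSign_eq_zero (Or.inr (not_le.1 hs)), mul_zero]
    exact le_max_right _ _

/-- A truncation at level `η`: a `C¹` function `β` that vanishes on `[-η, η]`, with a primitive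
`B`. Composed with a function that vanishes on `∂Ω`, it has compact support in `Ω`. -/
structure IsTruncation (η : ℝ) (β B : ℝ → ℝ) : Prop where
  contDiff : ContDiff ℝ 1 β
  eq_zero : ∀ s, |s| ≤ η → β s = 0
  hasDerivAt : ∀ s, HasDerivAt B (β s) s

theorem hasDerivAt_primitive {β : ℝ → ℝ} (hβ : Continuous β) (s : ℝ) :
    HasDerivAt (fun s => ∫ r in (0 : ℝ)..s, β r) (β s) s :=
  intervalIntegral.integral_hasDerivAt_right (hβ.intervalIntegrable _ _)
    (hβ.stronglyMeasurableAtFilter _ _) hβ.continuousAt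

/-- Truncations of the sign function; `B` is then close to the absolute value. -/
theorem exists_truncation_sign : ∃ D : ℝ, 0 ≤ D ∧ ∀ η : ℝ, 0 < η → ∃ β B : ℝ → ℝ,
    IsTruncation η β B ∧ (∀ s, |β s| ≤ 1) ∧ (∀ s, 0 ≤ s * β s) ∧ (∀ s, 0 ≤ deriv β s) ∧
    (∀ s, |s| * deriv β s ≤ D) ∧ (∀ s, 2 * η < |s| → deriv β s = 0) ∧
    (∀ s, |s| - 2 * η ≤ B s ∧ B s ≤ |s|) := by
  obtain ⟨D, hD0, hD⟩ := exists_deriv_smoothSign_le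
  refine ⟨D, hD0, fun η hη => ?_⟩
  set β : ℝ → ℝ := fun s => smoothSign (s / η) with hβ
  have hβc : ContDiff ℝ 1 β :=
    (contDiff_smoothSign.of_le (by simp)).comp (contDiff_id.div_const η)
  have hder : ∀ s, deriv β s = deriv smoothSign (s / η) / η := fun s => by
    have h1 : HasDerivAt smoothSign (deriv smoothSign (s / η)) (s / η) :=
      (contDiff_smoothSign.differentiable (by simp) _).hasDerivAt
    have h2 := h1.comp s ((hasDerivAt_id s).div_const η)
    have h3 : deriv β s = _ := h2.deriv
    rw [h3, mul_one_div]
  have hcont : Continuous β := hβc.continuous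
  have hpos : ∀ s, 0 ≤ s → |s| - 2 * η ≤ ∫ r in (0 : ℝ)..s, β r := fun s hs => by
    have hβ0 : ∀ r ∈ Icc (0 : ℝ) s, 0 ≤ β r := fun r hr =>
      smoothSign_nonneg (div_nonneg hr.1 hη.le)
    rw [abs_of_nonneg hs]
    rcases le_total s (2 * η) with h | h
    · linarith [intervalIntegral.integral_nonneg (μ := volume) hs hβ0]
    · rw [← intervalIntegral.integral_add_adjacent_intervals (b := 2 * η)
        (hcont.intervalIntegrable _ _) (hcont.intervalIntegrable _ _)]
      have h1 : 0 ≤ ∫ r in (0 : ℝ)..(2 * η), β r :=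
        intervalIntegral.integral_nonneg (by positivity) fun r hr => hβ0 r ⟨hr.1, hr.2.trans h⟩
      have h2 : ∫ r in (2 * η)..s, β r = ∫ r in (2 * η)..s, (1 : ℝ) := by
        refine intervalIntegral.integral_congr fun r hr => ?_
        rw [uIcc_of_le h] at hr
        exact smoothSign_eq_one (by rw [le_div_iff₀ hη]; exact hr.1)
      rw [h2]
      simp only [intervalIntegral.integral_const, smul_eq_mul, mul_one]
      linarith
  have heven : ∀ s, ∫ r in (0 : ℝ)..(-s), β r = ∫ r in (0 : ℝ)..s, β r := fun s => by
    have h1 := intervalIntegral.integral_comp_neg (a := 0) (b := s) (f := β)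
    have h2 : ∀ r, β (-r) = - β r := fun r => by simp [hβ, neg_div, smoothSign_neg]
    simp only [h2, intervalIntegral.integral_neg, neg_zero] at h1
    rw [intervalIntegral.integral_symm, ← h1, neg_neg]
  have hle1 : ∀ s, |β s| ≤ 1 := fun s => abs_smoothSign_le _
  refine ⟨β, fun s => ∫ r in (0 : ℝ)..s, β r, ⟨hβc, ?_, hasDerivAt_primitive hcont⟩, hle1, ?_, ?_,
    ?_, ?_, fun s => ⟨?_, ?_⟩⟩
  · intro s hs
    refine smoothSign_eq_zero ?_
    rwa [abs_div, abs_of_pos hη, div_le_one hη]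
  · intro s
    have := mul_smoothSign_nonneg (s / η)
    have h2 : s * β s = η * (s / η * smoothSign (s / η)) := by
      rw [hβ]; field_simp
    rw [h2]
    positivity
  · intro s
    rw [hder]
    exact div_nonneg (deriv_smoothSign_nonneg _) hη.le
  · intro s
    have := hD (s / η)
    rw [abs_div, abs_of_pos hη] at this
    rw [hder]
    calc _ = |s| / η * deriv smoothSign (s / η) := by ring
      _ ≤ D := this
  · intro s hs
    rw [hder, deriv_smoothSign_eq_zero, zero_div]
    right
    rwa [abs_div, abs_of_pos hη, lt_div_iff₀ hη]
  · rcases le_total 0 s with hs | hs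
    · exact hpos s hs
    · have := hpos (-s) (neg_nonneg.2 hs)
      rwa [abs_neg, heven] at this
  · have := intervalIntegral.norm_integral_le_of_norm_le_const (a := 0) (b := s) (f := β) (C := 1)
      fun r _ => hle1 r
    rw [sub_zero, one_mul] at this
    exact (le_abs_self _).trans this

/-- Truncations of the identity: `β` is odd, `0 ≤ β' ≤ 1`, and `β' = 1` off `[-2η, 2η]`. -/
theorem exists_truncation_id (η : ℝ) (hη : 0 < η) : ∃ β B : ℝ → ℝ,
    IsTruncation η β B ∧ (∀ s, 0 ≤ deriv β s) ∧ (∀ s, deriv β s ≤ 1) ∧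
    (∀ s, 2 * η ≤ |s| → deriv β s = 1) ∧ (∀ s, |β s| ≤ |s|) ∧ (∀ s, |B s| ≤ s ^ 2) := by
  set ψ : ℝ → ℝ := fun s => smoothSign (s / η) ^ 2 with hψ
  have hψc : Continuous ψ := ((contDiff_smoothSign.continuous).comp (by fun_prop)).pow 2
  have hψ1 : ∀ s, ψ s ≤ 1 := fun s => by
    have := abs_smoothSign_le (s / η)
    rw [hψ]
    exact (sq_le_one_iff_abs_le_one _).2 this
  have hψ0 : ∀ s, 0 ≤ ψ s := fun s => sq_nonneg _
  set β : ℝ → ℝ := fun s => ∫ r in (0 : ℝ)..s, ψ r with hβ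
  have hβd : ∀ s, HasDerivAt β (ψ s) s := hasDerivAt_primitive hψc
  have hβd' : deriv β = ψ := funext fun s => (hβd s).deriv
  have hβc : ContDiff ℝ 1 β := by
    rw [contDiff_one_iff_deriv]
    exact ⟨fun s => (hβd s).differentiableAt, by rwa [hβd']⟩
  have hβle : ∀ s, |β s| ≤ |s| := fun s => by
    have := intervalIntegral.norm_integral_le_of_norm_le_const (a := 0) (b := s) (f := ψ) (C := 1)
      fun r _ => by rw [Real.norm_of_nonneg (hψ0 r)]; exact hψ1 r
    simpa using this
  refine ⟨β, fun s => ∫ r in (0 : ℝ)..s, β r, ⟨hβc, ?_, hasDerivAt_primitive hβc.continuous⟩,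
    by simpa [hβd'] using hψ0, by simpa [hβd'] using hψ1, ?_, hβle, ?_⟩
  · intro s hs
    rw [hβ]
    have : ∫ r in (0 : ℝ)..s, ψ r = ∫ r in (0 : ℝ)..s, (0 : ℝ) := by
      refine intervalIntegral.integral_congr fun r hr => ?_
      have h1 : |r| ≤ |s| := by
        have := abs_sub_left_of_mem_uIcc hr
        simpa using this
      simp only [hψ]
      rw [smoothSign_eq_zero, zero_pow two_ne_zero]
      rw [abs_div, abs_of_pos hη, div_le_one hη]
      exact h1.trans hs
    simp [this]
  · intro s hs
    rw [hβd', hψ]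
    simp only
    rw [← sq_abs]
    have h2 : |smoothSign (s / η)| = 1 := by
      rcases le_abs.1 hs with h | h
      · rw [smoothSign_eq_one (by rwa [le_div_iff₀ hη]), abs_one]
      · rw [smoothSign_eq_neg_one (by rw [div_le_iff₀ hη]; linarith), abs_neg, abs_one]
    rw [h2, one_pow]
  · intro s
    have := intervalIntegral.norm_integral_le_of_norm_le_const (a := 0) (b := s) (f := β)
      (C := |s|) fun r hr => by
        refine (hβle r).trans ?_
        have := abs_sub_left_of_mem_uIcc (uIoc_subset_uIcc hr)
        simpa using this
    rw [sub_zero, ← abs_mul, ← sq, abs_of_nonneg (sq_nonneg s)] at this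
    exact this

end Cutoffs

/-! ### Conservation laws and their weak form -/

/-- `z` is a classical solution of `∂ₜz = ∇·A + g` in `Ω × (0,S)`, continuous up to the boundary,
with `z = 0` on `∂Ω × (0,S)`. The flux `A` and the right-hand side `g` are given functions
of `(x, t)`. -/
structure IsConservationLaw {N : ℕ} (Ω : Set (Space N)) (S : ℝ) (z : Space N → ℝ → ℝ)
    (A : Space N → ℝ → Space N) (g : Space N → ℝ → ℝ) : Prop where
  cont : ContinuousOn (fun p : Space N × ℝ => z p.1 p.2) (closure Ω ×ˢ Icc 0 S)
  boundary : ∀ x ∈ frontier Ω, ∀ t ∈ Ioo 0 S, z x t = 0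
  diff_time : ∀ x ∈ Ω, ∀ t ∈ Ioo 0 S, DifferentiableAt ℝ (z x) t
  cont_time : ContinuousOn (fun p : Space N × ℝ => timeDeriv z p.1 p.2) (cylinder Ω S)
  diff_space : ∀ t ∈ Ioo 0 S, ContDiffOn ℝ 1 (fun x => z x t) Ω
  cont_grad : ContinuousOn (fun p : Space N × ℝ => spaceGrad z p.1 p.2) (cylinder Ω S)
  flux : ∀ t ∈ Ioo 0 S, ContDiffOn ℝ 1 (fun x => A x t) Ω
  equation : ∀ x ∈ Ω, ∀ t ∈ Ioo 0 S, timeDeriv z x t = divergence (fun y => A y t) x + g x t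

section WeakForm

variable {N : ℕ} {Ω : Set (Space N)} {S : ℝ} {z : Space N → ℝ → ℝ}
  {A : Space N → ℝ → Space N} {g : Space N → ℝ → ℝ} {β B : ℝ → ℝ} {η : ℝ}

theorem continuousOn_slice {F : Type*} [TopologicalSpace F] {h : Space N × ℝ → F}
    (hh : ContinuousOn h (cylinder Ω S)) {t : ℝ} (ht : t ∈ Ioo 0 S) :
    ContinuousOn (fun x => h (x, t)) Ω :=
  hh.comp (f := fun x : Space N => (x, t)) (by fun_prop) fun _ hx => ⟨hx, ht⟩

theorem isOpen_cylinder (hΩ : IsOpen Ω) : IsOpen (cylinder Ω S) := hΩ.prod isOpen_Ioo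

theorem volume_restrict_prod (s : Set (Space N)) (I : Set ℝ) :
    (volume : Measure (Space N × ℝ)).restrict (s ×ˢ I)
      = (volume.restrict s).prod (volume.restrict I) := by
  rw [Measure.prod_restrict, ← Measure.volume_eq_prod]

theorem isCompact_closure_of_bounded (hb : Bornology.IsBounded Ω) : IsCompact (closure Ω) :=
  Metric.isCompact_of_isClosed_isBounded isClosed_closure hb.closure

theorem volume_lt_top_of_bounded (hb : Bornology.IsBounded Ω) : volume Ω < ⊤ :=
  hb.measure_lt_top

/-- The set where a solution is at least `η` in absolute value, in a time interval that stays
away from `0` and `S`, is a compact subset of `Ω × (0,S)`. -/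
theorem IsConservationLaw.isCompact_superlevel (h : IsConservationLaw Ω S z A g) (hΩ : IsOpen Ω)
    (hb : Bornology.IsBounded Ω) (hη : 0 < η) {a b : ℝ} (ha : 0 < a) (hbS : b < S) :
    IsCompact ((closure Ω ×ˢ Icc a b) ∩ {p : Space N × ℝ | η ≤ |z p.1 p.2|}) ∧
      (closure Ω ×ˢ Icc a b) ∩ {p : Space N × ℝ | η ≤ |z p.1 p.2|} ⊆ Ω ×ˢ Icc a b := by
  have hsub : closure Ω ×ˢ Icc a b ⊆ closure Ω ×ˢ Icc 0 S :=
    prod_mono_right (Icc_subset_Icc ha.le hbS.le)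
  constructor
  · have hc : IsCompact (closure Ω ×ˢ Icc a b) :=
      (isCompact_closure_of_bounded hb).prod isCompact_Icc
    exact hc.of_isClosed_subset ((h.cont.mono hsub).abs.preimage_isClosed_of_isClosed hc.isClosed
      isClosed_Ici) inter_subset_left
  · rintro ⟨x, t⟩ ⟨⟨hx, ht⟩, hz⟩
    refine ⟨?_, ht⟩
    by_contra hxΩ
    have hfr : x ∈ frontier Ω := by
      rw [hΩ.frontier_eq]; exact ⟨hx, hxΩ⟩
    have := h.boundary x hfr t ⟨ha.trans_le ht.1, ht.2.trans_lt hbS⟩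
    simp only [mem_ofPred_eq, this, abs_zero] at hz
    linarith

theorem IsConservationLaw.isCompact_superlevel_slice (h : IsConservationLaw Ω S z A g)
    (hΩ : IsOpen Ω) (hb : Bornology.IsBounded Ω) (hη : 0 < η) {t : ℝ} (ht : t ∈ Ioo 0 S) :
    ∃ K, IsCompact K ∧ K ⊆ Ω ∧ ∀ x ∈ Ω, x ∉ K → |z x t| ≤ η := by
  obtain ⟨h1, h2⟩ := h.isCompact_superlevel hΩ hb hη ht.1 ht.2 (a := t) (b := t)
  refine ⟨_, h1.image continuous_fst, ?_, ?_⟩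
  · rintro _ ⟨p, hp, rfl⟩
    exact (h2 hp).1
  · intro x hx hxK
    by_contra hlt
    exact hxK ⟨(x, t), ⟨⟨subset_closure hx, left_mem_Icc.2 le_rfl⟩, (not_le.1 hlt).le⟩, rfl⟩

theorem IsTruncation.continuous_deriv (hβ : IsTruncation η β B) : Continuous (deriv β) :=
  hβ.contDiff.continuous_deriv (by simp)

theorem IsTruncation.continuous_primitive (hβ : IsTruncation η β B) : Continuous B :=
  continuous_iff_continuousAt.2 fun s => (hβ.hasDerivAt s).continuousAt

/-- The derivative of a truncation at level `η` vanishes on `[-η, η]`, endpoints included. -/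
theorem IsTruncation.deriv_eq_zero (hβ : IsTruncation η β B) (hη : 0 < η) {s : ℝ}
    (hs : |s| ≤ η) : deriv β s = 0 := by
  have h1 : EqOn (deriv β) (fun _ => 0) (Ioo (-η) η) := fun r hr => by
    have : β =ᶠ[𝓝 r] fun _ => 0 := by
      filter_upwards [isOpen_Ioo.mem_nhds hr] with q hq
      exact hβ.eq_zero q (abs_le.2 ⟨hq.1.le, hq.2.le⟩)
    rw [this.deriv_eq, deriv_const]
  have h2 := h1.closure hβ.continuous_deriv continuous_const
  rw [closure_Ioo (by linarith)] at h2
  exact h2 (abs_le.1 hs)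

theorem IsConservationLaw.continuousOn_rhs (h : IsConservationLaw Ω S z A g) (hΩ : IsOpen Ω)
    {t : ℝ} (ht : t ∈ Ioo 0 S) : ContinuousOn (fun x => g x t) Ω :=
  ((continuousOn_slice h.cont_time ht).sub (continuousOn_divergence hΩ (h.flux t ht))).congr
    fun x hx => by simp [h.equation x hx t ht]

theorem IsConservationLaw.integrableOn_truncation (h : IsConservationLaw Ω S z A g)
    (hΩ : IsOpen Ω) (hb : Bornology.IsBounded Ω) (hη : 0 < η) {t : ℝ} (ht : t ∈ Ioo 0 S)
    {γ : ℝ → ℝ} (hγ : Continuous γ) (hγ0 : ∀ s, |s| ≤ η → γ s = 0) {F : Space N → ℝ}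
    (hF : ContinuousOn F Ω) : IntegrableOn (fun x => γ (z x t) * F x) Ω := by
  obtain ⟨K, hK, hKΩ, hK0⟩ := h.isCompact_superlevel_slice hΩ hb hη ht
  refine integrableOn_of_continuousOn_of_eq_zero hΩ.measurableSet hK ?_ fun x hx hxK => by
    rw [hγ0 _ (hK0 x hx hxK), zero_mul]
  exact ((hγ.comp_continuousOn (h.diff_space t ht).continuousOn).mul hF).mono hKΩ

/-- The weak form of the equation at a fixed time, tested with a truncation of the solution. -/
theorem IsConservationLaw.integral_truncation_mul_timeDeriv (h : IsConservationLaw Ω S z A g)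
    (hΩ : IsOpen Ω) (hb : Bornology.IsBounded Ω) (hη : 0 < η) (hβ : IsTruncation η β B) {t : ℝ}
    (ht : t ∈ Ioo 0 S) :
    ∫ x in Ω, β (z x t) * timeDeriv z x t
      = ∫ x in Ω, (β (z x t) * g x t - deriv β (z x t) * inner ℝ (A x t) (spaceGrad z x t)) := by
  obtain ⟨K, hK, hKΩ, hK0⟩ := h.isCompact_superlevel_slice hΩ hb hη ht
  have hz1 := h.diff_space t ht
  have hibp := integral_mul_divergence hΩ hK hKΩ (hβ.contDiff.comp_contDiffOn hz1)
    (fun x hx hxK => hβ.eq_zero _ (hK0 x hx hxK)) (h.flux t ht)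
  have i1 : IntegrableOn (fun x => β (z x t) * g x t) Ω :=
    h.integrableOn_truncation hΩ hb hη ht hβ.contDiff.continuous hβ.eq_zero
      (h.continuousOn_rhs hΩ ht)
  have i2 : IntegrableOn (fun x => β (z x t) * divergence (fun y => A y t) x) Ω :=
    h.integrableOn_truncation hΩ hb hη ht hβ.contDiff.continuous hβ.eq_zero
      (continuousOn_divergence hΩ (h.flux t ht))
  have i3 : IntegrableOn (fun x => deriv β (z x t) * inner ℝ (A x t) (spaceGrad z x t)) Ω :=
    h.integrableOn_truncation hΩ hb hη ht hβ.continuous_deriv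
      (fun s hs => hβ.deriv_eq_zero hη hs)
      ((h.flux t ht).continuousOn.inner (continuousOn_slice h.cont_grad ht))
  have hchain : ∫ x in Ω, fderiv ℝ (β ∘ fun x => z x t) x (A x t)
      = ∫ x in Ω, deriv β (z x t) * inner ℝ (A x t) (spaceGrad z x t) := by
    refine setIntegral_congr_fun hΩ.measurableSet fun x hx => ?_
    have h1 : HasDerivAt β (deriv β (z x t)) (z x t) :=
      (hβ.contDiff.differentiable (by simp) _).hasDerivAt
    have h2 := ((hz1.differentiableOn (by simp)).differentiableAt (hΩ.mem_nhds hx)).hasFDerivAt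
    have h3 : HasFDerivAt (β ∘ fun x => z x t) _ x := h1.comp_hasFDerivAt x h2
    rw [h3.fderiv, spaceGrad, inner_gradient_eq_fderiv]
    rfl
  rw [integral_sub i1 i3, ← hchain, sub_eq_add_neg, ← hibp]
  simp only [Function.comp]
  rw [← integral_add i1 i2]
  refine setIntegral_congr_fun hΩ.measurableSet fun x hx => ?_
  rw [h.equation x hx t ht]
  ring

theorem IsConservationLaw.integrable_truncation_prod (h : IsConservationLaw Ω S z A g)
    (hΩ : IsOpen Ω) (hb : Bornology.IsBounded Ω) (hη : 0 < η) {a b : ℝ} (ha : 0 < a)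
    (hbS : b < S) {γ : ℝ → ℝ} (hγ : Continuous γ) (hγ0 : ∀ s, |s| ≤ η → γ s = 0)
    {F : Space N × ℝ → ℝ} (hF : ContinuousOn F (cylinder Ω S)) :
    Integrable (fun p : Space N × ℝ => γ (z p.1 p.2) * F p)
      ((volume.restrict Ω).prod (volume.restrict (Ioc a b))) := by
  obtain ⟨hK, hKs⟩ := h.isCompact_superlevel hΩ hb hη ha hbS
  have hI : Ω ×ˢ Icc a b ⊆ cylinder Ω S :=
    prod_mono_right fun t ht => ⟨ha.trans_le ht.1, ht.2.trans_lt hbS⟩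
  have hc : ContinuousOn (fun p : Space N × ℝ => γ (z p.1 p.2) * F p) (Ω ×ˢ Icc a b) := by
    refine (hγ.comp_continuousOn (h.cont.mono ?_)).mul (hF.mono hI)
    exact prod_mono subset_closure (Icc_subset_Icc ha.le hbS.le)
  have h1 : IntegrableOn (fun p : Space N × ℝ => γ (z p.1 p.2) * F p) (Ω ×ˢ Icc a b) volume := by
    refine integrableOn_of_continuousOn_of_eq_zero
      (hΩ.measurableSet.prod measurableSet_Icc) hK (hc.mono hKs) ?_
    rintro ⟨x, t⟩ ⟨hx, ht⟩ hnot
    have : |z x t| ≤ η := by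
      by_contra hlt
      exact hnot ⟨⟨subset_closure hx, ht⟩, (not_le.1 hlt).le⟩
    simp [hγ0 _ this]
  rw [← volume_restrict_prod]
  exact h1.mono_set (prod_mono_right Ioc_subset_Icc_self)

theorem IsConservationLaw.integrableOn_comp (h : IsConservationLaw Ω S z A g)
    (hb : Bornology.IsBounded Ω) {t : ℝ} (ht : t ∈ Icc 0 S) {γ : ℝ → ℝ}
    (hγ : Continuous γ) : IntegrableOn (fun x => γ (z x t)) Ω := by
  have hc : ContinuousOn (fun x => γ (z x t)) (closure Ω) :=
    hγ.comp_continuousOn (h.cont.comp (f := fun x : Space N => (x, t)) (by fun_prop)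
      fun x hx => ⟨hx, ht⟩)
  exact (hc.integrableOn_compact (isCompact_closure_of_bounded hb)).mono_set subset_closure

/-- The change of `∫ B(z)` in time, for a primitive `B` of a truncation `β`. -/
theorem IsConservationLaw.integral_primitive_sub (h : IsConservationLaw Ω S z A g)
    (hΩ : IsOpen Ω) (hb : Bornology.IsBounded Ω) (hη : 0 < η) (hβ : IsTruncation η β B) {a b : ℝ}
    (ha : 0 < a) (hab : a ≤ b) (hbS : b < S) :
    (∫ x in Ω, B (z x b)) - ∫ x in Ω, B (z x a)
      = ∫ t in Ioc a b, ∫ x in Ω, β (z x t) * timeDeriv z x t := by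
  have hi := h.integrable_truncation_prod hΩ hb hη ha hbS hβ.contDiff.continuous hβ.eq_zero
    h.cont_time
  have hBc := hβ.continuous_primitive
  rw [← integral_sub
    (h.integrableOn_comp hb ⟨(ha.le.trans hab), hbS.le⟩ hBc)
    (h.integrableOn_comp hb ⟨ha.le, (hab.trans hbS.le)⟩ hBc),
    ← integral_integral_swap (μ := volume.restrict Ω) (ν := volume.restrict (Ioc a b))
      (f := fun x t => β (z x t) * timeDeriv z x t) hi]
  refine setIntegral_congr_fun hΩ.measurableSet fun x hx => ?_
  rw [← intervalIntegral.integral_of_le hab]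
  have hsub : ∀ t ∈ uIcc a b, t ∈ Ioo 0 S := fun t ht => by
    rw [uIcc_of_le hab] at ht
    exact ⟨ha.trans_le ht.1, ht.2.trans_lt hbS⟩
  have hd : ∀ t ∈ uIcc a b, HasDerivAt (fun t => B (z x t)) (β (z x t) * timeDeriv z x t) t :=
    fun t ht => (hβ.hasDerivAt _).comp t (h.diff_time x hx t (hsub t ht)).hasDerivAt
  refine (intervalIntegral.integral_eq_sub_of_hasDerivAt hd ?_).symm
  refine ContinuousOn.intervalIntegrable ?_
  refine ContinuousOn.mul ?_ ?_
  · refine hβ.contDiff.continuous.comp_continuousOn fun t ht => ?_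
    exact (h.diff_time x hx t (hsub t ht)).continuousAt.continuousWithinAt
  · exact h.cont_time.comp (f := fun t : ℝ => (x, t)) (by fun_prop) fun t ht => ⟨hx, hsub t ht⟩

end WeakForm

/-! ### The `L¹` estimate -/

section Contraction

variable {N : ℕ} {Ω : Set (Space N)} {S : ℝ} {z : Space N → ℝ → ℝ}
  {A : Space N → ℝ → Space N} {g : Space N → ℝ → ℝ}

theorem IsConservationLaw.exists_abs_le (h : IsConservationLaw Ω S z A g)
    (hb : Bornology.IsBounded Ω) :
    ∃ C, 0 ≤ C ∧ ∀ x ∈ closure Ω, ∀ t ∈ Icc 0 S, |z x t| ≤ C := by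
  obtain ⟨C, hC⟩ := ((isCompact_closure_of_bounded hb).prod
    isCompact_Icc).exists_bound_of_continuousOn h.cont
  exact ⟨max C 0, le_max_right _ _, fun x hx t ht => (hC (x, t) ⟨hx, ht⟩).trans (le_max_left _ _)⟩

theorem IsConservationLaw.tendsto_integral_abs (h : IsConservationLaw Ω S z A g)
    (hΩ : IsOpen Ω) (hb : Bornology.IsBounded Ω) (hS : 0 < S) :
    Tendsto (fun a => ∫ x in Ω, |z x a|) (𝓝[>] 0) (𝓝 (∫ x in Ω, |z x 0|)) := by
  obtain ⟨C, -, hC⟩ := h.exists_abs_le hb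
  have hmem : ∀ᶠ a in 𝓝[>] (0 : ℝ), a ∈ Ioo 0 S := Ioo_mem_nhdsGT hS
  have : IsFiniteMeasure (volume.restrict Ω) :=
    ⟨by simpa using volume_lt_top_of_bounded hb⟩
  refine tendsto_integral_filter_of_dominated_convergence (fun _ => C) ?_ ?_
    (integrable_const C) ?_
  · filter_upwards [hmem] with a ha
    exact ((h.integrableOn_comp hb (Ioo_subset_Icc_self ha) continuous_abs)).1
  · filter_upwards [hmem] with a ha
    filter_upwards [ae_restrict_mem hΩ.measurableSet] with x hx
    simpa using hC x (subset_closure hx) a (Ioo_subset_Icc_self ha)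
  · filter_upwards [ae_restrict_mem hΩ.measurableSet] with x hx
    have h1 : ContinuousWithinAt (fun t => z x t) (Icc 0 S) 0 :=
      (h.cont.comp (f := fun t : ℝ => (x, t)) (by fun_prop)
        fun t ht => ⟨subset_closure hx, ht⟩) 0 (left_mem_Icc.2 hS.le)
    have h2 : Tendsto (fun t => z x t) (𝓝[>] 0) (𝓝 (z x 0)) :=
      h1.mono_left (nhdsWithin_le_of_mem (mem_of_superset (Ioo_mem_nhdsGT hS)
        Ioo_subset_Icc_self))
    exact h2.abs

theorem mul_le_of_mul_le_abs_mul {s b g e : ℝ} (hs : s * g ≤ |s| * e) (hb : |b| ≤ 1)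
    (hsb : 0 ≤ s * b) (h0 : s = 0 → b = 0) (he : 0 ≤ e) : b * g ≤ e := by
  rcases lt_trichotomy s 0 with h | h | h
  · rw [abs_of_neg h] at hs
    have hb0 : b ≤ 0 := by nlinarith
    have : -e ≤ g := by nlinarith
    rw [abs_le] at hb
    nlinarith
  · rw [h0 h, zero_mul]; exact he
  · rw [abs_of_pos h] at hs
    have hb0 : 0 ≤ b := by nlinarith
    have : g ≤ e := by nlinarith
    rw [abs_le] at hb
    nlinarith

/-- The `L¹` estimate: testing with truncations of the sign of `z`, the flux term contributes at
most `∫∫ |z| β'(z) H`, which tends to `0` with the truncation level, because `|s| β'(s)` is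
bounded and supported near `0`. -/
theorem IsConservationLaw.integral_abs_le (h : IsConservationLaw Ω S z A g)
    (hΩ : IsOpen Ω) (hb : Bornology.IsBounded Ω) {H e : Space N × ℝ → ℝ}
    (hHc : ContinuousOn H (cylinder Ω S)) (hH0 : ∀ p ∈ cylinder Ω S, 0 ≤ H p)
    (hHi : IntegrableOn H (cylinder Ω S))
    (he0 : ∀ p ∈ cylinder Ω S, 0 ≤ e p)
    (hei : IntegrableOn e (cylinder Ω S))
    (hA : ∀ x ∈ Ω, ∀ t ∈ Ioo 0 S, -(|z x t| * H (x, t)) ≤ inner ℝ (A x t) (spaceGrad z x t))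
    (hg : ∀ x ∈ Ω, ∀ t ∈ Ioo 0 S, z x t * g x t ≤ |z x t| * e (x, t))
    {b : ℝ} (hbS : b ∈ Ioo 0 S) :
    ∫ x in Ω, |z x b| ≤ (∫ x in Ω, |z x 0|) + ∫ p in cylinder Ω S, e p := by
  have hQ : MeasurableSet (cylinder Ω S) := (isOpen_cylinder hΩ).measurableSet
  obtain ⟨D, hD0, hex⟩ := exists_truncation_sign
  have hpos : ∀ n : ℕ, (0 : ℝ) < 1 / ((n : ℝ) + 1) := fun n => by positivity
  have hex' := fun n : ℕ => hex _ (hpos n)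
  choose β B hT hβ1 hβs hβ' hβD hβ2 hB using hex'
  have hzc : ContinuousOn (fun p : Space N × ℝ => z p.1 p.2) (cylinder Ω S) :=
    h.cont.mono (prod_mono subset_closure Ioo_subset_Icc_self)
  set ψ : ℕ → Space N × ℝ → ℝ := fun n p => deriv (β n) (z p.1 p.2) * (|z p.1 p.2| * H p) with hψ
  have hψ0 : ∀ n, ∀ p ∈ cylinder Ω S, 0 ≤ ψ n p := fun n p hp =>
    mul_nonneg (hβ' n _) (mul_nonneg (abs_nonneg _) (hH0 p hp))
  have hψD : ∀ n, ∀ p ∈ cylinder Ω S, ψ n p ≤ D * H p := fun n p hp => by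
    rw [hψ]
    simp only
    rw [← mul_assoc, mul_comm (deriv (β n) _)]
    exact mul_le_mul_of_nonneg_right (hβD n _) (hH0 p hp)
  have hψc : ∀ n, ContinuousOn (ψ n) (cylinder Ω S) := fun n =>
    ((hT n).continuous_deriv.comp_continuousOn hzc).mul (hzc.abs.mul hHc)
  have hψi : ∀ n, IntegrableOn (ψ n) (cylinder Ω S) := fun n => by
    refine Integrable.mono' (hHi.const_mul D) ((hψc n).aestronglyMeasurable hQ) ?_
    filter_upwards [ae_restrict_mem hQ] with p hp
    rw [Real.norm_of_nonneg (hψ0 n p hp)]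
    exact hψD n p hp
  have hψlim : Tendsto (fun n => ∫ p in cylinder Ω S, ψ n p) atTop (𝓝 0) := by
    have := tendsto_integral_of_dominated_convergence (μ := volume.restrict (cylinder Ω S))
      (F := ψ) (f := fun _ => 0) (fun p => D * H p) (fun n => (hψi n).1) (hHi.const_mul D) ?_ ?_
    · simpa using this
    · intro n
      filter_upwards [ae_restrict_mem hQ] with p hp
      rw [Real.norm_of_nonneg (hψ0 n p hp)]
      exact hψD n p hp
    · refine Eventually.of_forall fun p => ?_
      rcases eq_or_ne (z p.1 p.2) 0 with h0 | h0
      · simp [hψ, h0]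
      · have hev : ∀ᶠ n : ℕ in atTop, 2 * (1 / ((n : ℝ) + 1)) < |z p.1 p.2| := by
          have := (tendsto_one_div_add_atTop_nhds_zero_nat (𝕜 := ℝ)).const_mul 2
          rw [mul_zero] at this
          exact (tendsto_order.1 this).2 _ (abs_pos.2 h0)
        refine tendsto_const_nhds.congr' ?_
        filter_upwards [hev] with n hn
        simp [hψ, hβ2 n _ hn]
  have hvol : (0 : ℝ) ≤ volume.real Ω := measureReal_nonneg
  have : IsFiniteMeasure (volume.restrict Ω) :=
    ⟨by simpa using volume_lt_top_of_bounded hb⟩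
  -- the estimate between two positive times
  have hab : ∀ a ∈ Ioo 0 b,
      ∫ x in Ω, |z x b| ≤ (∫ x in Ω, |z x a|) + ∫ p in cylinder Ω S, e p := by
    intro a ha
    have haS : a ∈ Ioo 0 S := ⟨ha.1, ha.2.trans hbS.2⟩
    have hsub : Ω ×ˢ Ioc a b ⊆ cylinder Ω S :=
      prod_mono_right fun t ht => ⟨ha.1.trans ht.1, ht.2.trans_lt hbS.2⟩
    have key : ∀ n : ℕ, ∫ x in Ω, |z x b| ≤ (∫ x in Ω, |z x a|) + (∫ p in cylinder Ω S, e p)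
        + ((∫ p in cylinder Ω S, ψ n p) + 2 * (1 / ((n : ℝ) + 1)) * volume.real Ω) := by
      intro n
      have hBc := (hT n).continuous_primitive
      have hsubt := h.integral_primitive_sub hΩ hb (hpos n) (hT n) ha.1 ha.2.le hbS.2
      have hup : ∫ x in Ω, B n (z x a) ≤ ∫ x in Ω, |z x a| :=
        setIntegral_mono_on (h.integrableOn_comp hb (Ioo_subset_Icc_self haS) hBc)
          (h.integrableOn_comp hb (Ioo_subset_Icc_self haS) continuous_abs) hΩ.measurableSet
          fun x _ => (hB n _).2
      have hlow : (∫ x in Ω, |z x b|) - 2 * (1 / ((n : ℝ) + 1)) * volume.real Ω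
          ≤ ∫ x in Ω, B n (z x b) := by
        have h1 : ∫ x in Ω, (|z x b| - 2 * (1 / ((n : ℝ) + 1)))
            = (∫ x in Ω, |z x b|) - 2 * (1 / ((n : ℝ) + 1)) * volume.real Ω := by
          rw [integral_sub (h.integrableOn_comp hb (Ioo_subset_Icc_self hbS) continuous_abs)
            (integrable_const _), integral_const, measureReal_restrict_apply_univ, smul_eq_mul,
            mul_comm (volume.real Ω)]
        rw [← h1]
        exact setIntegral_mono_on ((h.integrableOn_comp hb (Ioo_subset_Icc_self hbS)
          continuous_abs).sub (integrable_const _))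
          (h.integrableOn_comp hb (Ioo_subset_Icc_self hbS) hBc) hΩ.measurableSet
          fun x _ => (hB n _).1
      have hi1 : Integrable (fun p => e p + ψ n p)
          ((volume.restrict Ω).prod (volume.restrict (Ioc a b))) := by
        rw [← volume_restrict_prod]
        exact (hei.add (hψi n)).mono_set hsub
      have hJ : Integrable (fun t => ∫ x in Ω, β n (z x t) * timeDeriv z x t)
          (volume.restrict (Ioc a b)) :=
        (h.integrable_truncation_prod hΩ hb (hpos n) ha.1 hbS.2 (hT n).contDiff.continuous
          (hT n).eq_zero h.cont_time).integral_prod_right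
      have hJle : ∫ t in Ioc a b, ∫ x in Ω, β n (z x t) * timeDeriv z x t
          ≤ ∫ t in Ioc a b, ∫ x in Ω, (e (x, t) + ψ n (x, t)) := by
        refine integral_mono_ae hJ hi1.integral_prod_right ?_
        filter_upwards [hi1.prod_left_ae, ae_restrict_mem measurableSet_Ioc] with t hti ht
        have htS : t ∈ Ioo 0 S := ⟨ha.1.trans ht.1, ht.2.trans_lt hbS.2⟩
        rw [h.integral_truncation_mul_timeDeriv hΩ hb (hpos n) (hT n) htS]
        refine setIntegral_mono_on ?_ hti hΩ.measurableSet fun x hx => ?_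
        · refine Integrable.sub ?_ ?_
          · exact h.integrableOn_truncation hΩ hb (hpos n) htS (hT n).contDiff.continuous
              (hT n).eq_zero (h.continuousOn_rhs hΩ htS)
          · exact h.integrableOn_truncation hΩ hb (hpos n) htS (hT n).continuous_deriv
              (fun s hs => (hT n).deriv_eq_zero (hpos n) hs)
              ((h.flux t htS).continuousOn.inner (continuousOn_slice h.cont_grad htS))
        · have h1 : β n (z x t) * g x t ≤ e (x, t) :=
            mul_le_of_mul_le_abs_mul (hg x hx t htS) (hβ1 n _) (hβs n _)
              (fun h0 => (hT n).eq_zero _ (by rw [h0, abs_zero]; exact (hpos n).le))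
              (he0 _ ⟨hx, htS⟩)
          have h2 := mul_le_mul_of_nonneg_left (hA x hx t htS) (hβ' n (z x t))
          simp only [hψ]
          linarith
      have hfub : ∫ t in Ioc a b, ∫ x in Ω, (e (x, t) + ψ n (x, t))
          = ∫ p in Ω ×ˢ Ioc a b, (e p + ψ n p) := by
        rw [volume_restrict_prod]
        exact (integral_prod_symm (fun p => e p + ψ n p) hi1).symm
      have hext : ∫ p in Ω ×ˢ Ioc a b, (e p + ψ n p) ≤ ∫ p in cylinder Ω S, (e p + ψ n p) := by
        refine setIntegral_mono_set (hei.add (hψi n)) ?_ hsub.eventuallyLE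
        filter_upwards [ae_restrict_mem hQ] with p hp
        exact add_nonneg (he0 p hp) (hψ0 n p hp)
      rw [integral_add hei (hψi n)] at hext
      linarith
    have hlim2 : Tendsto (fun n : ℕ => (∫ x in Ω, |z x a|) + (∫ p in cylinder Ω S, e p)
        + ((∫ p in cylinder Ω S, ψ n p) + 2 * (1 / ((n : ℝ) + 1)) * volume.real Ω)) atTop
        (𝓝 ((∫ x in Ω, |z x a|) + (∫ p in cylinder Ω S, e p) + (0 + 2 * 0 * volume.real Ω))) :=
      tendsto_const_nhds.add (hψlim.add
        ((tendsto_one_div_add_atTop_nhds_zero_nat.const_mul 2).mul_const _))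
    have := ge_of_tendsto' hlim2 key
    simpa using this
  refine ge_of_tendsto ((h.tendsto_integral_abs hΩ hb (hbS.1.trans hbS.2)).add_const _) ?_
  filter_upwards [Ioo_mem_nhdsGT hbS.1] with a ha using hab a ha

/-- The `L¹` estimate with a reaction term, obtained from the estimate for `e^{-Lt} z`. -/
theorem IsConservationLaw.integral_abs_le_exp (h : IsConservationLaw Ω S z A g)
    (hΩ : IsOpen Ω) (hb : Bornology.IsBounded Ω) {H e : Space N × ℝ → ℝ}
    (hHc : ContinuousOn H (cylinder Ω S)) (hH0 : ∀ p ∈ cylinder Ω S, 0 ≤ H p)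
    (hHi : IntegrableOn H (cylinder Ω S))
    (he0 : ∀ p ∈ cylinder Ω S, 0 ≤ e p)
    (hei : IntegrableOn e (cylinder Ω S))
    (hA : ∀ x ∈ Ω, ∀ t ∈ Ioo 0 S, -(|z x t| * H (x, t)) ≤ inner ℝ (A x t) (spaceGrad z x t))
    {L : ℝ} (hL : 0 ≤ L)
    (hg : ∀ x ∈ Ω, ∀ t ∈ Ioo 0 S, |g x t| ≤ L * |z x t| + e (x, t))
    {b : ℝ} (hbS : b ∈ Ioo 0 S) :
    ∫ x in Ω, |z x b| ≤ Real.exp (L * b) * ((∫ x in Ω, |z x 0|) + ∫ p in cylinder Ω S, e p) := by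
  set E : ℝ → ℝ := fun t => Real.exp (-(L * t)) with hE
  have hE0 : ∀ t, 0 < E t := fun t => Real.exp_pos _
  have hE1 : ∀ t, 0 < t → E t ≤ 1 := fun t ht => by
    rw [hE]; simp only; rw [Real.exp_le_one_iff]; nlinarith
  have hEd : ∀ t, HasDerivAt E (-L * E t) t := fun t => by
    have h1 : HasDerivAt (fun t : ℝ => -(L * t)) (-L) t := by
      simpa using (hasDerivAt_id t).const_mul (-L)
    have := h1.exp
    rwa [mul_comm] at this
  have hEc : Continuous E := continuous_iff_continuousAt.2 fun t => (hEd t).continuousAt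
  have hder : ∀ x ∈ Ω, ∀ t ∈ Ioo 0 S, HasDerivAt (fun t => E t * z x t)
      (-L * E t * z x t + E t * timeDeriv z x t) t := fun x hx t ht =>
    (hEd t).mul (h.diff_time x hx t ht).hasDerivAt
  have hgrad : ∀ x ∈ Ω, ∀ t ∈ Ioo 0 S,
      spaceGrad (fun x t => E t * z x t) x t = E t • spaceGrad z x t := fun x hx t ht => by
    have h1 := ((h.diff_space t ht).differentiableOn (by simp)).differentiableAt
      (hΩ.mem_nhds hx)
    have h2 : fderiv ℝ (fun y => E t * z y t) x = E t • fderiv ℝ (fun y => z y t) x :=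
      fderiv_const_mul h1 (E t)
    rw [spaceGrad, spaceGrad, gradient, gradient, h2, map_smulₛₗ]
    simp
  have hlaw : IsConservationLaw Ω S (fun x t => E t * z x t) (fun x t => E t • A x t)
      (fun x t => E t * (g x t - L * z x t)) := by
    refine ⟨?_, ?_, ?_, ?_, ?_, ?_, ?_, ?_⟩
    · exact (hEc.comp continuous_snd).continuousOn.mul h.cont
    · intro x hx t ht
      simp [h.boundary x hx t ht]
    · exact fun x hx t ht => (hder x hx t ht).differentiableAt
    · have hzc : ContinuousOn (fun p : Space N × ℝ => z p.1 p.2) (cylinder Ω S) :=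
        h.cont.mono (prod_mono subset_closure Ioo_subset_Icc_self)
      have hEc' : ContinuousOn (fun p : Space N × ℝ => E p.2) (cylinder Ω S) :=
        (hEc.comp continuous_snd).continuousOn
      refine ContinuousOn.congr (f := fun p : Space N × ℝ =>
        -L * E p.2 * z p.1 p.2 + E p.2 * timeDeriv z p.1 p.2) ?_ fun p hp =>
          (hder p.1 hp.1 p.2 hp.2).deriv
      exact ((continuousOn_const.mul hEc').mul hzc).add (hEc'.mul h.cont_time)
    · exact fun t ht => contDiffOn_const.mul (h.diff_space t ht)
    · refine ContinuousOn.congr (f := fun p : Space N × ℝ => E p.2 • spaceGrad z p.1 p.2)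
        (ContinuousOn.smul (hEc.comp continuous_snd).continuousOn h.cont_grad)
        fun p hp => hgrad p.1 hp.1 p.2 hp.2
    · exact fun t ht => (h.flux t ht).const_smul (E t)
    · intro x hx t ht
      have h1 : timeDeriv (fun x t => E t * z x t) x t = _ := (hder x hx t ht).deriv
      have h2 : divergence (fun y => E t • A y t) x = E t * divergence (fun y => A y t) x := by
        have hd := ((h.flux t ht).differentiableOn (by simp)).differentiableAt (hΩ.mem_nhds hx)
        simp only [divergence]
        rw [fderiv_fun_const_smul hd, Finset.mul_sum]
        rfl
      rw [h1, h2, h.equation x hx t ht]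
      ring
  have hmain := hlaw.integral_abs_le hΩ hb hHc hH0 hHi he0 hei ?_ ?_ hbS
  · have hl : ∫ x in Ω, |E b * z x b| = E b * ∫ x in Ω, |z x b| := by
      simp_rw [abs_mul, abs_of_pos (hE0 b)]
      exact integral_const_mul _ _
    have hr : ∫ x in Ω, |E 0 * z x 0| = ∫ x in Ω, |z x 0| := by
      simp [hE]
    rw [hl, hr] at hmain
    have hEE : Real.exp (L * b) * E b = 1 := by
      rw [hE]; simp only; rw [← Real.exp_add]; simp
    calc ∫ x in Ω, |z x b| = Real.exp (L * b) * (E b * ∫ x in Ω, |z x b|) := by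
          rw [← mul_assoc, hEE, one_mul]
      _ ≤ _ := mul_le_mul_of_nonneg_left hmain (Real.exp_pos _).le
  · intro x hx t ht
    rw [hgrad x hx t ht, real_inner_smul_left, real_inner_smul_right, abs_mul,
      abs_of_pos (hE0 t)]
    have h1 := hA x hx t ht
    have h2 : 0 ≤ |z x t| * H (x, t) := mul_nonneg (abs_nonneg _) (hH0 _ ⟨hx, ht⟩)
    have h3 := mul_le_mul_of_nonneg_left h1 (mul_nonneg (hE0 t).le (hE0 t).le)
    have h4 : E t * E t * (|z x t| * H (x, t)) ≤ E t * (|z x t| * H (x, t)) :=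
      mul_le_mul_of_nonneg_right (mul_le_of_le_one_left (hE0 t).le (hE1 t ht.1)) h2
    linarith
  · intro x hx t ht
    rw [abs_mul, abs_of_pos (hE0 t)]
    have h1 : z x t * g x t ≤ |z x t| * |g x t| := by
      rw [← abs_mul]; exact le_abs_self _
    have h2 := mul_le_mul_of_nonneg_left (hg x hx t ht) (abs_nonneg (z x t))
    have h3 : |z x t| * |z x t| = z x t * z x t := abs_mul_abs_self _
    have h5 : z x t * (g x t - L * z x t) ≤ |z x t| * e (x, t) := by nlinarith
    have h6 : 0 ≤ |z x t| * e (x, t) := mul_nonneg (abs_nonneg _) (he0 _ ⟨hx, ht⟩)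
    have h7 := mul_le_mul_of_nonneg_left h5 (mul_nonneg (hE0 t).le (hE0 t).le)
    have h8 : E t * E t * (|z x t| * e (x, t)) ≤ E t * (|z x t| * e (x, t)) :=
      mul_le_mul_of_nonneg_right (mul_le_of_le_one_left (hE0 t).le (hE1 t ht.1)) h6
    linarith

end Contraction

/-! ### Energy estimates -/

section Energy

variable {N : ℕ} {Ω : Set (Space N)} {S : ℝ} {z : Space N → ℝ → ℝ}
  {A : Space N → ℝ → Space N} {g : Space N → ℝ → ℝ}

/-- The energy inequality at a fixed time, for a truncation `β` of the identity. The flux enters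
only through the lower bound `P - q` of `A · ∇z`. -/
theorem IsConservationLaw.integral_deriv_truncation_mul_le (h : IsConservationLaw Ω S z A g)
    (hΩ : IsOpen Ω) (hb : Bornology.IsBounded Ω) {η : ℝ} (hη : 0 < η) {β B : ℝ → ℝ}
    (hT : IsTruncation η β B) (hβ0 : ∀ s, 0 ≤ deriv β s) (hβ1 : ∀ s, deriv β s ≤ 1)
    (hβs : ∀ s, |β s| ≤ |s|) {P : Space N × ℝ → ℝ} (hPc : ContinuousOn P (cylinder Ω S))
    {q γ M : ℝ} (hq : 0 ≤ q) (hM : ∀ x ∈ Ω, ∀ t ∈ Ioo 0 S, |z x t| ≤ M)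
    (hA : ∀ x ∈ Ω, ∀ t ∈ Ioo 0 S, P (x, t) - q ≤ inner ℝ (A x t) (spaceGrad z x t))
    (hg : ∀ x ∈ Ω, ∀ t ∈ Ioo 0 S, |g x t| ≤ γ) {t : ℝ} (ht : t ∈ Ioo 0 S) :
    ∫ x in Ω, deriv β (z x t) * P (x, t)
      ≤ (q + γ * M) * volume.real Ω - ∫ x in Ω, β (z x t) * timeDeriv z x t := by
  have : IsFiniteMeasure (volume.restrict Ω) :=
    ⟨by simpa using volume_lt_top_of_bounded hb⟩
  have hd0 := fun s (hs : |s| ≤ η) => hT.deriv_eq_zero hη hs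
  have i1 : IntegrableOn (fun x => deriv β (z x t) * P (x, t)) Ω :=
    h.integrableOn_truncation hΩ hb hη ht hT.continuous_deriv hd0 (continuousOn_slice hPc ht)
  have i3 : IntegrableOn (fun x => β (z x t) * g x t) Ω :=
    h.integrableOn_truncation hΩ hb hη ht hT.contDiff.continuous hT.eq_zero
      (h.continuousOn_rhs hΩ ht)
  have i4 : IntegrableOn (fun x => deriv β (z x t) * inner ℝ (A x t) (spaceGrad z x t)) Ω :=
    h.integrableOn_truncation hΩ hb hη ht hT.continuous_deriv hd0
      ((h.flux t ht).continuousOn.inner (continuousOn_slice h.cont_grad ht))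
  have i5 : IntegrableOn (fun x => β (z x t) * g x t
      - deriv β (z x t) * inner ℝ (A x t) (spaceGrad z x t)) Ω := i3.sub i4
  have hc : ∫ _ in Ω, (q + γ * M) = (q + γ * M) * volume.real Ω := by
    rw [integral_const, measureReal_restrict_apply_univ, smul_eq_mul, mul_comm]
  rw [h.integral_truncation_mul_timeDeriv hΩ hb hη hT ht, ← hc,
    ← integral_sub (integrable_const _) i5]
  refine setIntegral_mono_on i1 ((integrable_const _).sub i5) hΩ.measurableSet
    fun x hx => ?_
  have h1 := mul_le_mul_of_nonneg_left (hA x hx t ht) (hβ0 (z x t))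
  have h2 : deriv β (z x t) * q ≤ q := mul_le_of_le_one_left hq (hβ1 _)
  have h3 : β (z x t) * g x t ≤ γ * M := by
    have h4 : |β (z x t) * g x t| ≤ γ * M := by
      rw [abs_mul, mul_comm]
      exact mul_le_mul (hg x hx t ht) ((hβs _).trans (hM x hx t ht)) (abs_nonneg _)
        ((abs_nonneg _).trans (hg x hx t ht))
    exact (le_abs_self _).trans h4
  linarith

theorem tendsto_truncation_level : Tendsto (fun n : ℕ => 2 * (1 / ((n : ℝ) + 1))) atTop (𝓝 0) := by
  simpa using (tendsto_one_div_add_atTop_nhds_zero_nat (𝕜 := ℝ)).const_mul 2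

/-- The energy bound at a fixed time. Removing the truncation loses nothing, since `∇z = 0`, and
hence `P = 0`, almost everywhere on `{z = 0}`. -/
theorem IsConservationLaw.lintegral_energy_slice_le (h : IsConservationLaw Ω S z A g)
    (hΩ : IsOpen Ω) (hb : Bornology.IsBounded Ω) {P : Space N × ℝ → ℝ}
    (hPc : ContinuousOn P (cylinder Ω S)) (hP0 : ∀ p ∈ cylinder Ω S, 0 ≤ P p)
    (hPz : ∀ x ∈ Ω, ∀ t ∈ Ioo 0 S, spaceGrad z x t = 0 → P (x, t) = 0)
    {q γ M : ℝ} (hq : 0 ≤ q) (hM : ∀ x ∈ Ω, ∀ t ∈ Ioo 0 S, |z x t| ≤ M)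
    (hA : ∀ x ∈ Ω, ∀ t ∈ Ioo 0 S, P (x, t) - q ≤ inner ℝ (A x t) (spaceGrad z x t))
    (hg : ∀ x ∈ Ω, ∀ t ∈ Ioo 0 S, |g x t| ≤ γ) {t : ℝ} (ht : t ∈ Ioo 0 S) :
    ∫⁻ x in Ω, ENNReal.ofReal (P (x, t)) ≤ ENNReal.ofReal ((q + γ * M) * volume.real Ω)
      + ENNReal.ofReal M * ∫⁻ x in Ω, ‖timeDeriv z x t‖ₑ := by
  have hpos : ∀ n : ℕ, (0 : ℝ) < 1 / ((n : ℝ) + 1) := fun n => by positivity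
  have hex := fun n : ℕ => exists_truncation_id _ (hpos n)
  choose β B hT hβ0 hβ1 hβ2 hβs hBs using hex
  have hPt := continuousOn_slice hPc ht
  have hzt := (h.diff_space t ht).continuousOn
  have hmeas : ∀ n, AEMeasurable (fun x => ENNReal.ofReal (deriv (β n) (z x t) * P (x, t)))
      (volume.restrict Ω) := fun n =>
    ((((hT n).continuous_deriv.comp_continuousOn hzt).mul hPt).aemeasurable
      hΩ.measurableSet).ennreal_ofReal
  have hbound : ∀ n, ∫⁻ x in Ω, ENNReal.ofReal (deriv (β n) (z x t) * P (x, t))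
      ≤ ENNReal.ofReal ((q + γ * M) * volume.real Ω)
        + ENNReal.ofReal M * ∫⁻ x in Ω, ‖timeDeriv z x t‖ₑ := fun n => by
    have i1 : IntegrableOn (fun x => deriv (β n) (z x t) * P (x, t)) Ω :=
      h.integrableOn_truncation hΩ hb (hpos n) ht (hT n).continuous_deriv
        (fun s hs => (hT n).deriv_eq_zero (hpos n) hs) hPt
    rw [← ofReal_integral_eq_lintegral_ofReal i1]
    · refine (ENNReal.ofReal_le_ofReal (h.integral_deriv_truncation_mul_le hΩ hb (hpos n) (hT n)
        (hβ0 n) (hβ1 n) (hβs n) hPc hq hM hA hg ht)).trans ?_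
      rw [sub_eq_add_neg]
      refine ENNReal.ofReal_add_le.trans (add_le_add le_rfl ?_)
      calc ENNReal.ofReal (-∫ x in Ω, β n (z x t) * timeDeriv z x t)
          ≤ ‖∫ x in Ω, β n (z x t) * timeDeriv z x t‖ₑ := by
            rw [← ofReal_norm]
            exact ENNReal.ofReal_le_ofReal (neg_le_abs _)
        _ ≤ ∫⁻ x in Ω, ‖β n (z x t) * timeDeriv z x t‖ₑ := enorm_integral_le_lintegral_enorm _
        _ ≤ ∫⁻ x in Ω, ENNReal.ofReal M * ‖timeDeriv z x t‖ₑ := by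
            refine lintegral_mono_ae ?_
            filter_upwards [ae_restrict_mem hΩ.measurableSet] with x hx
            rw [enorm_mul]
            gcongr
            rw [← ofReal_norm]
            exact ENNReal.ofReal_le_ofReal ((hβs n _).trans (hM x hx t ht))
        _ = _ := lintegral_const_mul' _ _ ENNReal.ofReal_ne_top
    · filter_upwards [ae_restrict_mem hΩ.measurableSet] with x hx
      exact mul_nonneg (hβ0 n _) (hP0 _ ⟨hx, ht⟩)
  calc ∫⁻ x in Ω, ENNReal.ofReal (P (x, t))
      ≤ ∫⁻ x in Ω, liminf (fun n => ENNReal.ofReal (deriv (β n) (z x t) * P (x, t))) atTop := by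
        refine lintegral_mono_ae ?_
        filter_upwards [ae_restrict_mem hΩ.measurableSet, ae_gradient_eq_zero_of_eq_zero hΩ
          ((h.diff_space t ht).differentiableOn (by simp))] with x hx hgr
        by_cases hz : z x t = 0
        · rw [hPz x hx t ht (hgr hz)]
          simp
        · refine le_of_eq (Tendsto.liminf_eq ?_).symm
          refine tendsto_const_nhds.congr' ?_
          filter_upwards [(tendsto_order.1 tendsto_truncation_level).2 _ (abs_pos.2 hz)] with n hn
          rw [hβ2 n _ hn.le, one_mul]
    _ ≤ liminf (fun n => ∫⁻ x in Ω, ENNReal.ofReal (deriv (β n) (z x t) * P (x, t))) atTop :=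
        lintegral_liminf_le' hmeas
    _ ≤ _ := by
        refine liminf_le_of_frequently_le' (Frequently.of_forall hbound)

theorem IsConservationLaw.ae_gradient_eq_zero (h : IsConservationLaw Ω S z A g)
    (hΩ : IsOpen Ω) :
    ∀ᵐ p ∂(volume.restrict (cylinder Ω S)), z p.1 p.2 = 0 → spaceGrad z p.1 p.2 = 0 := by
  have hQo := isOpen_cylinder (S := S) hΩ
  have hzc : ContinuousOn (fun p : Space N × ℝ => z p.1 p.2) (cylinder Ω S) :=
    h.cont.mono (prod_mono subset_closure Ioo_subset_Icc_self)
  set U : Set (Space N × ℝ) := cylinder Ω S ∩ (fun p => spaceGrad z p.1 p.2) ⁻¹' {0}ᶜ with hU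
  have hUm : MeasurableSet U :=
    (h.cont_grad.isOpen_inter_preimage hQo isOpen_compl_singleton).measurableSet
  have hVm : MeasurableSet (cylinder Ω S ∩ (fun p : Space N × ℝ => z p.1 p.2) ⁻¹' {0}ᶜ) :=
    (hzc.isOpen_inter_preimage hQo isOpen_compl_singleton).measurableSet
  have hnull : (volume : Measure (Space N × ℝ))
      (U \ (cylinder Ω S ∩ (fun p : Space N × ℝ => z p.1 p.2) ⁻¹' {0}ᶜ)) = 0 := by
    rw [Measure.volume_eq_prod, Measure.prod_apply_symm (hUm.diff hVm)]
    refine (lintegral_congr fun t => ?_).trans lintegral_zero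
    by_cases ht : t ∈ Ioo 0 S
    · have hae := ae_gradient_eq_zero_of_eq_zero hΩ
        ((h.diff_space t ht).differentiableOn (by simp))
      rw [ae_restrict_iff' hΩ.measurableSet] at hae
      refine measure_mono_null (fun x hx => ?_) hae
      obtain ⟨⟨hx1, hx2⟩, hx3⟩ := hx
      intro hcon
      refine hx2 (hcon hx1.1 ?_)
      by_contra hne
      exact hx3 ⟨hx1, hne⟩
    · refine measure_mono_null (fun x hx => ?_) (measure_empty (μ := volume))
      exact absurd hx.1.1.2 ht
  rw [ae_restrict_iff' hQo.measurableSet]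
  refine measure_mono_null (fun p hp => ?_) hnull
  simp only [mem_compl_iff, mem_ofPred_eq, Classical.not_imp] at hp
  exact ⟨⟨hp.1, hp.2.2⟩, fun hc => hc.2 hp.2.1⟩

/-- The energy bound on the whole cylinder. The term with `∂ₜz` is integrated in time exactly, so
that no information on `∂ₜz` is needed. -/
theorem IsConservationLaw.lintegral_energy_le (h : IsConservationLaw Ω S z A g)
    (hΩ : IsOpen Ω) (hb : Bornology.IsBounded Ω) (hS : 0 < S) {P : Space N × ℝ → ℝ}
    (hPc : ContinuousOn P (cylinder Ω S)) (hP0 : ∀ p ∈ cylinder Ω S, 0 ≤ P p)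
    (hPz : ∀ x ∈ Ω, ∀ t ∈ Ioo 0 S, spaceGrad z x t = 0 → P (x, t) = 0)
    {q γ M : ℝ} (hq : 0 ≤ q) (hγ : 0 ≤ γ) (hM0 : 0 ≤ M)
    (hM : ∀ x ∈ Ω, ∀ t ∈ Ioo 0 S, |z x t| ≤ M)
    (hA : ∀ x ∈ Ω, ∀ t ∈ Ioo 0 S, P (x, t) - q ≤ inner ℝ (A x t) (spaceGrad z x t))
    (hg : ∀ x ∈ Ω, ∀ t ∈ Ioo 0 S, |g x t| ≤ γ) :
    ∫⁻ p in cylinder Ω S, ENNReal.ofReal (P p)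
      ≤ ENNReal.ofReal (((q + γ * M) * S + 2 * M ^ 2) * volume.real Ω) := by
  have : IsFiniteMeasure (volume.restrict Ω) :=
    ⟨by simpa using volume_lt_top_of_bounded hb⟩
  have hQ : MeasurableSet (cylinder Ω S) := (isOpen_cylinder hΩ).measurableSet
  have hpos : ∀ n : ℕ, (0 : ℝ) < 1 / ((n : ℝ) + 1) := fun n => by positivity
  have hex := fun n : ℕ => exists_truncation_id _ (hpos n)
  choose β B hT hβ0 hβ1 hβ2 hβs hBs using hex
  have hzc : ContinuousOn (fun p : Space N × ℝ => z p.1 p.2) (cylinder Ω S) :=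
    h.cont.mono (prod_mono subset_closure Ioo_subset_Icc_self)
  -- time intervals that exhaust `(0, S)`
  set a : ℕ → ℝ := fun n => S / 3 * (1 / ((n : ℝ) + 1)) with ha
  set b : ℕ → ℝ := fun n => S - a n with hbdef
  have hle1 : ∀ n : ℕ, 1 / ((n : ℝ) + 1) ≤ 1 := fun n => by
    rw [div_le_one (by positivity)]; linarith [(Nat.cast_nonneg n : (0 : ℝ) ≤ n)]
  have ha0 : ∀ n, 0 < a n := fun n => mul_pos (by linarith) (hpos n)
  have haS : ∀ n, a n ≤ S / 3 := fun n => mul_le_of_le_one_right (by linarith) (hle1 n)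
  have hab : ∀ n, a n ≤ b n := fun n => by
    have := haS n; simp only [hbdef]; linarith
  have hbS : ∀ n, b n < S := fun n => by
    have := ha0 n; simp only [hbdef]; linarith
  have halim : Tendsto a atTop (𝓝 0) := by
    have := (tendsto_one_div_add_atTop_nhds_zero_nat (𝕜 := ℝ)).const_mul (S / 3)
    rwa [mul_zero] at this
  have hblim : Tendsto b atTop (𝓝 S) := by
    simpa using tendsto_const_nhds.sub halim
  have hsub : ∀ n, Ω ×ˢ Ioc (a n) (b n) ⊆ cylinder Ω S := fun n =>
    prod_mono_right fun t ht => ⟨(ha0 n).trans ht.1, ht.2.trans_lt (hbS n)⟩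
  set c : ℝ := ((q + γ * M) * S + 2 * M ^ 2) * volume.real Ω with hc
  have hvol : (0 : ℝ) ≤ volume.real Ω := measureReal_nonneg
  have hMb : ∀ n, ∀ t ∈ Ioo 0 S, |∫ x in Ω, B n (z x t)| ≤ M ^ 2 * volume.real Ω := by
    intro n t ht
    have := norm_setIntegral_le_of_norm_le_const (μ := volume) (s := Ω)
      (f := fun x => B n (z x t)) (C := M ^ 2) (volume_lt_top_of_bounded hb) fun x hx => by
        refine (hBs n _).trans ?_
        rw [← sq_abs]
        exact pow_le_pow_left₀ (abs_nonneg _) (hM x hx t ht) 2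
    simpa using this
  set Fn : ℕ → Space N × ℝ → ℝ := fun n p => deriv (β n) (z p.1 p.2) * P p with hFn
  have hFi : ∀ n, Integrable (Fn n)
      ((volume.restrict Ω).prod (volume.restrict (Ioc (a n) (b n)))) := fun n =>
    h.integrable_truncation_prod hΩ hb (hpos n) (ha0 n) (hbS n) (hT n).continuous_deriv
      (fun s hs => (hT n).deriv_eq_zero (hpos n) hs) hPc
  have hF0 : ∀ n, ∀ p ∈ cylinder Ω S, 0 ≤ Fn n p := fun n p hp =>
    mul_nonneg (hβ0 n _) (hP0 p hp)
  have hbound : ∀ n, ∫ p in Ω ×ˢ Ioc (a n) (b n), Fn n p ≤ c := by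
    intro n
    have hJ : Integrable (fun t => ∫ x in Ω, β n (z x t) * timeDeriv z x t)
        (volume.restrict (Ioc (a n) (b n))) :=
      (h.integrable_truncation_prod hΩ hb (hpos n) (ha0 n) (hbS n) (hT n).contDiff.continuous
        (hT n).eq_zero h.cont_time).integral_prod_right
    rw [volume_restrict_prod, integral_prod_symm _ (hFi n)]
    have h1 : ∫ t in Ioc (a n) (b n), ∫ x in Ω, Fn n (x, t)
        ≤ ∫ t in Ioc (a n) (b n), ((q + γ * M) * volume.real Ω
          - ∫ x in Ω, β n (z x t) * timeDeriv z x t) := by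
      refine setIntegral_mono_on (hFi n).integral_prod_right
        ((integrable_const _).sub hJ) measurableSet_Ioc fun t ht => ?_
      exact h.integral_deriv_truncation_mul_le hΩ hb (hpos n) (hT n)
        (hβ0 n) (hβ1 n) (hβs n) hPc hq hM hA hg ⟨(ha0 n).trans ht.1, ht.2.trans_lt (hbS n)⟩
    rw [integral_sub (integrable_const _) hJ,
      ← h.integral_primitive_sub hΩ hb (hpos n) (hT n) (ha0 n) (hab n) (hbS n),
      integral_const, measureReal_restrict_apply_univ, Real.volume_real_Ioc_of_le (hab n),
      smul_eq_mul] at h1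
    have h2 := hMb n (b n) ⟨(ha0 n).trans_le (hab n), hbS n⟩
    have h3 := hMb n (a n) ⟨ha0 n, (hab n).trans_lt (hbS n)⟩
    rw [abs_le] at h2 h3
    have h4 : (b n - a n) * ((q + γ * M) * volume.real Ω)
        ≤ S * ((q + γ * M) * volume.real Ω) := by
      refine mul_le_mul_of_nonneg_right ?_ (by positivity)
      linarith [ha0 n, hbS n]
    rw [hc]
    linarith [h2.1, h3.2]
  have hmeas : ∀ n, AEMeasurable
      ((Ω ×ˢ Ioc (a n) (b n)).indicator fun p => ENNReal.ofReal (Fn n p))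
      (volume.restrict (cylinder Ω S)) := fun n =>
    (((((hT n).continuous_deriv.comp_continuousOn hzc).mul hPc).aemeasurable
      hQ).ennreal_ofReal).indicator (hΩ.measurableSet.prod measurableSet_Ioc)
  calc ∫⁻ p in cylinder Ω S, ENNReal.ofReal (P p)
      ≤ ∫⁻ p in cylinder Ω S, liminf (fun n =>
          (Ω ×ˢ Ioc (a n) (b n)).indicator (fun p => ENNReal.ofReal (Fn n p)) p) atTop := by
        refine lintegral_mono_ae ?_
        filter_upwards [ae_restrict_mem hQ, h.ae_gradient_eq_zero hΩ] with p hp hgr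
        by_cases hz : z p.1 p.2 = 0
        · have : P p = 0 := hPz p.1 hp.1 p.2 hp.2 (hgr hz)
          simp [this]
        · refine le_of_eq (Tendsto.liminf_eq ?_).symm
          refine tendsto_const_nhds.congr' ?_
          filter_upwards [(tendsto_order.1 tendsto_truncation_level).2 _ (abs_pos.2 hz),
            (tendsto_order.1 halim).2 _ hp.2.1, (tendsto_order.1 hblim).1 _ hp.2.2]
            with n hn hna hnb
          rw [indicator_of_mem (show p ∈ Ω ×ˢ Ioc (a n) (b n) from ⟨hp.1, hna, hnb.le⟩), hFn]
          simp only
          rw [hβ2 n _ hn.le, one_mul]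
    _ ≤ liminf (fun n => ∫⁻ p in cylinder Ω S,
          (Ω ×ˢ Ioc (a n) (b n)).indicator (fun p => ENNReal.ofReal (Fn n p)) p) atTop :=
        lintegral_liminf_le' hmeas
    _ ≤ ENNReal.ofReal c := by
        refine liminf_le_of_frequently_le' (Frequently.of_forall fun n => ?_)
        rw [lintegral_indicator (hΩ.measurableSet.prod measurableSet_Ioc),
          Measure.restrict_restrict (hΩ.measurableSet.prod measurableSet_Ioc),
          inter_eq_left.2 (hsub n), ← ofReal_integral_eq_lintegral_ofReal]
        · exact ENNReal.ofReal_le_ofReal (hbound n)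
        · rw [volume_restrict_prod]; exact hFi n
        · filter_upwards [ae_restrict_mem (hΩ.measurableSet.prod measurableSet_Ioc)] with p hp
          exact hF0 n p (hsub n hp)

end Energy

/-! ### Regularity of the flux -/

section FluxRegularity

variable {N : ℕ} {Ω : Set (Space N)} {T δ ε c₁ c₂ : ℝ} {k : ℝ → ℝ} {Gε : Space N → ℝ → ℝ}
  {Φ : Space N → ℝ → ℝ → Space N} {f : Space N → ℝ → ℝ → ℝ} {v₀ : Space N → ℝ}
  {w : Space N → ℝ → ℝ}

theorem gradient_apply_coord (v : Space N → ℝ) (x : Space N) (i : Fin N) :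
    gradient v x i = fderiv ℝ v x (EuclideanSpace.single i 1) := by
  rw [← inner_gradient_eq_fderiv, EuclideanSpace.inner_single_left]
  simp

theorem contDiffOn_gradient (hΩ : IsOpen Ω) {v : Space N → ℝ} (hv : ContDiffOn ℝ 2 v Ω) :
    ContDiffOn ℝ 1 (gradient v) Ω := by
  rw [contDiffOn_euclidean]
  intro i
  simp only [gradient_apply_coord]
  exact (hv.fderiv_of_isOpen hΩ (by norm_num)).clm_apply contDiffOn_const

theorem IsPenalty.one_le (hk : IsPenalty ε k) (s : ℝ) : 1 ≤ k s := by
  rw [← hk.eq_one (min s 0) (min_le_right _ _)]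
  exact hk.mono (min_le_left _ _)

theorem IsPenalty.eq_one_of_nonpos (hk : IsPenalty ε k) {p g : ℝ} (hp : 0 ≤ p) (hpg : p ≤ g) :
    k (p ^ 2 - g ^ 2) = 1 :=
  hk.eq_one _ (by nlinarith)

/-- The flux `δ k(|∇v|² - G²(v)) ∇v + Φ(v)` is of class `C¹` when `v` is of class `C²`. -/
theorem contDiffOn_flux (hΩ : IsOpen Ω) (h : IsAdmissibleFluxSource Ω T Φ f c₁ c₂)
    (hk : IsPenalty ε k) (hG : ContDiff ℝ ∞ (fun z : Space N × ℝ => Gε z.1 z.2))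
    {v : Space N → ℝ} (hv : ContDiffOn ℝ 2 v Ω) {t : ℝ} (ht : t ∈ Ioo 0 T) (δ : ℝ) :
    ContDiffOn ℝ 1 (fun y => (δ * k (‖gradient v y‖ ^ 2 - (Gε y (v y)) ^ 2)) • gradient v y
      + Φ y t (v y)) Ω := by
  have hgr := contDiffOn_gradient hΩ hv
  have hv1 : ContDiffOn ℝ 1 v Ω := hv.of_le (by norm_num)
  have hGv : ContDiffOn ℝ 1 (fun y => Gε y (v y)) Ω :=
    (hG.of_le (by simp)).comp_contDiffOn (f := fun y => (y, v y)) (contDiffOn_id.prodMk hv1)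
  have hpen : ContDiffOn ℝ 1 (fun y => δ * k (‖gradient v y‖ ^ 2 - (Gε y (v y)) ^ 2)) Ω :=
    contDiffOn_const.mul
      ((hk.smooth.of_le (by simp)).comp_contDiffOn ((hgr.norm_sq ℝ).sub (hGv.pow 2)))
  refine ContDiffOn.add (hpen.smul hgr) fun x hx => ?_
  have h1 : ContDiffAt ℝ 1 (fun y => (y, t, v y)) x :=
    contDiffAt_id.prodMk (contDiffAt_const.prodMk (hv1.contDiffAt (hΩ.mem_nhds hx)))
  exact (ContDiffAt.comp (g := fun z : Space N × ℝ × ℝ => Φ z.1 z.2.1 z.2.2) x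
    (h.contDiffAt_flux hΩ hx ht (v x)) h1).contDiffWithinAt

/-- The total flux `δ k(|∇w|² - G²(w)) ∇w + Φ(w)` of a solution. -/
noncomputable def totalFlux (δ : ℝ) (k : ℝ → ℝ) (Gε : Space N → ℝ → ℝ)
    (Φ : Space N → ℝ → ℝ → Space N) (w : Space N → ℝ → ℝ) (x : Space N) (t : ℝ) : Space N :=
  (δ * penalty k Gε w x t) • spaceGrad w x t + Φ x t (w x t)

theorem IsClassicalSolution.isConservationLaw (hw : IsClassicalSolution Ω T δ k Gε Φ f v₀ w)
    (hΩ : IsOpen Ω) (h : IsAdmissibleFluxSource Ω T Φ f c₁ c₂)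
    (hk : IsPenalty ε k) (hG : ContDiff ℝ ∞ (fun z : Space N × ℝ => Gε z.1 z.2)) :
    IsConservationLaw Ω T w (totalFlux δ k Gε Φ w) (fun x t => f x t (w x t)) where
  cont := hw.cont
  boundary := hw.boundary
  diff_time := hw.diff_time
  cont_time := hw.cont_time
  diff_space := fun t ht => (hw.diff_space t ht).of_le (by norm_num)
  cont_grad := hw.cont_grad
  flux := fun t ht => contDiffOn_flux hΩ h hk hG (hw.diff_space t ht) ht δ
  equation := fun x hx t ht => by
    have := hw.equation x hx t ht
    simp only [totalFlux]
    linarith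

end FluxRegularity

/-! ### The maximum principle -/

section MaximumPrinciple

variable {N : ℕ} {Ω : Set (Space N)} {T δ ε c₁ c₂ : ℝ} {k : ℝ → ℝ} {Gε : Space N → ℝ → ℝ}
  {Φ : Space N → ℝ → ℝ → Space N} {f : Space N → ℝ → ℝ → ℝ} {v₀ : Space N → ℝ}
  {w : Space N → ℝ → ℝ}

theorem deriv_deriv_nonpos_of_isLocalMax {φ : ℝ → ℝ} {s : ℝ} (h : IsLocalMax φ s)
    (hc : ContinuousAt φ s) : deriv (deriv φ) s ≤ 0 := by
  by_contra hpos
  push Not at hpos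
  have hmin := isLocalMin_of_deriv_deriv_pos hpos h.deriv_eq_zero hc
  have hconst : φ =ᶠ[𝓝 s] fun _ => φ s := by
    filter_upwards [h, hmin] with r h1 h2 using le_antisymm h1 h2
  have h1 : deriv φ =ᶠ[𝓝 s] fun _ => 0 := by
    filter_upwards [hconst.eventuallyEq_nhds] with r hr
    rw [hr.deriv_eq, deriv_const]
  rw [h1.deriv_eq, deriv_const] at hpos
  exact lt_irrefl _ hpos

theorem gradient_eq_zero_of_isLocalMax {v : Space N → ℝ} {x : Space N} (h : IsLocalMax v x) :
    gradient v x = 0 := by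
  rw [gradient, h.fderiv_eq_zero, map_zero]

theorem divergence_gradient_nonpos_of_isLocalMax (hΩ : IsOpen Ω) {v : Space N → ℝ}
    (hv : ContDiffOn ℝ 2 v Ω) {x : Space N} (hx : x ∈ Ω) (h : IsLocalMax v x) :
    divergence (gradient v) x ≤ 0 := by
  have hgr := (contDiffOn_gradient hΩ hv).differentiableOn (by simp)
  rw [divergence_eq_sum (hgr.differentiableAt (hΩ.mem_nhds hx))]
  refine Finset.sum_nonpos fun i _ => ?_
  set e : Space N := EuclideanSpace.single i 1 with he
  have hline : ∀ s : ℝ, HasDerivAt (fun s : ℝ => x + s • e) e s := fun s => by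
    simpa using ((hasDerivAt_id s).smul_const e).const_add x
  have hcont : Continuous fun s : ℝ => x + s • e := by fun_prop
  have h0 : x + (0 : ℝ) • e = x := by simp
  have hev : ∀ᶠ s in 𝓝 (0 : ℝ), x + s • e ∈ Ω :=
    hcont.continuousAt.preimage_mem_nhds (by rw [h0]; exact hΩ.mem_nhds hx)
  have hd1 : deriv (fun s : ℝ => v (x + s • e)) =ᶠ[𝓝 0] fun s => gradient v (x + s • e) i := by
    filter_upwards [hev] with s hs
    have h1 := ((hv.differentiableOn (by norm_num)).differentiableAt (hΩ.mem_nhds hs)).hasFDerivAt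
    rw [gradient_apply_coord]
    exact (h1.comp_hasDerivAt s (hline s)).deriv
  have hd2 : deriv (fun s : ℝ => gradient v (x + s • e) i) 0
      = fderiv ℝ (fun y => gradient v y i) x e := by
    have h2 : DifferentiableAt ℝ (fun y => gradient v y i) (x + (0 : ℝ) • e) := by
      rw [h0]
      exact (EuclideanSpace.proj (𝕜 := ℝ) i).differentiableAt.comp x
        (hgr.differentiableAt (hΩ.mem_nhds hx))
    have h3 := (h2.hasFDerivAt.comp_hasDerivAt (0 : ℝ) (hline 0)).deriv
    rw [h0] at h3
    exact h3
  have hmax : IsLocalMax (fun s : ℝ => v (x + s • e)) 0 := by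
    have h1 : Tendsto (fun s : ℝ => x + s • e) (𝓝 0) (𝓝 x) := by
      have := hcont.tendsto 0
      rwa [h0] at this
    have h2 := h1.eventually h
    simp only [IsLocalMax, IsMaxFilter, h0]
    exact h2
  have hcv : ContinuousAt (fun s : ℝ => v (x + s • e)) 0 := by
    have h1 : ContinuousAt v (x + (0 : ℝ) • e) := by
      rw [h0]; exact hv.continuousOn.continuousAt (hΩ.mem_nhds hx)
    exact ContinuousAt.comp (f := fun s : ℝ => x + s • e) h1 hcont.continuousAt
  have := deriv_deriv_nonpos_of_isLocalMax hmax hcv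
  rwa [hd1.deriv_eq, hd2] at this

/-- At a critical point the equation reduces to `∂ₜw = δ k Δw + (∇·Φ)(w) + f(w)`. -/
theorem IsClassicalSolution.timeDeriv_of_gradient_eq_zero
    (hw : IsClassicalSolution Ω T δ k Gε Φ f v₀ w) (hΩ : IsOpen Ω)
    (h : IsAdmissibleFluxSource Ω T Φ f c₁ c₂) (hk : IsPenalty ε k)
    (hG : ContDiff ℝ ∞ (fun z : Space N × ℝ => Gε z.1 z.2)) {x : Space N} (hx : x ∈ Ω) {t : ℝ}
    (ht : t ∈ Ioo 0 T) (h0 : gradient (fun y => w y t) x = 0) :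
    timeDeriv w x t = δ * penalty k Gε w x t * divergence (gradient fun y => w y t) x
      + (divergence (fun y => Φ y t (w x t)) x + f x t (w x t)) := by
  have hw2 := hw.diff_space t ht
  have hwd := (hw2.differentiableOn (by norm_num)).differentiableAt (hΩ.mem_nhds hx)
  have hgr := ((contDiffOn_gradient hΩ hw2).differentiableOn (by simp)).differentiableAt
    (hΩ.mem_nhds hx)
  have hf0 : fderiv ℝ (fun y => w y t) x = 0 := by
    ext p
    rw [← inner_gradient_eq_fderiv, h0]
    simp
  have hΦ : divergence (fun y => Φ y t (w y t)) x = divergence (fun y => Φ y t (w x t)) x := by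
    rw [h.divergence_comp hΩ hx ht hwd, h.divergence_comp hΩ hx ht (differentiableAt_const _), hf0]
    simp
  have hΦd := h.differentiableAt_comp hΩ hx ht hwd
  have hpen : DifferentiableAt ℝ (fun y => δ * penalty k Gε w y t) x := by
    have hGd : DifferentiableAt ℝ (fun y => Gε y (w y t)) x :=
      DifferentiableAt.comp (g := fun z : Space N × ℝ => Gε z.1 z.2) x
        (f := fun y => (y, w y t)) (hG.differentiable (by simp) _)
        (differentiableAt_id.prodMk hwd)
    refine DifferentiableAt.const_mul ?_ δ
    exact DifferentiableAt.comp x (hk.smooth.differentiable (by simp) _)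
      ((hgr.norm_sq ℝ).sub (hGd.pow 2))
  have hdiv : divergence (fun y => (δ * penalty k Gε w y t) • spaceGrad w y t + Φ y t (w y t)) x
      = δ * penalty k Gε w x t * divergence (gradient fun y => w y t) x
        + divergence (fun y => Φ y t (w y t)) x := by
    have h1 : HasFDerivAt (fun y => (δ * penalty k Gε w y t) • spaceGrad w y t + Φ y t (w y t))
        _ x := (hpen.hasFDerivAt.smul hgr.hasFDerivAt).add hΦd.hasFDerivAt
    simp only [divergence]
    rw [h1.fderiv, Finset.mul_sum, ← Finset.sum_add_distrib]
    refine Finset.sum_congr rfl fun i _ => ?_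
    have h00 : gradient (fun y => w y t) x = 0 := h0
    simp [h00]
  have := hw.equation x hx t ht
  rw [hdiv, hΦ] at this
  linarith

/-- The derivative is nonnegative where a function dominates its earlier values. -/
theorem nonneg_of_hasDerivAt_of_le {φ : ℝ → ℝ} {φ' t : ℝ} (ht : 0 < t) (hφ : HasDerivAt φ φ' t)
    (hmax : ∀ s ∈ Ioo 0 t, φ s ≤ φ t) : 0 ≤ φ' := by
  by_contra hneg
  push Not at hneg
  have h1 := (tendsto_order.1 (hasDerivAt_iff_tendsto_slope.1 hφ)).2 0 hneg
  have h2 : ∀ᶠ s in 𝓝[<] t, slope φ t s < 0 :=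
    (nhdsWithin_mono t fun s (hs : s < t) => hs.ne) h1
  obtain ⟨s, hs1, hs2⟩ := (h2.and (Ioo_mem_nhdsLT ht)).exists
  rw [slope_def_field, div_neg_iff] at hs1
  rcases hs1 with ⟨h3, -⟩ | ⟨-, h3⟩
  · linarith [hmax s hs2]
  · linarith [hs2.2]

/-- At an interior spatial maximum of `σ w`, `σ = ±1`, the growth condition controls `σ ∂ₜw`. -/
theorem IsClassicalSolution.timeDeriv_le_of_isLocalMax
    (hw : IsClassicalSolution Ω T δ k Gε Φ f v₀ w) (hΩ : IsOpen Ω) (hδ : 0 < δ)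
    (h : IsAdmissibleFluxSource Ω T Φ f c₁ c₂) (hk : IsPenalty ε k)
    (hG : ContDiff ℝ ∞ (fun z : Space N × ℝ => Gε z.1 z.2)) {σ : ℝ} (hσ : σ = 1 ∨ σ = -1)
    {x : Space N} (hx : x ∈ Ω) {t : ℝ} (ht : t ∈ Ioo 0 T)
    (hmax : IsLocalMax (fun y => σ * w y t) x) :
    σ * timeDeriv w x t ≤ c₁ * |w x t| + c₂ := by
  have hw2 := hw.diff_space t ht
  have hpos : 0 ≤ δ * penalty k Gε w x t :=
    mul_nonneg hδ.le (zero_le_one.trans (hk.one_le _))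
  have hgrow := h.growth_everywhere hΩ hx ht (w x t)
  rw [abs_le] at hgrow
  rcases hσ with rfl | rfl
  · simp only [one_mul] at hmax ⊢
    rw [hw.timeDeriv_of_gradient_eq_zero hΩ h hk hG hx ht (gradient_eq_zero_of_isLocalMax hmax)]
    have h1 := divergence_gradient_nonpos_of_isLocalMax hΩ hw2 hx hmax
    nlinarith [mul_nonneg hpos (neg_nonneg.2 h1)]
  · simp only [neg_mul, one_mul] at hmax ⊢
    have hneg : (fun y => gradient (fun y => -w y t) y) = fun y => -gradient (fun y => w y t) y := by
      funext y
      rw [gradient, gradient, fderiv_fun_neg, map_neg]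
    have h0 : gradient (fun y => w y t) x = 0 := by
      have h1 := gradient_eq_zero_of_isLocalMax hmax
      have h2 := congrFun hneg x
      simp only [h1] at h2
      exact neg_eq_zero.1 h2.symm
    rw [hw.timeDeriv_of_gradient_eq_zero hΩ h hk hG hx ht h0]
    have h1 := divergence_gradient_nonpos_of_isLocalMax hΩ hw2.neg hx hmax
    have h2 : divergence (gradient fun y => -w y t) x
        = -divergence (gradient fun y => w y t) x := by
      change divergence (fun y => gradient (fun y => -w y t) y) x = _
      rw [hneg]
      simp only [divergence]
      rw [fderiv_fun_neg]
      simp [Finset.sum_neg_distrib]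
    rw [h2] at h1
    nlinarith [mul_nonneg hpos (neg_nonneg.2 h1)]

/-- The maximum principle yields the bound `c₂ / (l - c₁)`, which is at least as good as the square
root in `boundM`: the squares of both sides compare by `2 (r - 1/2) ≤ r²` with `r = l - c₁`. -/
theorem div_le_sqrt_growth {l c₁ c₂ : ℝ} (hl : c₁ + 1 / 2 < l) :
    c₂ / (l - c₁) ≤ Real.sqrt ((c₂ ^ 2 / 2) / (l - (c₁ + 1 / 2))) := by
  apply Real.le_sqrt_of_sq_le
  have h1 : 0 < l - (c₁ + 1 / 2) := by linarith
  have h2 : 0 < l - c₁ := by linarith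
  rw [div_pow, div_div, div_le_div_iff₀ (by positivity) (by positivity)]
  nlinarith [mul_nonneg (sq_nonneg c₂) (sq_nonneg (l - c₁ - 1))]

/-- The maximum principle, for one exponent `l` and for `σ w` with `σ = ±1`. -/
theorem IsClassicalSolution.mul_le_exp_mul_max
    (hw : IsClassicalSolution Ω T δ k Gε Φ f v₀ w) (hΩ : IsOpen Ω) (hb : Bornology.IsBounded Ω)
    (hδ : 0 < δ) (h : IsAdmissibleFluxSource Ω T Φ f c₁ c₂) (hk : IsPenalty ε k)
    (hG : ContDiff ℝ ∞ (fun z : Space N × ℝ => Gε z.1 z.2)) {m : ℝ} (hm0 : 0 ≤ m)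
    (hm : ∀ x ∈ Ω, |v₀ x| ≤ m) {σ : ℝ} (hσ : σ = 1 ∨ σ = -1) {l : ℝ} (hl : c₁ + 1 / 2 < l)
    {x : Space N} (hx : x ∈ Ω) {t : ℝ} (ht : t ∈ Ioo 0 T) :
    σ * w x t ≤ Real.exp (l * T) *
      max m (Real.sqrt ((c₂ ^ 2 / 2) / (l - (c₁ + 1 / 2)))) := by
  have hl0 : 0 < l := by linarith [h.c₁_pos]
  set M := max m (Real.sqrt ((c₂ ^ 2 / 2) / (l - (c₁ + 1 / 2)))) with hM
  have hM0 : 0 ≤ M := hm0.trans (le_max_left _ _)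
  have hσabs : |σ| = 1 := by rcases hσ with rfl | rfl <;> simp
  have hE1 : ∀ s, 0 ≤ s → Real.exp (-(l * s)) ≤ 1 := fun s hs => by
    rw [Real.exp_le_one_iff]; nlinarith
  set F : Space N × ℝ → ℝ := fun p => Real.exp (-(l * p.2)) * (σ * w p.1 p.2) with hF
  have hsubI : Icc 0 t ⊆ Icc 0 T := Icc_subset_Icc le_rfl ht.2.le
  have hFc : ContinuousOn F (closure Ω ×ˢ Icc 0 t) := by
    refine ContinuousOn.mul ?_ (continuousOn_const.mul (hw.cont.mono (prod_mono_right hsubI)))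
    fun_prop
  have hcomp : IsCompact (closure Ω ×ˢ Icc 0 t) :=
    (isCompact_closure_of_bounded hb).prod isCompact_Icc
  obtain ⟨⟨x₀, t₀⟩, ⟨hx₀, ht₀⟩, hmax⟩ := hcomp.exists_isMaxOn
    ⟨(x, t), subset_closure hx, right_mem_Icc.2 ht.1.le⟩ hFc
  have hinit : ∀ y ∈ closure Ω, |w y 0| ≤ m := fun y hy => by
    have hc0 : ContinuousOn (fun y => |w y 0|) (closure Ω) :=
      (hw.cont.comp (f := fun y : Space N => (y, (0 : ℝ))) (by fun_prop)
        fun y hy => ⟨hy, left_mem_Icc.2 (ht.1.trans ht.2).le⟩).abs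
    exact le_on_closure (fun y hy => by rw [hw.initial y hy]; exact hm y hy) hc0
      continuousOn_const hy
  have hle : F (x₀, t₀) ≤ M := by
    rcases eq_or_lt_of_le ht₀.1 with h0 | h0
    · -- the maximum is attained initially
      change 0 = t₀ at h0
      rw [← h0]
      simp only [hF, mul_zero, neg_zero, Real.exp_zero, one_mul]
      calc σ * w x₀ 0 ≤ |σ * w x₀ 0| := le_abs_self _
        _ = |w x₀ 0| := by rw [abs_mul, hσabs, one_mul]
        _ ≤ M := (hinit x₀ hx₀).trans (le_max_left _ _)
    have ht₀T : t₀ ∈ Ioo 0 T := ⟨h0, ht₀.2.trans_lt ht.2⟩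
    by_cases hx₀Ω : x₀ ∈ Ω
    · rcases le_or_gt (σ * w x₀ t₀) 0 with hneg | hpos
      · exact (mul_nonpos_of_nonneg_of_nonpos (Real.exp_pos _).le hneg).trans hM0
      -- the maximum is attained in the interior, or at the final time
      have hlocmax : IsLocalMax (fun y => σ * w y t₀) x₀ := by
        filter_upwards [hΩ.mem_nhds hx₀Ω] with y hy
        have := hmax (show (y, t₀) ∈ closure Ω ×ˢ Icc 0 t from ⟨subset_closure hy, ht₀⟩)
        exact le_of_mul_le_mul_left this (Real.exp_pos _)
      have h1 := hw.timeDeriv_le_of_isLocalMax hΩ hδ h hk hG hσ hx₀Ω ht₀T hlocmax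
      have hd : HasDerivAt (fun s => F (x₀, s)) (-l * Real.exp (-(l * t₀)) * (σ * w x₀ t₀)
          + Real.exp (-(l * t₀)) * (σ * timeDeriv w x₀ t₀)) t₀ := by
        have h2 : HasDerivAt (fun s : ℝ => Real.exp (-(l * s))) (-l * Real.exp (-(l * t₀))) t₀ := by
          have h3 : HasDerivAt (fun s : ℝ => -(l * s)) (-l) t₀ := by
            simpa using (hasDerivAt_id t₀).const_mul (-l)
          have := h3.exp
          rwa [mul_comm] at this
        exact h2.mul ((hw.diff_time x₀ hx₀Ω t₀ ht₀T).hasDerivAt.const_mul σ)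
      have h2 := nonneg_of_hasDerivAt_of_le h0 hd fun s hs =>
        hmax (show (x₀, s) ∈ closure Ω ×ˢ Icc 0 t from ⟨hx₀, hs.1.le, hs.2.le.trans ht₀.2⟩)
      have h3 : l * (σ * w x₀ t₀) ≤ σ * timeDeriv w x₀ t₀ := by
        have h4 : 0 ≤ Real.exp (-(l * t₀)) * (σ * timeDeriv w x₀ t₀ - l * (σ * w x₀ t₀)) := by
          linarith
        have := nonneg_of_mul_nonneg_right h4 (Real.exp_pos _)
        linarith
      have h5 : |w x₀ t₀| = σ * w x₀ t₀ := by
        rw [← abs_of_pos hpos, abs_mul, hσabs, one_mul]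
      rw [h5] at h1
      have h6 : σ * w x₀ t₀ ≤ c₂ / (l - c₁) := by
        rw [le_div_iff₀ (by linarith)]
        linarith
      calc F (x₀, t₀) ≤ σ * w x₀ t₀ := mul_le_of_le_one_left hpos.le (hE1 t₀ ht₀.1)
        _ ≤ M := h6.trans ((div_le_sqrt_growth hl).trans (le_max_right _ _))
    · have hfr : x₀ ∈ frontier Ω := by
        rw [hΩ.frontier_eq]; exact ⟨hx₀, hx₀Ω⟩
      simp only [hF, hw.boundary x₀ hfr t₀ ht₀T, mul_zero]
      exact hM0
  have hxt : F (x, t) ≤ M := (hmax (show (x, t) ∈ closure Ω ×ˢ Icc 0 t from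
    ⟨subset_closure hx, right_mem_Icc.2 ht.1.le⟩)).trans hle
  calc σ * w x t = Real.exp (l * t) * F (x, t) := by
        simp only [hF]
        rw [← mul_assoc, ← Real.exp_add, add_neg_cancel, Real.exp_zero, one_mul]
    _ ≤ Real.exp (l * t) * M := mul_le_mul_of_nonneg_left hxt (Real.exp_pos _).le
    _ ≤ Real.exp (l * T) * M := by
        refine mul_le_mul_of_nonneg_right (Real.exp_le_exp.2 ?_) hM0
        nlinarith [ht.2]

theorem supNorm_nonneg (Ω : Set (Space N)) (u₀ : Space N → ℝ) : 0 ≤ supNorm Ω u₀ :=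
  Real.sSup_nonneg (by rintro _ ⟨x, -, rfl⟩; exact abs_nonneg _)

theorem supNorm_add_one_le_boundM {T c₁ c₂ : ℝ} (hT : 0 < T) (hc₁ : 0 < c₁)
    (u₀ : Space N → ℝ) : supNorm Ω u₀ + 1 ≤ boundM Ω T u₀ c₁ c₂ := by
  have : Nonempty (Ioi (c₁ + 1 / 2)) := ⟨⟨c₁ + 1 / 2 + 1, by simp⟩⟩
  refine le_ciInf fun l => ?_
  have hl : c₁ + 1 / 2 < (l : ℝ) := l.2
  have h1 : 1 ≤ Real.exp ((l : ℝ) * T) := Real.one_le_exp (by nlinarith)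
  have h2 : supNorm Ω u₀ + 1 ≤ max (supNorm Ω u₀ + 1)
      (Real.sqrt ((c₂ ^ 2 / 2) / ((l : ℝ) - (c₁ + 1 / 2)))) := le_max_left _ _
  exact h2.trans (le_mul_of_one_le_left (by linarith [supNorm_nonneg Ω u₀]) h1)

theorem IsClassicalSolution.abs_le_boundM
    (hw : IsClassicalSolution Ω T δ k Gε Φ f v₀ w) (hΩ : IsOpen Ω) (hb : Bornology.IsBounded Ω)
    (hδ : 0 < δ) (h : IsAdmissibleFluxSource Ω T Φ f c₁ c₂) (hk : IsPenalty ε k)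
    (hG : ContDiff ℝ ∞ (fun z : Space N × ℝ => Gε z.1 z.2)) {u₀ : Space N → ℝ}
    (hm : ∀ x ∈ Ω, |v₀ x| ≤ supNorm Ω u₀ + 1)
    {x : Space N} (hx : x ∈ Ω) {t : ℝ} (ht : t ∈ Ioo 0 T) :
    |w x t| ≤ boundM Ω T u₀ c₁ c₂ := by
  have : Nonempty (Ioi (c₁ + 1 / 2)) := ⟨⟨c₁ + 1 / 2 + 1, by simp⟩⟩
  have hm0 : 0 ≤ supNorm Ω u₀ + 1 := by linarith [supNorm_nonneg Ω u₀]
  refine le_ciInf fun l => abs_le'.2 ⟨?_, ?_⟩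
  · simpa using hw.mul_le_exp_mul_max hΩ hb hδ h hk hG hm0 hm (Or.inl rfl) l.2 hx ht
  · simpa using hw.mul_le_exp_mul_max hΩ hb hδ h hk hG hm0 hm (Or.inr rfl) l.2 hx ht

end MaximumPrinciple

/-! ### `L¹` comparison of solutions -/

section Comparison

variable {N : ℕ} {Ω : Set (Space N)} {S T R δ ε c₁ c₂ L M : ℝ} {k : ℝ → ℝ}
  {Gε : Space N → ℝ → ℝ} {Φ : Space N → ℝ → ℝ → Space N} {f : Space N → ℝ → ℝ → ℝ}
  {v₀ : Space N → ℝ} {w w₁ w₂ : Space N → ℝ → ℝ}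

/-- The bounds on `Φ` and `f` on `{|u| < R}` that enter the estimates, with one constant `L`. -/
structure HasFluxSourceBound (Ω : Set (Space N)) (T R : ℝ) (Φ : Space N → ℝ → ℝ → Space N)
    (f : Space N → ℝ → ℝ → ℝ) (L : ℝ) : Prop where
  pos : 0 < L
  source : ∀ x ∈ Ω, ∀ t ∈ Ioo 0 T, ∀ u ∈ Ioo (-R) R, |f x t u| ≤ L
  source_sub : ∀ x ∈ Ω, ∀ t ∈ Ioo 0 T, ∀ t' ∈ Ioo 0 T, ∀ u ∈ Ioo (-R) R, ∀ u' ∈ Ioo (-R) R,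
    t ≤ t' → |f x t' u' - f x t u| ≤ L * ((t' - t) + |u' - u|)
  flux : ∀ x ∈ Ω, ∀ t ∈ Ioo 0 T, ∀ u ∈ Ioo (-R) R, ‖Φ x t u‖ ≤ L
  flux_sub : ∀ x ∈ Ω, ∀ t ∈ Ioo 0 T, ∀ u ∈ Ioo (-R) R, ∀ u' ∈ Ioo (-R) R,
    ‖Φ x t u' - Φ x t u‖ ≤ L * |u' - u|
  flux_div : ∀ x ∈ Ω, ∀ t ∈ Ioo 0 T, ∀ v : Space N → ℝ, DifferentiableAt ℝ v x →
    v x ∈ Ioo (-R) R → |divergence (fun y => Φ y t (v y)) x| ≤ L * (1 + ‖gradient v x‖)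
  flux_div_sub : ∀ x ∈ Ω, ∀ t ∈ Ioo 0 T, ∀ t' ∈ Ioo 0 T, t ≤ t' → ∀ v : Space N → ℝ,
    DifferentiableAt ℝ v x → v x ∈ Ioo (-R) R →
    |divergence (fun y => Φ y t' (v y)) x - divergence (fun y => Φ y t (v y)) x|
      ≤ L * (t' - t) * (1 + ‖gradient v x‖)

theorem IsAdmissibleFluxSource.exists_bound (h : IsAdmissibleFluxSource Ω T Φ f c₁ c₂)
    (hΩ : IsOpen Ω) (hR : 0 < R) : ∃ L, HasFluxSourceBound Ω T R Φ f L := by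
  obtain ⟨A, hA0, hA1, hA2⟩ := h.exists_source_bound hΩ hR
  obtain ⟨B, hB0, hB1, hB2, hB3, hB4⟩ := h.exists_flux_bound hΩ hR
  refine ⟨A + B + 1, by positivity, ?_, ?_, ?_, ?_, ?_, ?_⟩
  · exact fun x hx t ht u hu => (hA1 x hx t ht u hu).trans (by linarith)
  · intro x hx t ht t' ht' u hu u' hu' hle
    refine (hA2 x hx t ht t' ht' u hu u' hu' hle).trans ?_
    have := sub_nonneg.2 hle
    gcongr
    linarith
  · exact fun x hx t ht u hu => (hB1 x hx t ht u hu).trans (by linarith)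
  · intro x hx t ht u hu u' hu'
    refine (hB2 x hx t ht u hu u' hu').trans ?_
    gcongr
    linarith
  · intro x hx t ht v hv hvR
    refine (hB3 x hx t ht v hv hvR).trans ?_
    gcongr
    linarith
  · intro x hx t ht t' ht' hle v hv hvR
    refine (hB4 x hx t ht t' ht' hle v hv hvR).trans ?_
    have := sub_nonneg.2 hle
    gcongr
    linarith

theorem mem_Ioo_of_abs_le {s M : ℝ} (h : |s| ≤ M) : s ∈ Ioo (-(M + 1)) (M + 1) := by
  rw [abs_le] at h
  constructor <;> linarith [h.1, h.2]

/-- Monotonicity of `p ↦ k(|p|² - s) p`, up to the variation of the threshold `s`. -/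
theorem neg_le_inner_penalty_sub {E : Type*} [NormedAddCommGroup E] [InnerProductSpace ℝ E]
    (hk : Monotone k) (hk0 : ∀ s, 0 ≤ k s) (p₁ p₂ : E) (s₁ s₂ : ℝ) :
    -((k (‖p₁‖ ^ 2 - s₁) + k (‖p₂‖ ^ 2 - s₂)) / 2 * |s₁ - s₂|)
      ≤ inner ℝ (k (‖p₁‖ ^ 2 - s₁) • p₁ - k (‖p₂‖ ^ 2 - s₂) • p₂) (p₁ - p₂) := by
  have hk1 := hk0 (‖p₁‖ ^ 2 - s₁)
  have hk2 := hk0 (‖p₂‖ ^ 2 - s₂)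
  have hmono : 0 ≤ (k (‖p₁‖ ^ 2 - s₁) - k (‖p₂‖ ^ 2 - s₂))
      * ((‖p₁‖ ^ 2 - s₁) - (‖p₂‖ ^ 2 - s₂)) := by
    rcases le_total (‖p₁‖ ^ 2 - s₁) (‖p₂‖ ^ 2 - s₂) with h | h
    · exact mul_nonneg_of_nonpos_of_nonpos (sub_nonpos.2 (hk h)) (sub_nonpos.2 h)
    · exact mul_nonneg (sub_nonneg.2 (hk h)) (sub_nonneg.2 h)
  set a := k (‖p₁‖ ^ 2 - s₁) with ha
  set b := k (‖p₂‖ ^ 2 - s₂) with hb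
  have hexp : inner ℝ (a • p₁ - b • p₂) (p₁ - p₂)
      = (a + b) / 2 * ‖p₁ - p₂‖ ^ 2 + (a - b) / 2 * (‖p₁‖ ^ 2 - ‖p₂‖ ^ 2) := by
    rw [norm_sub_sq_real]
    simp only [inner_sub_left, inner_sub_right, real_inner_smul_left, real_inner_self_eq_norm_sq,
      real_inner_comm p₁ p₂]
    ring
  have h1 : 0 ≤ (a + b) / 2 * ‖p₁ - p₂‖ ^ 2 := by positivity
  have h2 : |(a - b) * (s₁ - s₂)| ≤ (a + b) * |s₁ - s₂| := by
    rw [abs_mul]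
    refine mul_le_mul_of_nonneg_right ?_ (abs_nonneg _)
    rw [abs_le]; constructor <;> linarith
  have h3 := (abs_le.1 h2).1
  rw [hexp]
  linarith

/-- The mollified threshold is Lipschitz in `u`, uniformly in `x`; the constant depends on `ε`. -/
theorem exists_abs_sq_sub_sq_le (hb : Bornology.IsBounded Ω)
    (hG : ContDiff ℝ ∞ (fun z : Space N × ℝ => Gε z.1 z.2)) (M : ℝ) :
    ∃ C, 0 ≤ C ∧ ∀ x ∈ Ω, ∀ u ∈ Icc (-M) M, ∀ u' ∈ Icc (-M) M,
      |(Gε x u) ^ 2 - (Gε x u') ^ 2| ≤ C * |u - u'| := by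
  have hG2 : ContDiff ℝ ∞ (fun z : Space N × ℝ => (Gε z.1 z.2) ^ 2) := hG.pow 2
  have hc : Continuous fun z : Space N × ℝ =>
      fderiv ℝ (fun z : Space N × ℝ => (Gε z.1 z.2) ^ 2) z (0, 1) :=
    (hG2.continuous_fderiv (by simp)).clm_apply continuous_const
  obtain ⟨C, hC⟩ := ((isCompact_closure_of_bounded hb).prod
    (isCompact_Icc (a := -M) (b := M))).exists_bound_of_continuousOn hc.continuousOn
  refine ⟨max C 0, le_max_right _ _, fun x hx u hu u' hu' => ?_⟩
  have hd : ∀ s ∈ Icc (-M) M, HasDerivWithinAt (fun s => (Gε x s) ^ 2)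
      (fderiv ℝ (fun z : Space N × ℝ => (Gε z.1 z.2) ^ 2) (x, s) (0, 1)) (Icc (-M) M) s := by
    intro s _
    have h1 : HasDerivAt (fun s : ℝ => (x, s)) ((0, 1) : Space N × ℝ) s :=
      (hasDerivAt_const s x).prodMk (hasDerivAt_id s)
    exact ((hG2.differentiable (by simp) (x, s)).hasFDerivAt.comp_hasDerivAt s h1).hasDerivWithinAt
  have := (convex_Icc (-M) M).norm_image_sub_le_of_norm_hasDerivWithin_le hd
    (fun s hs => (hC (x, s) ⟨subset_closure hx, hs⟩).trans (le_max_left C 0)) hu' hu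
  simpa using this

/-- The flux difference is monotone up to a multiple of `|w₁ - w₂|`. -/
theorem neg_le_inner_totalFlux_sub (hk : IsPenalty ε k) (hδ : 0 < δ)
    (hB : HasFluxSourceBound Ω T (M + 1) Φ f L) {C : ℝ} {x : Space N} (hx : x ∈ Ω) {t : ℝ}
    (ht : t ∈ Ioo 0 T) (h₁ : |w₁ x t| ≤ M) (h₂ : |w₂ x t| ≤ M)
    (hC : |(Gε x (w₁ x t)) ^ 2 - (Gε x (w₂ x t)) ^ 2| ≤ C * |w₁ x t - w₂ x t|) :
    -(|w₁ x t - w₂ x t| * (δ / 2 * (penalty k Gε w₁ x t + penalty k Gε w₂ x t) * C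
        + L * ‖spaceGrad w₁ x t - spaceGrad w₂ x t‖))
      ≤ inner ℝ (totalFlux δ k Gε Φ w₁ x t - totalFlux δ k Gε Φ w₂ x t)
          (spaceGrad w₁ x t - spaceGrad w₂ x t) := by
  have hk0 : ∀ s, 0 ≤ k s := fun s => zero_le_one.trans (hk.one_le s)
  have h3 := neg_le_inner_penalty_sub hk.mono hk0 (spaceGrad w₁ x t) (spaceGrad w₂ x t)
    ((Gε x (w₁ x t)) ^ 2) ((Gε x (w₂ x t)) ^ 2)
  have h4 := hB.flux_sub x hx t ht _ (mem_Ioo_of_abs_le h₂) _ (mem_Ioo_of_abs_le h₁)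
  have h5 : -(L * |w₁ x t - w₂ x t| * ‖spaceGrad w₁ x t - spaceGrad w₂ x t‖)
      ≤ inner ℝ (Φ x t (w₁ x t) - Φ x t (w₂ x t)) (spaceGrad w₁ x t - spaceGrad w₂ x t) := by
    have := abs_real_inner_le_norm (Φ x t (w₁ x t) - Φ x t (w₂ x t))
      (spaceGrad w₁ x t - spaceGrad w₂ x t)
    have h6 := mul_le_mul_of_nonneg_right h4 (norm_nonneg (spaceGrad w₁ x t - spaceGrad w₂ x t))
    linarith [(abs_le.1 this).1]
  have hsplit : totalFlux δ k Gε Φ w₁ x t - totalFlux δ k Gε Φ w₂ x t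
      = δ • (penalty k Gε w₁ x t • spaceGrad w₁ x t - penalty k Gε w₂ x t • spaceGrad w₂ x t)
        + (Φ x t (w₁ x t) - Φ x t (w₂ x t)) := by
    simp only [totalFlux, mul_smul, smul_sub]
    abel
  have hp : 0 ≤ (penalty k Gε w₁ x t + penalty k Gε w₂ x t) / 2 :=
    div_nonneg (add_nonneg (hk0 _) (hk0 _)) two_pos.le
  have h7 := mul_le_mul_of_nonneg_left hC hp
  rw [hsplit, inner_add_left, real_inner_smul_left]
  have h8 := mul_le_mul_of_nonneg_left h3 hδ.le
  have h9 := mul_le_mul_of_nonneg_left h7 hδ.le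
  simp only [penalty] at *
  linarith

theorem divergence_sub {F G : Space N → Space N} {x : Space N} (hF : DifferentiableAt ℝ F x)
    (hG : DifferentiableAt ℝ G x) :
    divergence (fun y => F y - G y) x = divergence F x - divergence G x := by
  simp only [divergence]
  rw [fderiv_fun_sub hF hG, ← Finset.sum_sub_distrib]
  rfl

theorem spaceGrad_sub {x : Space N} {t : ℝ} (h₁ : DifferentiableAt ℝ (fun y => w₁ y t) x)
    (h₂ : DifferentiableAt ℝ (fun y => w₂ y t) x) :
    spaceGrad (fun y s => w₁ y s - w₂ y s) x t = spaceGrad w₁ x t - spaceGrad w₂ x t := by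
  simp only [spaceGrad, gradient]
  rw [fderiv_fun_sub h₁ h₂, map_sub]

theorem IsConservationLaw.differentiableAt {z : Space N → ℝ → ℝ} {A : Space N → ℝ → Space N}
    {g : Space N → ℝ → ℝ} (h : IsConservationLaw Ω S z A g) (hΩ : IsOpen Ω) {x : Space N}
    (hx : x ∈ Ω) {t : ℝ} (ht : t ∈ Ioo 0 S) : DifferentiableAt ℝ (fun y => z y t) x :=
  ((h.diff_space t ht).differentiableOn (by simp)).differentiableAt (hΩ.mem_nhds hx)

theorem IsConservationLaw.sub {z₁ z₂ : Space N → ℝ → ℝ} {A₁ A₂ : Space N → ℝ → Space N}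
    {g₁ g₂ : Space N → ℝ → ℝ} (h₁ : IsConservationLaw Ω S z₁ A₁ g₁)
    (h₂ : IsConservationLaw Ω S z₂ A₂ g₂) (hΩ : IsOpen Ω) :
    IsConservationLaw Ω S (fun x t => z₁ x t - z₂ x t) (fun x t => A₁ x t - A₂ x t)
      (fun x t => g₁ x t - g₂ x t) := by
  have hd : ∀ x ∈ Ω, ∀ t ∈ Ioo 0 S, HasDerivAt (fun t => z₁ x t - z₂ x t)
      (timeDeriv z₁ x t - timeDeriv z₂ x t) t := fun x hx t ht =>
    (h₁.diff_time x hx t ht).hasDerivAt.sub (h₂.diff_time x hx t ht).hasDerivAt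
  refine ⟨h₁.cont.sub h₂.cont, ?_, fun x hx t ht => (hd x hx t ht).differentiableAt, ?_,
    fun t ht => (h₁.diff_space t ht).sub (h₂.diff_space t ht), ?_,
    fun t ht => (h₁.flux t ht).sub (h₂.flux t ht), ?_⟩
  · intro x hx t ht
    rw [h₁.boundary x hx t ht, h₂.boundary x hx t ht, sub_zero]
  · exact (h₁.cont_time.sub h₂.cont_time).congr fun p hp => (hd p.1 hp.1 p.2 hp.2).deriv
  · exact (h₁.cont_grad.sub h₂.cont_grad).congr fun p hp =>
      spaceGrad_sub (h₁.differentiableAt hΩ hp.1 hp.2) (h₂.differentiableAt hΩ hp.1 hp.2)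
  · intro x hx t ht
    have h3 : timeDeriv (fun x t => z₁ x t - z₂ x t) x t = _ := (hd x hx t ht).deriv
    rw [h3, divergence_sub
      (((h₁.flux t ht).differentiableOn (by simp)).differentiableAt (hΩ.mem_nhds hx))
      (((h₂.flux t ht).differentiableOn (by simp)).differentiableAt (hΩ.mem_nhds hx)),
      h₁.equation x hx t ht, h₂.equation x hx t ht]
    ring

theorem IsConservationLaw.mono {z : Space N → ℝ → ℝ} {A : Space N → ℝ → Space N}
    {g : Space N → ℝ → ℝ} (h : IsConservationLaw Ω T z A g) (hST : S ≤ T) :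
    IsConservationLaw Ω S z A g := by
  have hI : Ioo 0 S ⊆ Ioo 0 T := Ioo_subset_Ioo le_rfl hST
  exact ⟨h.cont.mono (prod_mono_right (Icc_subset_Icc le_rfl hST)),
    fun x hx t ht => h.boundary x hx t (hI ht), fun x hx t ht => h.diff_time x hx t (hI ht),
    h.cont_time.mono (prod_mono_right hI), fun t ht => h.diff_space t (hI ht),
    h.cont_grad.mono (prod_mono_right hI), fun t ht => h.flux t (hI ht),
    fun x hx t ht => h.equation x hx t (hI ht)⟩

theorem IsConservationLaw.continuousOn_penalty {A : Space N → ℝ → Space N}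
    {g : Space N → ℝ → ℝ} (h : IsConservationLaw Ω S w A g) (hk : IsPenalty ε k)
    (hG : ContDiff ℝ ∞ (fun z : Space N × ℝ => Gε z.1 z.2)) :
    ContinuousOn (fun p : Space N × ℝ => penalty k Gε w p.1 p.2) (cylinder Ω S) := by
  have hzc : ContinuousOn (fun p : Space N × ℝ => w p.1 p.2) (cylinder Ω S) :=
    h.cont.mono (prod_mono subset_closure Ioo_subset_Icc_self)
  refine hk.smooth.continuous.comp_continuousOn ((h.cont_grad.norm.pow 2).sub (ContinuousOn.pow ?_ 2))
  exact hG.continuous.comp_continuousOn (f := fun p : Space N × ℝ => (p.1, w p.1 p.2))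
    (continuousOn_fst.prodMk hzc)

/-- `L¹` comparison of two functions that solve the equation with the same flux and with
right-hand sides `g₁` and `g₂`. -/
theorem integral_abs_sub_le (hΩ : IsOpen Ω) (hb : Bornology.IsBounded Ω) (hST : S ≤ T)
    (hk : IsPenalty ε k) (hδ : 0 < δ)
    (hG : ContDiff ℝ ∞ (fun z : Space N × ℝ => Gε z.1 z.2))
    (hB : HasFluxSourceBound Ω T (M + 1) Φ f L) {g₁ g₂ : Space N → ℝ → ℝ}
    (h₁ : IsConservationLaw Ω S w₁ (totalFlux δ k Gε Φ w₁) g₁)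
    (h₂ : IsConservationLaw Ω S w₂ (totalFlux δ k Gε Φ w₂) g₂)
    (hM₁ : ∀ x ∈ Ω, ∀ t ∈ Ioo 0 S, |w₁ x t| ≤ M) (hM₂ : ∀ x ∈ Ω, ∀ t ∈ Ioo 0 S, |w₂ x t| ≤ M)
    (hp₁ : IntegrableOn (fun p : Space N × ℝ => penalty k Gε w₁ p.1 p.2) (cylinder Ω S))
    (hp₂ : IntegrableOn (fun p : Space N × ℝ => penalty k Gε w₂ p.1 p.2) (cylinder Ω S))
    (hd₁ : IntegrableOn (fun p : Space N × ℝ => spaceGrad w₁ p.1 p.2) (cylinder Ω S))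
    (hd₂ : IntegrableOn (fun p : Space N × ℝ => spaceGrad w₂ p.1 p.2) (cylinder Ω S))
    {e : Space N × ℝ → ℝ} (he0 : ∀ p ∈ cylinder Ω S, 0 ≤ e p)
    (hei : IntegrableOn e (cylinder Ω S)) {L' : ℝ} (hL' : 0 ≤ L')
    (hg : ∀ x ∈ Ω, ∀ t ∈ Ioo 0 S, |g₁ x t - g₂ x t| ≤ L' * |w₁ x t - w₂ x t| + e (x, t))
    {b : ℝ} (hbS : b ∈ Ioo 0 S) :
    ∫ x in Ω, |w₁ x b - w₂ x b| ≤ Real.exp (L' * b) *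
      ((∫ x in Ω, |w₁ x 0 - w₂ x 0|) + ∫ p in cylinder Ω S, e p) := by
  obtain ⟨C, hC0, hC⟩ := exists_abs_sq_sub_sq_le hb hG M
  have hk0 : ∀ s, 0 ≤ k s := fun s => zero_le_one.trans (hk.one_le s)
  have hlaw := h₁.sub h₂ hΩ
  refine hlaw.integral_abs_le_exp hΩ hb
    (H := fun p => δ / 2 * (penalty k Gε w₁ p.1 p.2 + penalty k Gε w₂ p.1 p.2) * C
        + L * ‖spaceGrad w₁ p.1 p.2 - spaceGrad w₂ p.1 p.2‖) ?_ ?_ ?_ he0 hei ?_ hL' hg hbS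
  · exact ((continuousOn_const.mul ((h₁.continuousOn_penalty hk hG).add
      (h₂.continuousOn_penalty hk hG))).mul continuousOn_const).add
      (continuousOn_const.mul (h₁.cont_grad.sub h₂.cont_grad).norm)
  · intro p _
    have h3 : 0 ≤ penalty k Gε w₁ p.1 p.2 := hk0 _
    have h4 : 0 ≤ penalty k Gε w₂ p.1 p.2 := hk0 _
    have := hB.pos
    positivity
  · exact (((hp₁.add hp₂).const_mul (δ / 2)).mul_const C).add ((hd₁.sub hd₂).norm.const_mul L)
  · intro x hx t ht
    have htT : t ∈ Ioo 0 T := ⟨ht.1, ht.2.trans_le hST⟩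
    rw [spaceGrad_sub (h₁.differentiableAt hΩ hx ht) (h₂.differentiableAt hΩ hx ht)]
    exact neg_le_inner_totalFlux_sub hk hδ hB hx htT (hM₁ x hx t ht) (hM₂ x hx t ht)
      (hC x hx _ (abs_le.1 (hM₁ x hx t ht)) _ (abs_le.1 (hM₂ x hx t ht)))

end Comparison

/-! ### Energy bounds and the initial layer -/

/-- A classical solution of the regularized problem, together with the bounds on the data that
the `L¹` and energy estimates use: `|w| ≤ M`, the threshold is at least `lam`, and `L` bounds the
flux and the source on `{|u| < M + 1}`. -/
structure IsBoundedSolution {N : ℕ} (Ω : Set (Space N)) (T δ ε : ℝ) (k : ℝ → ℝ)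
    (Gε : Space N → ℝ → ℝ) (Φ : Space N → ℝ → ℝ → Space N) (f : Space N → ℝ → ℝ → ℝ)
    (v₀ : Space N → ℝ) (w : Space N → ℝ → ℝ) (c₁ c₂ M L lam : ℝ) : Prop where
  isOpen : IsOpen Ω
  bounded : Bornology.IsBounded Ω
  T_pos : 0 < T
  δ_pos : 0 < δ
  δ_lt : δ < 1
  adm : IsAdmissibleFluxSource Ω T Φ f c₁ c₂
  pen : IsPenalty ε k
  smooth : ContDiff ℝ ∞ (fun z : Space N × ℝ => Gε z.1 z.2)
  lam_pos : 0 < lam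
  lower : ∀ x u, lam ≤ Gε x u
  sol : IsClassicalSolution Ω T δ k Gε Φ f v₀ w
  one_le : 1 ≤ M
  abs_le : ∀ x ∈ Ω, ∀ t ∈ Ioo 0 T, |w x t| ≤ M
  bound : HasFluxSourceBound Ω T (M + 1) Φ f L

/-- The energy density `(δ/2) k(|∇w|² - G²(w)) |∇w|²`. -/
noncomputable def energyDensity {N : ℕ} (δ : ℝ) (k : ℝ → ℝ) (Gε : Space N → ℝ → ℝ)
    (w : Space N → ℝ → ℝ) (p : Space N × ℝ) : ℝ :=
  δ / 2 * (penalty k Gε w p.1 p.2 * ‖spaceGrad w p.1 p.2‖ ^ 2)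

/-- A bound of `δ` times the integral of the energy density over the cylinder. -/
noncomputable def energyConst {N : ℕ} (Ω : Set (Space N)) (T M L : ℝ) : ℝ :=
  ((L ^ 2 + L * M) * T + 2 * M ^ 2) * volume.real Ω

section EnergyEstimates

variable {N : ℕ} {Ω : Set (Space N)} {T δ ε c₁ c₂ L M lam C₀ : ℝ} {k : ℝ → ℝ}
  {Gε : Space N → ℝ → ℝ} {Φ : Space N → ℝ → ℝ → Space N} {f : Space N → ℝ → ℝ → ℝ}
  {v₀ u₀ : Space N → ℝ} {du₀ : Space N → Space N} {w : Space N → ℝ → ℝ}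

namespace IsBoundedSolution

theorem law (h : IsBoundedSolution Ω T δ ε k Gε Φ f v₀ w c₁ c₂ M L lam) :
    IsConservationLaw Ω T w (totalFlux δ k Gε Φ w) (fun x t => f x t (w x t)) :=
  h.sol.isConservationLaw h.isOpen h.adm h.pen h.smooth

theorem one_le_penalty (h : IsBoundedSolution Ω T δ ε k Gε Φ f v₀ w c₁ c₂ M L lam)
    (x : Space N) (t : ℝ) : 1 ≤ penalty k Gε w x t := h.pen.one_le _

theorem energyDensity_nonneg (h : IsBoundedSolution Ω T δ ε k Gε Φ f v₀ w c₁ c₂ M L lam)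
    (p : Space N × ℝ) : 0 ≤ energyDensity δ k Gε w p := by
  have h1 := zero_le_one.trans (h.one_le_penalty p.1 p.2)
  have h2 := h.δ_pos
  simp only [energyDensity]
  positivity

theorem half_mul_sq_le (h : IsBoundedSolution Ω T δ ε k Gε Φ f v₀ w c₁ c₂ M L lam)
    (p : Space N × ℝ) :
    δ / 2 * ‖spaceGrad w p.1 p.2‖ ^ 2 ≤ energyDensity δ k Gε w p := by
  have h1 := h.one_le_penalty p.1 p.2
  have h2 := h.δ_pos
  refine mul_le_mul_of_nonneg_left ?_ (by positivity)
  exact le_mul_of_one_le_left (sq_nonneg _) h1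

theorem continuousOn_penalty (h : IsBoundedSolution Ω T δ ε k Gε Φ f v₀ w c₁ c₂ M L lam) :
    ContinuousOn (fun p : Space N × ℝ => penalty k Gε w p.1 p.2) (cylinder Ω T) :=
  h.law.continuousOn_penalty h.pen h.smooth

theorem continuousOn_energyDensity
    (h : IsBoundedSolution Ω T δ ε k Gε Φ f v₀ w c₁ c₂ M L lam) :
    ContinuousOn (energyDensity δ k Gε w) (cylinder Ω T) :=
  continuousOn_const.mul (h.continuousOn_penalty.mul (h.sol.cont_grad.norm.pow 2))

/-- Coercivity of the flux, by Young's inequality for the term `Φ(w)·∇w`. -/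
theorem energyDensity_sub_le (h : IsBoundedSolution Ω T δ ε k Gε Φ f v₀ w c₁ c₂ M L lam)
    {x : Space N} (hx : x ∈ Ω) {t : ℝ} (ht : t ∈ Ioo 0 T) :
    energyDensity δ k Gε w (x, t) - L ^ 2 / (2 * δ)
      ≤ inner ℝ (totalFlux δ k Gε Φ w x t) (spaceGrad w x t) := by
  have hδ := h.δ_pos
  have h1 := h.half_mul_sq_le (x, t)
  have h2 := h.bound.flux x hx t ht _ (mem_Ioo_of_abs_le (h.abs_le x hx t ht))
  have h3 : -(L * ‖spaceGrad w x t‖) ≤ inner ℝ (Φ x t (w x t)) (spaceGrad w x t) := by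
    have h4 := abs_real_inner_le_norm (Φ x t (w x t)) (spaceGrad w x t)
    have h5 := mul_le_mul_of_nonneg_right h2 (norm_nonneg (spaceGrad w x t))
    linarith [(_root_.abs_le.1 h4).1]
  have hyoung : L * ‖spaceGrad w x t‖ ≤ δ / 2 * ‖spaceGrad w x t‖ ^ 2 + L ^ 2 / (2 * δ) := by
    have h6 : δ / 2 * ‖spaceGrad w x t‖ ^ 2 + L ^ 2 / (2 * δ) - L * ‖spaceGrad w x t‖
        = (δ * ‖spaceGrad w x t‖ - L) ^ 2 / (2 * δ) := by
      field_simp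
      ring
    have h7 : 0 ≤ (δ * ‖spaceGrad w x t‖ - L) ^ 2 / (2 * δ) := by positivity
    linarith
  rw [totalFlux, inner_add_left, real_inner_smul_left, real_inner_self_eq_norm_sq]
  simp only [energyDensity] at *
  linarith

theorem lintegral_energyDensity_le
    (h : IsBoundedSolution Ω T δ ε k Gε Φ f v₀ w c₁ c₂ M L lam) :
    ∫⁻ p in cylinder Ω T, ENNReal.ofReal (energyDensity δ k Gε w p)
      ≤ ENNReal.ofReal (energyConst Ω T M L / δ) := by
  have hδ := h.δ_pos
  have hL := h.bound.pos
  have hM := h.one_le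
  refine (h.law.lintegral_energy_le h.isOpen h.bounded h.T_pos h.continuousOn_energyDensity
    (fun p _ => h.energyDensity_nonneg p) ?_ (q := L ^ 2 / (2 * δ)) (γ := L) (M := M)
    (by positivity) hL.le (by linarith) h.abs_le (fun x hx t ht => h.energyDensity_sub_le hx ht)
    (fun x hx t ht => h.bound.source x hx t ht _
      (mem_Ioo_of_abs_le (h.abs_le x hx t ht)))).trans ?_
  · intro x _ t _ h0
    simp [energyDensity, h0]
  · refine ENNReal.ofReal_le_ofReal ?_
    rw [energyConst, le_div_iff₀ hδ, mul_right_comm]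
    refine mul_le_mul_of_nonneg_right ?_ measureReal_nonneg
    have h1 : L ^ 2 / (2 * δ) * δ = L ^ 2 / 2 := by field_simp
    have hT := h.T_pos
    have h2 : L * M * T * δ ≤ L * M * T := mul_le_of_le_one_right (by positivity) h.δ_lt.le
    have h3 : 2 * M ^ 2 * δ ≤ 2 * M ^ 2 := mul_le_of_le_one_right (by positivity) h.δ_lt.le
    have h4 : 0 ≤ L ^ 2 * T := by positivity
    calc ((L ^ 2 / (2 * δ) + L * M) * T + 2 * M ^ 2) * δ
        = L ^ 2 / (2 * δ) * δ * T + L * M * T * δ + 2 * M ^ 2 * δ := by ring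
      _ ≤ (L ^ 2 + L * M) * T + 2 * M ^ 2 := by rw [h1]; nlinarith

theorem integrableOn_energyDensity
    (h : IsBoundedSolution Ω T δ ε k Gε Φ f v₀ w c₁ c₂ M L lam) :
    IntegrableOn (energyDensity δ k Gε w) (cylinder Ω T) := by
  have hQ := (isOpen_cylinder (S := T) h.isOpen).measurableSet
  refine ⟨h.continuousOn_energyDensity.aestronglyMeasurable hQ, ?_⟩
  rw [hasFiniteIntegral_iff_ofReal (Eventually.of_forall fun p => h.energyDensity_nonneg p)]
  exact h.lintegral_energyDensity_le.trans_lt ENNReal.ofReal_lt_top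

theorem energyConst_nonneg (h : IsBoundedSolution Ω T δ ε k Gε Φ f v₀ w c₁ c₂ M L lam) :
    0 ≤ energyConst Ω T M L := by
  have hL := h.bound.pos
  have hM := h.one_le
  have hT := h.T_pos
  unfold energyConst
  positivity

theorem integral_energyDensity_le
    (h : IsBoundedSolution Ω T δ ε k Gε Φ f v₀ w c₁ c₂ M L lam) :
    ∫ p in cylinder Ω T, energyDensity δ k Gε w p ≤ energyConst Ω T M L / δ := by
  rw [integral_eq_lintegral_of_nonneg_ae (Eventually.of_forall fun p => h.energyDensity_nonneg p)
    h.integrableOn_energyDensity.1]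
  exact ENNReal.toReal_le_of_le_ofReal (div_nonneg h.energyConst_nonneg h.δ_pos.le)
    h.lintegral_energyDensity_le

/-- The penalty is `1` where the constraint holds; elsewhere `|∇w| ≥ lam`. -/
theorem penalty_le (h : IsBoundedSolution Ω T δ ε k Gε Φ f v₀ w c₁ c₂ M L lam)
    (p : Space N × ℝ) :
    penalty k Gε w p.1 p.2 ≤ 1 + 2 / (δ * lam ^ 2) * energyDensity δ k Gε w p := by
  have hδ := h.δ_pos
  have hl := h.lam_pos
  have h0 := h.energyDensity_nonneg p
  rcases le_total ‖spaceGrad w p.1 p.2‖ (Gε p.1 (w p.1 p.2)) with hle | hle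
  · have : penalty k Gε w p.1 p.2 = 1 := h.pen.eq_one_of_nonpos (norm_nonneg _) hle
    rw [this]
    have : 0 ≤ 2 / (δ * lam ^ 2) * energyDensity δ k Gε w p := by positivity
    linarith
  · have h1 : lam ^ 2 ≤ ‖spaceGrad w p.1 p.2‖ ^ 2 :=
      pow_le_pow_left₀ hl.le ((h.lower _ _).trans hle) 2
    have h2 : 2 / (δ * lam ^ 2) * energyDensity δ k Gε w p
        = penalty k Gε w p.1 p.2 * (‖spaceGrad w p.1 p.2‖ ^ 2 / lam ^ 2) := by
      rw [energyDensity]; field_simp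
    have h3 : 1 ≤ ‖spaceGrad w p.1 p.2‖ ^ 2 / lam ^ 2 := by
      rwa [one_le_div (by positivity)]
    rw [h2]
    have := le_mul_of_one_le_right (zero_le_one.trans (h.one_le_penalty p.1 p.2)) h3
    linarith

/-- Young's inequality, with `k ≥ 1`. -/
theorem norm_spaceGrad_le (h : IsBoundedSolution Ω T δ ε k Gε Φ f v₀ w c₁ c₂ M L lam)
    (p : Space N × ℝ) :
    ‖spaceGrad w p.1 p.2‖ ≤ energyDensity δ k Gε w p + 1 / (2 * δ) := by
  have hδ := h.δ_pos
  have h1 := h.half_mul_sq_le p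
  have h6 : δ / 2 * ‖spaceGrad w p.1 p.2‖ ^ 2 + 1 / (2 * δ) - ‖spaceGrad w p.1 p.2‖
      = (δ * ‖spaceGrad w p.1 p.2‖ - 1) ^ 2 / (2 * δ) := by
    field_simp
    ring
  have h7 : 0 ≤ (δ * ‖spaceGrad w p.1 p.2‖ - 1) ^ 2 / (2 * δ) := by positivity
  linarith

theorem volume_cylinder_lt_top (h : IsBoundedSolution Ω T δ ε k Gε Φ f v₀ w c₁ c₂ M L lam) :
    volume (cylinder Ω T) < ⊤ :=
  (h.bounded.prod (Metric.isBounded_Ioo 0 T)).measure_lt_top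

theorem integrableOn_penalty (h : IsBoundedSolution Ω T δ ε k Gε Φ f v₀ w c₁ c₂ M L lam) :
    IntegrableOn (fun p : Space N × ℝ => penalty k Gε w p.1 p.2) (cylinder Ω T) := by
  have hQ := (isOpen_cylinder (S := T) h.isOpen).measurableSet
  have hc : IntegrableOn (fun _ : Space N × ℝ => (1 : ℝ)) (cylinder Ω T) :=
    integrableOn_const h.volume_cylinder_lt_top.ne
  refine Integrable.mono' (hc.add (h.integrableOn_energyDensity.const_mul (2 / (δ * lam ^ 2))))
    (h.continuousOn_penalty.aestronglyMeasurable hQ) (Eventually.of_forall fun p => ?_)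
  rw [Real.norm_of_nonneg (zero_le_one.trans (h.one_le_penalty p.1 p.2))]
  exact h.penalty_le p

theorem integrableOn_spaceGrad (h : IsBoundedSolution Ω T δ ε k Gε Φ f v₀ w c₁ c₂ M L lam) :
    IntegrableOn (fun p : Space N × ℝ => spaceGrad w p.1 p.2) (cylinder Ω T) := by
  have hQ := (isOpen_cylinder (S := T) h.isOpen).measurableSet
  have hc : IntegrableOn (fun _ : Space N × ℝ => 1 / (2 * δ)) (cylinder Ω T) :=
    integrableOn_const h.volume_cylinder_lt_top.ne
  exact Integrable.mono' (h.integrableOn_energyDensity.add hc)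
    (h.sol.cont_grad.aestronglyMeasurable hQ)
    (Eventually.of_forall fun p => h.norm_spaceGrad_le p)

theorem volume_real_cylinder (h : IsBoundedSolution Ω T δ ε k Gε Φ f v₀ w c₁ c₂ M L lam) :
    volume.real (cylinder Ω T) = volume.real Ω * T := by
  rw [cylinder, measureReal_def, Measure.volume_eq_prod, Measure.prod_prod, ENNReal.toReal_mul,
    Real.volume_Ioo, sub_zero, ENNReal.toReal_ofReal h.T_pos.le, measureReal_def]

theorem integral_norm_spaceGrad_le
    (h : IsBoundedSolution Ω T δ ε k Gε Φ f v₀ w c₁ c₂ M L lam) :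
    ∫ p in cylinder Ω T, ‖spaceGrad w p.1 p.2‖
      ≤ (energyConst Ω T M L + volume.real Ω * T) / δ := by
  have hδ := h.δ_pos
  have hc : IntegrableOn (fun _ : Space N × ℝ => 1 / (2 * δ)) (cylinder Ω T) :=
    integrableOn_const h.volume_cylinder_lt_top.ne
  have h1 : ∫ p in cylinder Ω T, ‖spaceGrad w p.1 p.2‖
      ≤ ∫ p in cylinder Ω T, (energyDensity δ k Gε w p + 1 / (2 * δ)) :=
    integral_mono h.integrableOn_spaceGrad.norm (h.integrableOn_energyDensity.add hc)
      fun p => h.norm_spaceGrad_le p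
  rw [integral_add h.integrableOn_energyDensity hc, setIntegral_const,
    h.volume_real_cylinder, smul_eq_mul] at h1
  have h2 : volume.real Ω * T * (1 / (2 * δ)) ≤ volume.real Ω * T / δ := by
    rw [mul_one_div]
    have := h.T_pos
    gcongr
    linarith
  rw [add_div]
  linarith [h.integral_energyDensity_le]

/-- The regularized initial datum, as a stationary solution with its own right-hand side. -/
theorem law_initial (h : IsBoundedSolution Ω T δ ε k Gε Φ f v₀ w c₁ c₂ M L lam)
    (hv : IsTestFunction Ω v₀) :
    IsConservationLaw Ω T (fun x _ => v₀ x) (totalFlux δ k Gε Φ fun x _ => v₀ x)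
      (fun x t => -divergence (fun y => totalFlux δ k Gε Φ (fun x _ => v₀ x) y t) x) := by
  have hv2 : ContDiffOn ℝ 2 v₀ Ω := (contDiff_infty.1 hv.smooth 2).contDiffOn
  refine ⟨?_, ?_, fun x _ t _ => differentiableAt_const _, ?_, fun t _ => hv2.of_le (by norm_num),
    ?_, fun t ht => contDiffOn_flux h.isOpen h.adm h.pen h.smooth hv2 ht δ, ?_⟩
  · exact (hv.smooth.continuous.comp continuous_fst).continuousOn
  · intro x hx t _
    have hxΩ : x ∉ Ω := by
      rw [h.isOpen.frontier_eq] at hx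
      exact hx.2
    exact image_eq_zero_of_notMem_tsupport fun hc => hxΩ (hv.support hc)
  · simp only [timeDeriv, deriv_const]
    exact continuousOn_const
  · exact (continuousOn_gradient h.isOpen (hv2.of_le (by norm_num))).comp continuousOn_fst
      fun p hp => hp.1
  · intro x _ t _
    simp [timeDeriv]

/-- For the initial datum the constraint holds, so that its flux is `δ ∇v₀ + Φ(v₀)`. -/
theorem abs_divergence_initial_le (h : IsBoundedSolution Ω T δ ε k Gε Φ f v₀ w c₁ c₂ M L lam)
    (hv : IsRegularizedInitial Ω Gε u₀ du₀ C₀ δ v₀) (hvM : ∀ x ∈ Ω, |v₀ x| ≤ M)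
    {x : Space N} (hx : x ∈ Ω) {t : ℝ} (ht : t ∈ Ioo 0 T) :
    |divergence (fun y => totalFlux δ k Gε Φ (fun x _ => v₀ x) y t) x|
      ≤ δ * |divergence (gradient v₀) x| + L * (1 + ‖gradient v₀ x‖) := by
  have hv2 : ContDiffOn ℝ 2 v₀ Ω := (contDiff_infty.1 hv.test.smooth 2).contDiffOn
  have hvd : DifferentiableAt ℝ v₀ x := hv.test.smooth.differentiable (by simp) x
  have hgr := ((contDiffOn_gradient h.isOpen hv2).differentiableOn (by simp)).differentiableAt
    (h.isOpen.mem_nhds hx)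
  have hev : (fun y => totalFlux δ k Gε Φ (fun x _ => v₀ x) y t)
      =ᶠ[𝓝 x] fun y => δ • gradient v₀ y + Φ y t (v₀ y) := by
    filter_upwards [h.isOpen.mem_nhds hx] with y hy
    have : penalty k Gε (fun x _ => v₀ x) y t = 1 :=
      h.pen.eq_one_of_nonpos (norm_nonneg _) (hv.grad_le_threshold y hy)
    rw [totalFlux, this, mul_one]
    rfl
  have hΦ := h.adm.differentiableAt_comp h.isOpen hx ht hvd
  have hs : DifferentiableAt ℝ (fun y => δ • gradient v₀ y) x := hgr.const_smul δ
  have h1 : divergence (fun y => totalFlux δ k Gε Φ (fun x _ => v₀ x) y t) x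
      = δ * divergence (gradient v₀) x + divergence (fun y => Φ y t (v₀ y)) x := by
    simp only [divergence]
    rw [hev.fderiv_eq, fderiv_fun_add hs hΦ, fderiv_fun_const_smul hgr,
      Finset.mul_sum, ← Finset.sum_add_distrib]
    rfl
  have h2 := h.bound.flux_div x hx t ht v₀ hvd (mem_Ioo_of_abs_le (hvM x hx))
  rw [h1]
  refine (abs_add_le _ _).trans (add_le_add ?_ h2)
  rw [abs_mul, abs_of_pos h.δ_pos]

/-- The initial layer: `‖w(b) - v₀‖₁ ≤ C b`. -/
theorem integral_abs_sub_initial_le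
    (h : IsBoundedSolution Ω T δ ε k Gε Φ f v₀ w c₁ c₂ M L lam)
    (hv : IsRegularizedInitial Ω Gε u₀ du₀ C₀ δ v₀) (hvM : ∀ x ∈ Ω, |v₀ x| ≤ M)
    (hdu : IntegrableOn du₀ Ω) {b : ℝ} (hb : 0 < b) (hbT : 2 * b ≤ T) :
    ∫ x in Ω, |w x b - v₀ x| ≤ b * (2 * (2 * L * volume.real Ω + C₀ + L * ∫ x in Ω, ‖du₀ x‖)) := by
  have hΩ := h.isOpen
  have hδ := h.δ_pos
  have hL := h.bound.pos
  have hcl := isCompact_closure_of_bounded h.bounded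
  have hfin : IsFiniteMeasure (volume.restrict Ω) :=
    ⟨by simpa using volume_lt_top_of_bounded h.bounded⟩
  have hsub : cylinder Ω (2 * b) ⊆ cylinder Ω T := prod_mono_right (Ioo_subset_Ioo le_rfl hbT)
  have hIoo : Ioo 0 (2 * b) ⊆ Ioo 0 T := Ioo_subset_Ioo le_rfl hbT
  have hv2 : ContDiffOn ℝ 2 v₀ univ :=
    (contDiff_infty.1 hv.test.smooth 2).contDiffOn
  have hgc : Continuous (gradient v₀) :=
    continuousOn_univ.1 (contDiffOn_gradient isOpen_univ hv2).continuousOn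
  have hdc : Continuous (divergence (gradient v₀)) :=
    continuousOn_univ.1 (continuousOn_divergence isOpen_univ (contDiffOn_gradient isOpen_univ hv2))
  have hgi : IntegrableOn (fun x => ‖gradient v₀ x‖) Ω :=
    (hgc.norm.continuousOn.integrableOn_compact hcl).mono_set subset_closure
  have hdi : IntegrableOn (fun x => |divergence (gradient v₀) x|) Ω :=
    (hdc.abs.continuousOn.integrableOn_compact hcl).mono_set subset_closure
  set e₀ : Space N → ℝ := fun x =>
    2 * L + δ * |divergence (gradient v₀) x| + L * ‖gradient v₀ x‖ with he₀
  have he₀i : IntegrableOn e₀ Ω :=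
    ((integrable_const (2 * L)).add (hdi.const_mul δ)).add (hgi.const_mul L)
  have hprod : ∀ {F : Type} [NormedAddCommGroup F] {φ : Space N → F}, IntegrableOn φ Ω →
      IntegrableOn (fun p : Space N × ℝ => φ p.1) (cylinder Ω (2 * b)) := by
    intro F _ φ hφ
    rw [IntegrableOn, cylinder, volume_restrict_prod]
    exact hφ.comp_fst _
  have hei : IntegrableOn (fun p : Space N × ℝ => e₀ p.1) (cylinder Ω (2 * b)) := hprod he₀i
  have hpen1 : IntegrableOn (fun p : Space N × ℝ => penalty k Gε (fun x _ => v₀ x) p.1 p.2)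
      (cylinder Ω (2 * b)) := by
    have h1 : IntegrableOn (fun _ : Space N × ℝ => (1 : ℝ)) (cylinder Ω (2 * b)) :=
      integrableOn_const ((measure_mono hsub).trans_lt h.volume_cylinder_lt_top).ne
    refine h1.congr_fun (fun p hp => ?_) (isOpen_cylinder hΩ).measurableSet
    exact (h.pen.eq_one_of_nonpos (norm_nonneg _) (hv.grad_le_threshold p.1 hp.1)).symm
  have hgi' : IntegrableOn (gradient v₀) Ω :=
    (hgc.continuousOn.integrableOn_compact hcl).mono_set subset_closure
  have key := integral_abs_sub_le (S := 2 * b) (e := fun p => e₀ p.1) (L' := 0) hΩ h.bounded hbT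
    h.pen hδ h.smooth h.bound
    (h.law.mono hbT) ((h.law_initial hv.test).mono hbT)
    (fun x hx t ht => h.abs_le x hx t (hIoo ht)) (fun x hx t _ => hvM x hx)
    (h.integrableOn_penalty.mono_set hsub) hpen1 (h.integrableOn_spaceGrad.mono_set hsub)
    (hprod hgi') (fun p _ => by simp only [he₀]; positivity) hei le_rfl
    (fun x hx t ht => by
      have h1 := h.bound.source x hx t (hIoo ht) _
        (mem_Ioo_of_abs_le (h.abs_le x hx t (hIoo ht)))
      have h2 := h.abs_divergence_initial_le hv hvM hx (hIoo ht)
      rw [sub_neg_eq_add, zero_mul, zero_add]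
      refine (abs_add_le _ _).trans ((add_le_add h1 h2).trans (le_of_eq ?_))
      simp only [he₀]
      ring)
    (b := b) ⟨hb, by linarith⟩
  have h0 : ∫ x in Ω, |w x 0 - v₀ x| = 0 := by
    rw [setIntegral_congr_fun hΩ.measurableSet (g := fun _ => (0 : ℝ))
      fun x hx => by simp [h.sol.initial x hx]]
    simp
  have hcyl : ∫ p in cylinder Ω (2 * b), e₀ p.1 = 2 * b * ∫ x in Ω, e₀ x := by
    rw [cylinder, volume_restrict_prod, integral_fun_fst, measureReal_restrict_apply_univ,
      Real.volume_real_Ioo_of_le (by linarith), sub_zero, smul_eq_mul]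
  have hint : ∫ x in Ω, e₀ x ≤ 2 * L * volume.real Ω + C₀ + L * ∫ x in Ω, ‖du₀ x‖ := by
    have i12 : IntegrableOn (fun x => 2 * L + δ * |divergence (gradient v₀) x|) Ω :=
      (integrable_const (2 * L)).add (hdi.const_mul δ)
    simp only [he₀]
    rw [integral_add i12 (hgi.const_mul L),
      integral_add (integrable_const (2 * L)) (hdi.const_mul δ), integral_const,
      integral_const_mul, integral_const_mul, measureReal_restrict_apply_univ, smul_eq_mul]
    have h1 : δ * ∫ x in Ω, |divergence (gradient v₀) x| ≤ C₀ := by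
      have := mul_le_mul_of_nonneg_left hv.laplacian_le hδ.le
      rwa [mul_div_cancel₀ _ hδ.ne'] at this
    have h2 : ∫ x in Ω, ‖gradient v₀ x‖ ≤ ∫ x in Ω, ‖du₀ x‖ :=
      integral_mono_ae hgi hdu.norm hv.grad_le
    have h3 := mul_le_mul_of_nonneg_left h2 hL.le
    linarith
  rw [h0, hcyl, zero_mul, Real.exp_zero, one_mul, zero_add] at key
  have h4 := mul_le_mul_of_nonneg_left hint hb.le
  linarith

end IsBoundedSolution

end EnergyEstimates

/-! ### The time derivative -/

section TimeDerivative

variable {N : ℕ} {Ω : Set (Space N)} {T δ ε c₁ c₂ L M lam C₀ τ : ℝ} {k : ℝ → ℝ}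
  {Gε : Space N → ℝ → ℝ} {Φ : Space N → ℝ → ℝ → Space N} {f : Space N → ℝ → ℝ → ℝ}
  {v₀ u₀ : Space N → ℝ} {du₀ : Space N → Space N} {w : Space N → ℝ → ℝ}

/-- A bound of `δ ‖∂ₜw‖_{L^∞(0,T; L¹(Ω))}` in terms of the data, with `I₀` for the `L¹` norm of
the gradient of the initial datum. -/
noncomputable def timeDerivConst (Ω : Set (Space N)) (T M L C₀ I₀ : ℝ) : ℝ :=
  Real.exp (L * T) * (2 * (2 * L * volume.real Ω + C₀ + L * I₀) +
    L * (2 * (volume.real Ω * T) + (energyConst Ω T M L + volume.real Ω * T)))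

theorem cylinder_subset_preimage_add (hτ : 0 < τ) :
    cylinder Ω (T - τ) ⊆ (fun p : Space N × ℝ => p + (0, τ)) ⁻¹' cylinder Ω T := by
  rintro ⟨x, t⟩ ⟨hx, ht⟩
  refine ⟨by simpa using hx, ?_⟩
  simp only [Prod.mk_add_mk] at *
  exact ⟨by linarith [ht.1], by linarith [ht.2]⟩

theorem integrableOn_shift {F : Type*} [NormedAddCommGroup F] {φ : Space N → ℝ → F}
    (hτ : 0 < τ) (hφ : IntegrableOn (fun p : Space N × ℝ => φ p.1 p.2) (cylinder Ω T)) :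
    IntegrableOn (fun p : Space N × ℝ => φ p.1 (p.2 + τ)) (cylinder Ω (T - τ)) := by
  have h1 := ((measurePreserving_add_right (volume : Measure (Space N × ℝ)) (0, τ)
    ).integrableOn_comp_preimage (measurableEmbedding_addRight _)).2 hφ
  refine (h1.mono_set (cylinder_subset_preimage_add hτ)).congr_fun_ae
    (Eventually.of_forall fun p => ?_)
  simp

theorem setIntegral_shift_le {φ : Space N → ℝ → ℝ} (hτ : 0 < τ)
    (h0 : ∀ x t, 0 ≤ φ x t)
    (hφ : IntegrableOn (fun p : Space N × ℝ => φ p.1 p.2) (cylinder Ω T)) :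
    ∫ p in cylinder Ω (T - τ), φ p.1 (p.2 + τ) ≤ ∫ p in cylinder Ω T, φ p.1 p.2 := by
  have hmp := measurePreserving_add_right (volume : Measure (Space N × ℝ)) (0, τ)
  have he := measurableEmbedding_addRight ((0, τ) : Space N × ℝ)
  have h1 := (hmp.integrableOn_comp_preimage he).2 hφ
  have h2 := hmp.setIntegral_preimage_emb he (fun p : Space N × ℝ => φ p.1 p.2) (cylinder Ω T)
  rw [← h2]
  have h3 : ∀ p : Space N × ℝ, φ p.1 (p.2 + τ) = φ (p + (0, τ)).1 (p + (0, τ)).2 := by simp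
  simp only [h3]
  exact setIntegral_mono_set h1 (Eventually.of_forall fun p => h0 _ _)
    (cylinder_subset_preimage_add hτ).eventuallyLE

namespace IsBoundedSolution

/-- The solution translated in time solves an equation with the same flux; the explicit time
dependence of the data is moved to the right-hand side. -/
theorem law_shift (h : IsBoundedSolution Ω T δ ε k Gε Φ f v₀ w c₁ c₂ M L lam) (hτ : 0 < τ) :
    IsConservationLaw Ω (T - τ) (fun x t => w x (t + τ))
      (totalFlux δ k Gε Φ fun x t => w x (t + τ))
      (fun x t => f x (t + τ) (w x (t + τ)) + (divergence (fun y => Φ y (t + τ) (w y (t + τ))) x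
        - divergence (fun y => Φ y t (w y (t + τ))) x)) := by
  have hI : ∀ t ∈ Ioo 0 (T - τ), t + τ ∈ Ioo 0 T := fun t ht =>
    ⟨by linarith [ht.1], by linarith [ht.2]⟩
  have hI' : ∀ t ∈ Ioo 0 (T - τ), t ∈ Ioo 0 T := fun t ht => ⟨ht.1, by linarith [ht.2]⟩
  have hsh : Continuous fun p : Space N × ℝ => (p.1, p.2 + τ) := by fun_prop
  have hmaps : MapsTo (fun p : Space N × ℝ => (p.1, p.2 + τ)) (cylinder Ω (T - τ))
      (cylinder Ω T) := fun p hp => ⟨hp.1, hI p.2 hp.2⟩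
  have htd : ∀ x t, timeDeriv (fun x t => w x (t + τ)) x t = timeDeriv w x (t + τ) := fun x t =>
    deriv_comp_add_const (w x) τ t
  have hfl : ∀ t ∈ Ioo 0 (T - τ),
      ContDiffOn ℝ 1 (fun x => totalFlux δ k Gε Φ (fun x t => w x (t + τ)) x t) Ω := fun t ht =>
    contDiffOn_flux h.isOpen h.adm h.pen h.smooth (h.sol.diff_space _ (hI t ht)) (hI' t ht) δ
  refine ⟨?_, fun x hx t ht => h.sol.boundary x hx _ (hI t ht), ?_, ?_,
    fun t ht => (h.sol.diff_space _ (hI t ht)).of_le (by norm_num), ?_, hfl, ?_⟩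
  · exact h.sol.cont.comp hsh.continuousOn fun p hp =>
      ⟨hp.1, by linarith [hp.2.1], by linarith [hp.2.2]⟩
  · intro x hx t ht
    exact (h.sol.diff_time x hx _ (hI t ht)).comp (f := fun t => t + τ) t (by fun_prop)
  · simp only [htd]
    exact h.sol.cont_time.comp hsh.continuousOn hmaps
  · exact h.sol.cont_grad.comp hsh.continuousOn hmaps
  · intro x hx t ht
    have hwd : DifferentiableAt ℝ (fun y => w y (t + τ)) x :=
      h.law.differentiableAt h.isOpen hx (hI t ht)
    have hd₁ := h.adm.differentiableAt_comp h.isOpen hx (hI t ht) hwd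
    have hd₀ := h.adm.differentiableAt_comp h.isOpen hx (hI' t ht) hwd
    have hA₁ := ((h.law.flux _ (hI t ht)).differentiableOn (by simp)).differentiableAt
      (h.isOpen.mem_nhds hx)
    have hA₀ := ((hfl t ht).differentiableOn (by simp)).differentiableAt (h.isOpen.mem_nhds hx)
    have h1 : (fun y => totalFlux δ k Gε Φ w y (t + τ)
          - totalFlux δ k Gε Φ (fun x t => w x (t + τ)) y t)
        = fun y => Φ y (t + τ) (w y (t + τ)) - Φ y t (w y (t + τ)) := by
      funext y
      simp only [totalFlux, penalty, spaceGrad]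
      abel
    have h2 := divergence_sub hA₁ hA₀
    rw [h1, divergence_sub hd₁ hd₀] at h2
    rw [htd, h.law.equation x hx _ (hI t ht), h2]
    ring

/-- The modulus of continuity in time, in `L¹(Ω)`. -/
theorem integral_abs_sub_shift_le
    (h : IsBoundedSolution Ω T δ ε k Gε Φ f v₀ w c₁ c₂ M L lam)
    (hv : IsRegularizedInitial Ω Gε u₀ du₀ C₀ δ v₀) (hvM : ∀ x ∈ Ω, |v₀ x| ≤ M)
    (hdu : IntegrableOn du₀ Ω) (hτ : 0 < τ) (hτT : 2 * τ ≤ T) {b : ℝ}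
    (hb : b ∈ Ioo 0 (T - τ)) :
    ∫ x in Ω, |w x (b + τ) - w x b| ≤ τ * (Real.exp (L * T) *
      (2 * (2 * L * volume.real Ω + C₀ + L * ∫ x in Ω, ‖du₀ x‖) +
        L * (2 * (volume.real Ω * T) + ∫ p in cylinder Ω T, ‖spaceGrad w p.1 p.2‖))) := by
  have hL := h.bound.pos
  have hT := h.T_pos
  have hST : T - τ ≤ T := by linarith
  have hsub : cylinder Ω (T - τ) ⊆ cylinder Ω T := prod_mono_right (Ioo_subset_Ioo le_rfl hST)
  have hI : ∀ t ∈ Ioo 0 (T - τ), t + τ ∈ Ioo 0 T := fun t ht =>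
    ⟨by linarith [ht.1], by linarith [ht.2]⟩
  have hI' : ∀ t ∈ Ioo 0 (T - τ), t ∈ Ioo 0 T := fun t ht => ⟨ht.1, by linarith [ht.2]⟩
  have hgn : IntegrableOn (fun p : Space N × ℝ => ‖spaceGrad w p.1 p.2‖) (cylinder Ω T) :=
    h.integrableOn_spaceGrad.norm
  have hgs : IntegrableOn (fun p : Space N × ℝ => ‖spaceGrad w p.1 (p.2 + τ)‖)
      (cylinder Ω (T - τ)) :=
    integrableOn_shift (φ := fun x t => ‖spaceGrad w x t‖) hτ hgn
  have hc2 : IntegrableOn (fun _ : Space N × ℝ => (2 : ℝ)) (cylinder Ω T) :=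
    integrableOn_const h.volume_cylinder_lt_top.ne
  have hei : IntegrableOn (fun p : Space N × ℝ => 2 + ‖spaceGrad w p.1 (p.2 + τ)‖)
      (cylinder Ω (T - τ)) := (hc2.mono_set hsub).add hgs
  have key := integral_abs_sub_le (S := T - τ) (L' := L) (M := M)
    (e := fun p => L * τ * (2 + ‖spaceGrad w p.1 (p.2 + τ)‖)) h.isOpen h.bounded hST
    h.pen h.δ_pos h.smooth h.bound (h.law_shift hτ) (h.law.mono hST)
    (fun x hx t ht => h.abs_le x hx _ (hI t ht)) (fun x hx t ht => h.abs_le x hx t (hI' t ht))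
    (integrableOn_shift (φ := penalty k Gε w) hτ h.integrableOn_penalty)
    (h.integrableOn_penalty.mono_set hsub)
    (integrableOn_shift (φ := spaceGrad w) hτ h.integrableOn_spaceGrad)
    (h.integrableOn_spaceGrad.mono_set hsub) (fun p _ => by positivity)
    (hei.const_mul (L * τ)) hL.le
    (fun x hx t ht => by
      have h1 := h.bound.source_sub x hx t (hI' t ht) _ (hI t ht) _
        (mem_Ioo_of_abs_le (h.abs_le x hx t (hI' t ht))) _
        (mem_Ioo_of_abs_le (h.abs_le x hx _ (hI t ht))) (by linarith)
      have h2 := h.bound.flux_div_sub x hx t (hI' t ht) _ (hI t ht) (by linarith)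
        (fun y => w y (t + τ)) (h.law.differentiableAt h.isOpen hx (hI t ht))
        (mem_Ioo_of_abs_le (h.abs_le x hx _ (hI t ht)))
      rw [add_sub_cancel_left] at h1 h2
      rw [add_sub_right_comm]
      refine (abs_add_le _ _).trans ((add_le_add h1 h2).trans (le_of_eq ?_))
      simp only [spaceGrad]
      ring) hb
  have h0 : ∫ x in Ω, |w x (0 + τ) - w x 0| = ∫ x in Ω, |w x τ - v₀ x| :=
    setIntegral_congr_fun h.isOpen.measurableSet fun x hx => by
      simp only [zero_add, h.sol.initial x hx]
  have h1 := h.integral_abs_sub_initial_le hv hvM hdu hτ hτT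
  have h2 : ∫ p in cylinder Ω (T - τ), (2 + ‖spaceGrad w p.1 (p.2 + τ)‖)
      ≤ 2 * (volume.real Ω * T) + ∫ p in cylinder Ω T, ‖spaceGrad w p.1 p.2‖ := by
    refine (setIntegral_shift_le (φ := fun x t => 2 + ‖spaceGrad w x t‖) hτ
      (fun x t => by positivity) (hc2.add hgn)).trans (le_of_eq ?_)
    rw [integral_add hc2 hgn, setIntegral_const, h.volume_real_cylinder, smul_eq_mul]
    ring
  rw [h0, integral_const_mul] at key
  refine key.trans ?_
  rw [mul_left_comm]
  refine mul_le_mul (Real.exp_le_exp.2 (mul_le_mul_of_nonneg_left (by linarith [hb.2]) hL.le)) ?_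
    ?_ (Real.exp_pos _).le
  · have h3 := mul_le_mul_of_nonneg_left h2 (mul_pos hL hτ).le
    linarith
  · refine add_nonneg (integral_nonneg fun x => abs_nonneg _)
      (mul_nonneg (by positivity) (integral_nonneg fun p => by positivity))

/-- The bound of `∂ₜw` in `L¹(Ω)`, by Fatou's lemma applied to difference quotients. -/
theorem lintegral_timeDeriv_le
    (h : IsBoundedSolution Ω T δ ε k Gε Φ f v₀ w c₁ c₂ M L lam)
    (hv : IsRegularizedInitial Ω Gε u₀ du₀ C₀ δ v₀) (hvM : ∀ x ∈ Ω, |v₀ x| ≤ M)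
    (hdu : IntegrableOn du₀ Ω) {b : ℝ} (hb : b ∈ Ioo 0 T) :
    ∫⁻ x in Ω, ‖timeDeriv w x b‖ₑ ≤ ENNReal.ofReal (Real.exp (L * T) *
      (2 * (2 * L * volume.real Ω + C₀ + L * ∫ x in Ω, ‖du₀ x‖) +
        L * (2 * (volume.real Ω * T) + ∫ p in cylinder Ω T, ‖spaceGrad w p.1 p.2‖))) := by
  set B := Real.exp (L * T) *
      (2 * (2 * L * volume.real Ω + C₀ + L * ∫ x in Ω, ‖du₀ x‖) +
        L * (2 * (volume.real Ω * T) + ∫ p in cylinder Ω T, ‖spaceGrad w p.1 p.2‖))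
  have hT := h.T_pos
  -- steps `τ n ≤ s` for which `2 τ ≤ T` and `b + τ < T`
  set s := min (T / 2) ((T - b) / 2) with hs
  have hs0 : 0 < s := lt_min (by linarith) (by linarith [hb.2])
  set τ : ℕ → ℝ := fun n => s * (1 / ((n : ℝ) + 1)) with hτ
  have hτ0 : ∀ n, 0 < τ n := fun n => by positivity
  have hτs : ∀ n, τ n ≤ s := fun n => by
    refine mul_le_of_le_one_right hs0.le ?_
    rw [div_le_one (by positivity)]
    linarith [(Nat.cast_nonneg n : (0 : ℝ) ≤ n)]
  have hs1 : s ≤ T / 2 := min_le_left _ _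
  have hs2 : s ≤ (T - b) / 2 := min_le_right _ _
  have hlim : Tendsto τ atTop (𝓝[≠] 0) := by
    refine tendsto_nhdsWithin_iff.2 ⟨?_, Eventually.of_forall fun n => (hτ0 n).ne'⟩
    have h1 := (tendsto_one_div_add_atTop_nhds_zero_nat (𝕜 := ℝ)).const_mul s
    rwa [mul_zero] at h1
  have hbτ : ∀ n, b + τ n ∈ Ioo 0 T := fun n =>
    ⟨by linarith [hb.1, hτ0 n], by linarith [hb.2, hτs n]⟩
  have hi : ∀ n, IntegrableOn (fun x => w x (b + τ n) - w x b) Ω := fun n =>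
    (h.law.integrableOn_comp h.bounded (Ioo_subset_Icc_self (hbτ n)) continuous_id).sub
      (h.law.integrableOn_comp h.bounded (Ioo_subset_Icc_self hb) continuous_id)
  have hbound : ∀ n, ∫⁻ x in Ω, ‖(τ n)⁻¹ • (w x (b + τ n) - w x b)‖ₑ ≤ ENNReal.ofReal B := by
    intro n
    have h1 := h.integral_abs_sub_shift_le hv hvM hdu (hτ0 n) (by linarith [hτs n])
      (b := b) ⟨hb.1, by linarith [hτs n, hb.2]⟩
    have hi' : IntegrableOn (fun x => (τ n)⁻¹ • (w x (b + τ n) - w x b)) Ω :=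
      (hi n).smul (τ n)⁻¹
    rw [← ofReal_integral_norm_eq_lintegral_enorm hi']
    refine ENNReal.ofReal_le_ofReal ?_
    simp only [norm_smul, norm_inv, Real.norm_eq_abs, abs_of_pos (hτ0 n)]
    rw [integral_const_mul, inv_mul_le_iff₀ (hτ0 n)]
    exact h1
  calc ∫⁻ x in Ω, ‖timeDeriv w x b‖ₑ
      = ∫⁻ x in Ω, liminf (fun n => ‖(τ n)⁻¹ • (w x (b + τ n) - w x b)‖ₑ) atTop := by
        refine setLIntegral_congr_fun h.isOpen.measurableSet fun x hx => ?_
        have h2 := (h.sol.diff_time x hx b hb).hasDerivAt.tendsto_slope_zero.comp hlim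
        exact h2.enorm.liminf_eq.symm
    _ ≤ liminf (fun n => ∫⁻ x in Ω, ‖(τ n)⁻¹ • (w x (b + τ n) - w x b)‖ₑ) atTop :=
        lintegral_liminf_le' fun n => ((hi n).smul (τ n)⁻¹).1.enorm
    _ ≤ ENNReal.ofReal B := liminf_le_of_frequently_le' (Frequently.of_forall hbound)

/-- There is a regularized initial datum only if `C₀ ≥ 0`. -/
theorem nonneg_C₀ (h : IsBoundedSolution Ω T δ ε k Gε Φ f v₀ w c₁ c₂ M L lam)
    (hv : IsRegularizedInitial Ω Gε u₀ du₀ C₀ δ v₀) : 0 ≤ C₀ := by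
  have h1 := (integral_nonneg fun x => abs_nonneg _).trans hv.laplacian_le
  have h2 := mul_nonneg h1 h.δ_pos.le
  rwa [div_mul_cancel₀ _ h.δ_pos.ne'] at h2

theorem lintegral_timeDeriv_le_div
    (h : IsBoundedSolution Ω T δ ε k Gε Φ f v₀ w c₁ c₂ M L lam)
    (hv : IsRegularizedInitial Ω Gε u₀ du₀ C₀ δ v₀) (hvM : ∀ x ∈ Ω, |v₀ x| ≤ M)
    (hdu : IntegrableOn du₀ Ω) {b : ℝ} (hb : b ∈ Ioo 0 T) :
    ∫⁻ x in Ω, ‖timeDeriv w x b‖ₑ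
      ≤ ENNReal.ofReal (timeDerivConst Ω T M L C₀ (∫ x in Ω, ‖du₀ x‖) / δ) := by
  refine (h.lintegral_timeDeriv_le hv hvM hdu hb).trans (ENNReal.ofReal_le_ofReal ?_)
  have hδ := h.δ_pos
  have hL := h.bound.pos
  have hT := h.T_pos
  have hC := h.nonneg_C₀ hv
  have hI := h.integral_norm_spaceGrad_le
  have hd : 0 ≤ ∫ x in Ω, ‖du₀ x‖ := integral_nonneg fun x => norm_nonneg _
  have hle : ∀ a : ℝ, 0 ≤ a → a ≤ a / δ := fun a ha => by
    rw [le_div_iff₀ hδ]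
    exact mul_le_of_le_one_right ha h.δ_lt.le
  rw [timeDerivConst, mul_div_assoc, add_div, mul_div_assoc L, add_div]
  have h1 := hle (2 * (2 * L * volume.real Ω + C₀ + L * ∫ x in Ω, ‖du₀ x‖)) (by positivity)
  have h2 := hle (2 * (volume.real Ω * T)) (by positivity)
  gcongr

end IsBoundedSolution

end TimeDerivative

/-! ### The penalty and the `L^q` norms of the gradient -/

section UniformBounds

variable {N : ℕ} {Ω : Set (Space N)} {T δ ε c₁ c₂ L M lam C₀ : ℝ} {k : ℝ → ℝ}
  {Gε : Space N → ℝ → ℝ} {Φ : Space N → ℝ → ℝ → Space N} {f : Space N → ℝ → ℝ → ℝ}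
  {v₀ u₀ : Space N → ℝ} {du₀ : Space N → Space N} {w : Space N → ℝ → ℝ}

/-- A bound of `δ` times the energy at a fixed time. -/
noncomputable def sliceEnergyConst (Ω : Set (Space N)) (T M L C₀ I₀ : ℝ) : ℝ :=
  (L ^ 2 + L * M) * volume.real Ω + M * timeDerivConst Ω T M L C₀ I₀

/-- A bound of `δ²` times the `L¹(Ω)` norm of the penalty at a fixed time. -/
noncomputable def penaltyConst (Ω : Set (Space N)) (T M L C₀ I₀ lam : ℝ) : ℝ :=
  volume.real Ω + 2 / lam ^ 2 * sliceEnergyConst Ω T M L C₀ I₀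

theorem timeDerivConst_nonneg (hT : 0 ≤ T) (hM : 0 ≤ M) (hL : 0 ≤ L) (hC : 0 ≤ C₀) {I₀ : ℝ}
    (hI : 0 ≤ I₀) : 0 ≤ timeDerivConst Ω T M L C₀ I₀ := by
  unfold timeDerivConst energyConst
  positivity

/-- The penalty controls every power of the gradient, uniformly in `ε`: with `s = a² - g²` and
`y = 1 + Λ² + max s 0 ≥ a²`, one has `a^q ≤ y^m ≤ m! e^y` for `m = ⌈q/2⌉`, and
`e^{max s 0} ≤ e k(s)`, as `k ≥ 1` and `k(s) = e^{s/ε} ≥ e^s` for `s ≥ ε`. -/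
theorem exists_rpow_norm_le_penalty (Λ : ℝ) {q : ℝ} (hq : 0 ≤ q) :
    ∃ c, 0 < c ∧ ∀ (ε : ℝ) (k : ℝ → ℝ), 0 < ε → ε < 1 → IsPenalty ε k →
      ∀ a g : ℝ, 0 ≤ a → 0 ≤ g → g ≤ Λ → a ^ q ≤ c * k (a ^ 2 - g ^ 2) := by
  set m := ⌈q / 2⌉₊ with hm
  refine ⟨m.factorial * Real.exp (2 + Λ ^ 2), by positivity, ?_⟩
  intro ε k hε hε1 hk a g ha hg hgΛ
  set s := a ^ 2 - g ^ 2 with hs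
  set y := 1 + Λ ^ 2 + max s 0 with hy
  have hmax : s ≤ max s 0 := le_max_left _ _
  have hmax0 : 0 ≤ max s 0 := le_max_right _ _
  have hy1 : 1 ≤ y := by nlinarith [sq_nonneg Λ]
  have hay : a ^ 2 ≤ y := by
    have : g ^ 2 ≤ Λ ^ 2 := pow_le_pow_left₀ hg hgΛ 2
    linarith
  have h1 : a ^ q ≤ y ^ m := by
    calc a ^ q = (a ^ 2) ^ (q / 2) := by
          rw [← Real.rpow_natCast, ← Real.rpow_mul ha]
          congr 1
          push_cast
          ring
      _ ≤ y ^ (q / 2) := Real.rpow_le_rpow (by positivity) hay (by linarith)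
      _ ≤ y ^ (m : ℝ) := Real.rpow_le_rpow_of_exponent_le hy1 (Nat.le_ceil _)
      _ = y ^ m := Real.rpow_natCast _ _
  have h2 : y ^ m ≤ m.factorial * Real.exp y := by
    have := Real.pow_div_factorial_le_exp y (by linarith) m
    rwa [div_le_iff₀' (by positivity)] at this
  have h3 : Real.exp (max s 0) ≤ Real.exp 1 * k s := by
    rcases le_total s ε with hsε | hsε
    · have h4 : Real.exp (max s 0) ≤ Real.exp 1 :=
        Real.exp_le_exp.2 (max_le (hsε.trans hε1.le) zero_le_one)
      exact h4.trans (le_mul_of_one_le_right (Real.exp_pos 1).le (hk.one_le s))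
    · rw [hk.eq_exp s hsε, max_eq_left (hε.le.trans hsε)]
      have h5 : s ≤ s / ε := le_div_self (hε.le.trans hsε) hε hε1.le
      exact (Real.exp_le_exp.2 h5).trans
        (le_mul_of_one_le_left (Real.exp_pos _).le (Real.one_le_exp zero_le_one))
  calc a ^ q ≤ m.factorial * Real.exp y := h1.trans h2
    _ = m.factorial * Real.exp (1 + Λ ^ 2) * Real.exp (max s 0) := by
        rw [hy, Real.exp_add]; ring
    _ ≤ m.factorial * Real.exp (1 + Λ ^ 2) * (Real.exp 1 * k s) := by gcongr
    _ = m.factorial * Real.exp (2 + Λ ^ 2) * k s := by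
        rw [show (2 : ℝ) + Λ ^ 2 = (1 + Λ ^ 2) + 1 by ring, Real.exp_add (1 + Λ ^ 2) 1]; ring

namespace IsBoundedSolution

theorem lintegral_energyDensity_slice_le
    (h : IsBoundedSolution Ω T δ ε k Gε Φ f v₀ w c₁ c₂ M L lam)
    (hv : IsRegularizedInitial Ω Gε u₀ du₀ C₀ δ v₀) (hvM : ∀ x ∈ Ω, |v₀ x| ≤ M)
    (hdu : IntegrableOn du₀ Ω) {t : ℝ} (ht : t ∈ Ioo 0 T) :
    ∫⁻ x in Ω, ENNReal.ofReal (energyDensity δ k Gε w (x, t))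
      ≤ ENNReal.ofReal (sliceEnergyConst Ω T M L C₀ (∫ x in Ω, ‖du₀ x‖) / δ) := by
  have hδ := h.δ_pos
  have hL := h.bound.pos
  have hM : 0 ≤ M := zero_le_one.trans h.one_le
  have hd : 0 ≤ ∫ x in Ω, ‖du₀ x‖ := integral_nonneg fun x => norm_nonneg _
  have hB := timeDerivConst_nonneg (Ω := Ω) h.T_pos.le hM hL.le (h.nonneg_C₀ hv) hd
  refine (h.law.lintegral_energy_slice_le h.isOpen h.bounded h.continuousOn_energyDensity
    (fun p _ => h.energyDensity_nonneg p) ?_ (q := L ^ 2 / (2 * δ)) (γ := L) (M := M)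
    (by positivity) h.abs_le (fun x hx t ht => h.energyDensity_sub_le hx ht)
    (fun x hx t ht => h.bound.source x hx t ht _
      (mem_Ioo_of_abs_le (h.abs_le x hx t ht))) ht).trans ?_
  · intro x _ t _ h0
    simp [energyDensity, h0]
  · refine (add_le_add le_rfl (mul_le_mul_right
      (h.lintegral_timeDeriv_le_div hv hvM hdu ht) _)).trans ?_
    rw [← ENNReal.ofReal_mul hM, ← ENNReal.ofReal_add (by positivity) (by positivity)]
    refine ENNReal.ofReal_le_ofReal ?_
    rw [sliceEnergyConst, add_div, mul_div_assoc M]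
    refine add_le_add ?_ le_rfl
    rw [mul_div_right_comm]
    refine mul_le_mul_of_nonneg_right ?_ measureReal_nonneg
    rw [add_div]
    refine add_le_add ?_ ?_
    · refine div_le_div_of_nonneg_left (by positivity) hδ (by linarith)
    · rw [le_div_iff₀ hδ]
      exact mul_le_of_le_one_right (by positivity) h.δ_lt.le

theorem lintegral_penalty_slice_le
    (h : IsBoundedSolution Ω T δ ε k Gε Φ f v₀ w c₁ c₂ M L lam)
    (hv : IsRegularizedInitial Ω Gε u₀ du₀ C₀ δ v₀) (hvM : ∀ x ∈ Ω, |v₀ x| ≤ M)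
    (hdu : IntegrableOn du₀ Ω) {t : ℝ} (ht : t ∈ Ioo 0 T) :
    ∫⁻ x in Ω, ENNReal.ofReal (penalty k Gε w x t)
      ≤ ENNReal.ofReal (penaltyConst Ω T M L C₀ (∫ x in Ω, ‖du₀ x‖) lam / δ ^ 2) := by
  have hδ := h.δ_pos
  have hl := h.lam_pos
  have hL := h.bound.pos
  have hM : 0 ≤ M := zero_le_one.trans h.one_le
  have hd : 0 ≤ ∫ x in Ω, ‖du₀ x‖ := integral_nonneg fun x => norm_nonneg _
  have hB := timeDerivConst_nonneg (Ω := Ω) h.T_pos.le hM hL.le (h.nonneg_C₀ hv) hd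
  have hE : 0 ≤ sliceEnergyConst Ω T M L C₀ (∫ x in Ω, ‖du₀ x‖) := by
    unfold sliceEnergyConst; positivity
  have hc : 0 ≤ 2 / (δ * lam ^ 2) := by positivity
  calc ∫⁻ x in Ω, ENNReal.ofReal (penalty k Gε w x t)
      ≤ ∫⁻ x in Ω, (1 + ENNReal.ofReal (2 / (δ * lam ^ 2))
          * ENNReal.ofReal (energyDensity δ k Gε w (x, t))) := by
        refine lintegral_mono fun x => ?_
        rw [← ENNReal.ofReal_mul hc, ← ENNReal.ofReal_one,
          ← ENNReal.ofReal_add zero_le_one (mul_nonneg hc (h.energyDensity_nonneg _))]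
        exact ENNReal.ofReal_le_ofReal (h.penalty_le (x, t))
    _ = volume Ω + ENNReal.ofReal (2 / (δ * lam ^ 2))
          * ∫⁻ x in Ω, ENNReal.ofReal (energyDensity δ k Gε w (x, t)) := by
        rw [lintegral_add_left measurable_const, lintegral_const_mul' _ _ ENNReal.ofReal_ne_top,
          setLIntegral_const, one_mul]
    _ ≤ ENNReal.ofReal (volume.real Ω) + ENNReal.ofReal (2 / (δ * lam ^ 2))
          * ENNReal.ofReal (sliceEnergyConst Ω T M L C₀ (∫ x in Ω, ‖du₀ x‖) / δ) := by
        refine add_le_add (le_of_eq ?_)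
          (mul_le_mul_right (h.lintegral_energyDensity_slice_le hv hvM hdu ht) _)
        rw [measureReal_def, ENNReal.ofReal_toReal (volume_lt_top_of_bounded h.bounded).ne]
    _ ≤ _ := by
        rw [← ENNReal.ofReal_mul hc, ← ENNReal.ofReal_add measureReal_nonneg (by positivity)]
        refine ENNReal.ofReal_le_ofReal ?_
        rw [penaltyConst, add_div]
        refine add_le_add ?_ (le_of_eq ?_)
        · rw [le_div_iff₀ (by positivity)]
          exact mul_le_of_le_one_right measureReal_nonneg (pow_le_one₀ hδ.le h.δ_lt.le)
        · field_simp

theorem penaltyConst_nonneg (h : IsBoundedSolution Ω T δ ε k Gε Φ f v₀ w c₁ c₂ M L lam)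
    (hC : 0 ≤ C₀) {I₀ : ℝ} (hI : 0 ≤ I₀) : 0 ≤ penaltyConst Ω T M L C₀ I₀ lam := by
  have hL := h.bound.pos
  have hM : 0 ≤ M := zero_le_one.trans h.one_le
  have hB := timeDerivConst_nonneg (Ω := Ω) h.T_pos.le hM hL.le hC hI
  unfold penaltyConst sliceEnergyConst
  positivity

/-- The `L^q` bound of the gradient at a fixed time, from the bound of the penalty. -/
theorem eLpNorm_spaceGrad_slice_le
    (h : IsBoundedSolution Ω T δ ε k Gε Φ f v₀ w c₁ c₂ M L lam)
    (hv : IsRegularizedInitial Ω Gε u₀ du₀ C₀ δ v₀) (hvM : ∀ x ∈ Ω, |v₀ x| ≤ M)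
    (hdu : IntegrableOn du₀ Ω) {q c : ℝ} (hq : 1 ≤ q) (hc : 0 ≤ c) {t : ℝ} (ht : t ∈ Ioo 0 T)
    (hpow : ∀ x ∈ Ω, ‖spaceGrad w x t‖ ^ q ≤ c * penalty k Gε w x t) :
    eLpNorm (fun x => spaceGrad w x t) (ENNReal.ofReal q) (volume.restrict Ω)
      ≤ ENNReal.ofReal
        (max 1 (c * penaltyConst Ω T M L C₀ (∫ x in Ω, ‖du₀ x‖) lam) / δ ^ 2) := by
  have hδ := h.δ_pos
  have hq0 : 0 < q := zero_lt_one.trans_le hq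
  have hd : 0 ≤ ∫ x in Ω, ‖du₀ x‖ := integral_nonneg fun x => norm_nonneg _
  have hP := h.penaltyConst_nonneg (h.nonneg_C₀ hv) hd
  set K := penaltyConst Ω T M L C₀ (∫ x in Ω, ‖du₀ x‖) lam
  have hδ2 : δ ^ 2 ≤ 1 := pow_le_one₀ hδ.le h.δ_lt.le
  -- a number at least `1` dominates its `q`-th root
  have hX : 1 ≤ max 1 (c * K) / δ ^ 2 := by
    rw [one_le_div (by positivity)]
    exact hδ2.trans (le_max_left _ _)
  have h1 : ∫⁻ x in Ω, ‖spaceGrad w x t‖ₑ ^ q ≤ ENNReal.ofReal (max 1 (c * K) / δ ^ 2) := by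
    calc ∫⁻ x in Ω, ‖spaceGrad w x t‖ₑ ^ q
        ≤ ∫⁻ x in Ω, ENNReal.ofReal c * ENNReal.ofReal (penalty k Gε w x t) := by
          refine lintegral_mono_ae ?_
          filter_upwards [ae_restrict_mem h.isOpen.measurableSet] with x hx
          rw [← ENNReal.ofReal_mul hc, ← ofReal_norm,
            ENNReal.ofReal_rpow_of_nonneg (norm_nonneg _) hq0.le]
          exact ENNReal.ofReal_le_ofReal (hpow x hx)
      _ = ENNReal.ofReal c * ∫⁻ x in Ω, ENNReal.ofReal (penalty k Gε w x t) :=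
          lintegral_const_mul' _ _ ENNReal.ofReal_ne_top
      _ ≤ ENNReal.ofReal c * ENNReal.ofReal (K / δ ^ 2) :=
          mul_le_mul_right (h.lintegral_penalty_slice_le hv hvM hdu ht) _
      _ ≤ ENNReal.ofReal (max 1 (c * K) / δ ^ 2) := by
          rw [← ENNReal.ofReal_mul hc, ← mul_div_assoc]
          exact ENNReal.ofReal_le_ofReal
            (div_le_div_of_nonneg_right (le_max_right _ _) (by positivity))
  rw [eLpNorm_eq_lintegral_rpow_enorm_toReal (by simpa using hq0) ENNReal.ofReal_ne_top,
    ENNReal.toReal_ofReal hq0.le]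
  refine (ENNReal.rpow_le_rpow h1 (by positivity)).trans ?_
  rw [ENNReal.ofReal_rpow_of_nonneg (zero_le_one.trans hX) (by positivity)]
  refine ENNReal.ofReal_le_ofReal ?_
  calc _ ≤ (max 1 (c * K) / δ ^ 2) ^ (1 : ℝ) :=
        Real.rpow_le_rpow_of_exponent_le hX ((div_le_one hq0).2 hq)
    _ = _ := Real.rpow_one _

end IsBoundedSolution

theorem normLinftyLq_le {F : Type*} [NormedAddCommGroup F] {q B : ℝ≥0∞}
    {g : Space N → ℝ → F}
    (h : ∀ t ∈ Ioo 0 T, eLpNorm (fun x => g x t) q (volume.restrict Ω) ≤ B) :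
    normLinftyLq Ω T q g ≤ B :=
  essSup_le_of_ae_le _ (by
    filter_upwards [ae_restrict_mem measurableSet_Ioo] with t ht using h t ht)

end UniformBounds

end GradConstraint

open GradConstraint

theorem mainTheorem7 {N : ℕ} (Ω : Set (Space N)) (hΩo : IsOpen Ω)
    (hΩb : Bornology.IsBounded Ω) (hΩL : HasLipschitzBoundary Ω) (T : ℝ) (hT : 0 < T)
    (Φ : Space N → ℝ → ℝ → Space N) (f : Space N → ℝ → ℝ → ℝ) (c₁ c₂ : ℝ)
    (hΦf : IsAdmissibleFluxSource Ω T Φ f c₁ c₂)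
    (lam : ℝ) (G : Space N → ℝ → ℝ) (hG : IsThreshold Ω lam G)
    -- an extension of `G` to the whole space, used in the mollification
    (Gext : Space N → ℝ → ℝ) (hGext : IsThreshold univ lam Gext)
    (hGG : ∀ x ∈ Ω, ∀ u : ℝ, Gext x u = G x u)
    (u₀ : Space N → ℝ) (du₀ : Space N → Space N) (hu₀ : IsAdmissibleInitial Ω G u₀ du₀)
    (C₀ : ℝ) :
    ∃ (C₁ C₂ K C : ℝ) (D : ℝ → ℝ),
      0 < C₁ ∧ 0 < C₂ ∧ 0 < K ∧ 0 < C ∧ (∀ q, 0 < D q) ∧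
      ∀ (ε δ : ℝ), 0 < ε → ε < 1 → 0 < δ → δ < 1 →
      ∀ (k : ℝ → ℝ) (ρ : Space N × ℝ → ℝ) (v₀ : Space N → ℝ) (w : Space N → ℝ → ℝ),
        IsPenalty ε k → IsMollifier ε ρ →
        IsRegularizedInitial Ω (mollified Gext ρ) u₀ du₀ C₀ δ v₀ →
        IsClassicalSolution Ω T δ k (mollified Gext ρ) Φ f v₀ w →
        (∀ x ∈ Ω, ∀ t ∈ Set.Ioo 0 T, |w x t| ≤ boundM Ω T u₀ c₁ c₂) ∧
        normLinftyLq Ω T 1 (timeDeriv w) ≤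
          ENNReal.ofReal (Real.exp (C₂ * T)) * (ENNReal.ofReal C₁ + ENNReal.ofReal K *
            eLpNorm (fun z : Space N × ℝ => spaceGrad w z.1 z.2) 1
              (volume.restrict (cylinder Ω T))) ∧
        normLinftyLq Ω T 1 (penalty k (mollified Gext ρ) w) ≤ ENNReal.ofReal (C / δ ^ 2) ∧
        ∀ q : ℝ, 2 ≤ q →
          normLinftyLq Ω T (ENNReal.ofReal q) (spaceGrad w) ≤ ENNReal.ofReal (D q / δ ^ 2) := by
  -- all constants are fixed before `ε`, `δ` and the regularizations
  set M := boundM Ω T u₀ c₁ c₂ with hMdef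
  have hmM : supNorm Ω u₀ + 1 ≤ M := supNorm_add_one_le_boundM hT hΦf.c₁_pos u₀
  have hM1 : 1 ≤ M := by linarith [supNorm_nonneg Ω u₀]
  obtain ⟨L, hL⟩ := hΦf.exists_bound (R := M + 1) hΩo (by linarith)
  have hL0 := hL.pos
  -- `|u| < M + 1` covers the range of `w` enlarged by the support of the mollifier
  obtain ⟨Λ, -, hΛ⟩ := hGext.exists_ae_abs_le (M + 1)
  have hfin : IsFiniteMeasure (volume.restrict Ω) :=
    ⟨by simpa using volume_lt_top_of_bounded hΩb⟩
  have hdu : IntegrableOn du₀ Ω := hu₀.sobolev.grad_memLp.integrable one_le_two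
  set I₀ := ∫ x in Ω, ‖du₀ x‖
  have hI₀ : 0 ≤ I₀ := integral_nonneg fun x => norm_nonneg _
  choose c hc0 hc using fun q : ℝ => exists_rpow_norm_le_penalty Λ (abs_nonneg q)
  refine ⟨2 * (2 * L * volume.real Ω + |C₀| + L * I₀) + L * (2 * (volume.real Ω * T)) + 1, L, L,
    max 1 (penaltyConst Ω T M L C₀ I₀ lam),
    fun q => max 1 (c q * penaltyConst Ω T M L C₀ I₀ lam), by positivity, hL0, hL0,
    by positivity, fun q => by positivity, ?_⟩
  intro ε δ hε hε1 hδ hδ1 k ρ v₀ w hk hρ hv hw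
  have hsm := contDiff_mollified hGext hρ
  have hB : IsBoundedSolution Ω T δ ε k (mollified Gext ρ) Φ f v₀ w c₁ c₂ M L lam :=
    { isOpen := hΩo, bounded := hΩb, T_pos := hT, δ_pos := hδ, δ_lt := hδ1, adm := hΦf, pen := hk
      smooth := hsm, lam_pos := hGext.lam_pos, lower := fun x u => le_mollified hGext hρ x u
      sol := hw, one_le := hM1, bound := hL
      abs_le := fun x hx t ht => hw.abs_le_boundM hΩo hΩb hδ hΦf hk hsm hv.sup_le hx ht }
  have hvM : ∀ x ∈ Ω, |v₀ x| ≤ M := fun x hx => (hv.sup_le x hx).trans hmM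
  refine ⟨hB.abs_le, normLinftyLq_le fun t ht => ?_, normLinftyLq_le fun t ht => ?_,
    fun q hq => normLinftyLq_le fun t ht => ?_⟩
  · rw [eLpNorm_one_eq_lintegral_enorm, eLpNorm_one_eq_lintegral_enorm,
      ← ofReal_integral_norm_eq_lintegral_enorm hB.integrableOn_spaceGrad,
      ← ENNReal.ofReal_mul hL0.le, ← ENNReal.ofReal_add (by positivity)
        (mul_nonneg hL0.le (integral_nonneg fun p => norm_nonneg _)),
      ← ENNReal.ofReal_mul (Real.exp_pos _).le]
    refine (hB.lintegral_timeDeriv_le hv hvM hdu ht).trans (ENNReal.ofReal_le_ofReal ?_)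
    refine mul_le_mul_of_nonneg_left ?_ (Real.exp_pos _).le
    linarith [le_abs_self C₀]
  · rw [eLpNorm_one_eq_lintegral_enorm]
    simp only [Real.enorm_of_nonneg (zero_le_one.trans (hB.one_le_penalty _ t))]
    refine (hB.lintegral_penalty_slice_le hv hvM hdu ht).trans (ENNReal.ofReal_le_ofReal ?_)
    exact div_le_div_of_nonneg_right (le_max_right _ _) (by positivity)
  · refine hB.eLpNorm_spaceGrad_slice_le hv hvM hdu (by linarith) (hc0 q).le ht fun x hx => ?_
    have h1 := hc q ε k hε hε1 hk ‖spaceGrad w x t‖ (mollified Gext ρ x (w x t)) (norm_nonneg _)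
      (hGext.lam_pos.le.trans (le_mollified hGext hρ x _))
      (mollified_le hGext hρ hε1 hΛ x (hB.abs_le x hx t ht))
    rwa [abs_of_nonneg (by linarith : (0 : ℝ) ≤ q)] at h1
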